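/- Let $F$ be a finite field with $q$ elements and $n\in\mathbb N$. The spherical building $\mathcal S$ of $SL_n(F)$ is the simplicial complex whose vertices are the linear subspaces $0\ne W\subsetneq F^n$, coloured by their dimension, and whose faces are the flags; its top-level faces (complete flags) carry the uniform distribution. For a set $I=\{i_0<i_1<i_2<i_3\}\subseteq\{1,\dots,n-1\}$ let $\mathcal S^I$ be the $4$-partite complex of flags of subspaces with dimensions in $I$; a random top-level face of $\mathcal S^I$ is the part with dimensions in $I$ of a random complete flag. A random oriented edge (triangle) of $\mathcal S^I$ is a uniformly random ordered pair (triple) of distinct vertices of a random top-level face. For a complex $X$ of this kind and a group $\Gamma$, a $1$-cochain is a function $f$ from the oriented edges of $X$ to $\Gamma$ with $f(u,v)=f(v,u)^{-1}$. Its coboundary is $\delta f(u,v,w)=f(u,v)f(v,w)f(w,u)$ on oriented triangles, and $Z^1(X,\Gamma)$ is the set of $f$ with $\delta f\equiv 1$. Let $\mathrm{dist}(f,g)$ be the probability that $f$ and $g$ differ on a random oriented edge, and $\mathrm{wt}(\delta f)$ the probability that $\delta f\neq 1$ on a random oriented triangle. For $\beta>0$ write $h^1(X)\ge\beta$ if for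 every group $\Gamma$ and every $1$-cochain $f$ there is $g\in Z^1(X,\Gamma)$ with $\beta\,\mathrm{dist}(f,g)\le \mathrm{wt}(\delta f)$. Lemma. There is an absolute constant $C>0$ such that for every $n$ there is $q_0=q_0(n)$ with the following property. Let $F$ be a finite field with $q\ge q_0$ elements, let $\mathcal S$ be the spherical building of $SL_n(F)$, and let $1\le i_0<i_1<i_2<i_3<n$ be integers with $i_3>21$ and $i_j-i_{j-1}\ge 3$ for $j=1,2,3$. Then, with $I=\{i_0,i_1,i_2,i_3\}$, $$h^1(\mathcal S^I)\ \ge\ \exp\left(-C\left(1+\log\left(\frac{i_3}{i_1-i_0}\right)\cdot\log\left(\frac{i_3}{i_1}\right)\right)\right).$$ -/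

import Mathlib

open Finset

universe u v

noncomputable section

/-- A finite pure simplicial complex on the vertex type `V` whose top-level faces have `m` vertices
(so it has dimension `m - 1`), with a probability density on its top-level faces.  The faces
are the subsets of the top-level faces. -/
structure WeightedComplex (V : Type u) (m : ℕ) where
  /-- the top-level faces -/
  top : Finset (Finset V)
  /-- the density on the top-level faces -/
  weight : Finset V → ℝ
  card_top : ∀ s ∈ top, s.card = m
  weight_pos : ∀ s ∈ top, 0 < weight s
  weight_sum : ∑ s ∈ top, weight s = 1

namespace WeightedComplex

variable {V : Type u} {m : ℕ}

/-- `t` is a face of the complex. -/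
def IsFace (X : WeightedComplex V m) (t : Finset V) : Prop := ∃ s ∈ X.top, t ⊆ s

open scoped Classical in
/-- The oriented edges `(x, y)` inside a set of vertices `s`. -/
def orientedEdges (s : Finset V) : Finset (V × V) :=
  (s ×ˢ s).filter fun p => p.1 ≠ p.2

open scoped Classical in
/-- The oriented triangles `(x, y, z)` inside a set of vertices `s`. -/
def orientedTriangles (s : Finset V) : Finset (V × V × V) :=
  (s ×ˢ s ×ˢ s).filter fun p => p.1 ≠ p.2.1 ∧ p.2.1 ≠ p.2.2 ∧ p.1 ≠ p.2.2

open scoped Classical in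
/-- The probability that a random oriented edge satisfies `P`: a top-level face `s` is drawn from
the density of the complex, and then an ordered pair of distinct vertices of `s` uniformly. -/
def edgeProb (X : WeightedComplex V m) (P : V × V → Prop) : ℝ :=
  ∑ s ∈ X.top, X.weight s *
    ((((orientedEdges s).filter P).card : ℝ) / ((orientedEdges s).card : ℝ))

open scoped Classical in
/-- The probability that a random oriented triangle satisfies `P`: a top-level face `s` is drawn
from the density of the complex, and then an ordered triple of distinct vertices of `s`
uniformly. -/
def triangleProb (X : WeightedComplex V m) (P : V × V × V → Prop) : ℝ :=
  ∑ s ∈ X.top, X.weight s *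
    ((((orientedTriangles s).filter P).card : ℝ) / ((orientedTriangles s).card : ℝ))

open scoped Classical in
/-- `f` is a `1`-cochain: an antisymmetric function on the oriented edges.  The values
of `f` at pairs that are not oriented edges play no role anywhere. -/
def IsOneCochain {Γ : Type v} [Group Γ] (X : WeightedComplex V m) (f : V → V → Γ) : Prop :=
  ∀ x y, x ≠ y → X.IsFace {x, y} → f x y = (f y x)⁻¹

/-- The coboundary `δ₁ f` of a `1`-cochain. -/
def coboundary {Γ : Type v} [Group Γ] (f : V → V → Γ) (x y z : V) : Γ :=
  f x y * f y z * f z x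

open scoped Classical in
/-- `f` is a `1`-cocycle: a `1`-cochain whose coboundary is trivial on all oriented triangles. -/
def IsOneCocycle {Γ : Type v} [Group Γ] (X : WeightedComplex V m) (f : V → V → Γ) : Prop :=
  X.IsOneCochain f ∧
    ∀ x y z, x ≠ y → y ≠ z → x ≠ z → X.IsFace {x, y, z} → coboundary f x y z = 1

/-- The distance of two `1`-cochains: the probability that they differ on a random edge. -/
def edgeDist {Γ : Type v} (X : WeightedComplex V m) (f g : V → V → Γ) : ℝ :=
  X.edgeProb fun p => f p.1 p.2 ≠ g p.1 p.2

/-- The weight of `δ₁ f`: the probability that it is nontrivial on a random triangle. -/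
def coboundaryWeight {Γ : Type v} [Group Γ] (X : WeightedComplex V m) (f : V → V → Γ) : ℝ :=
  X.triangleProb fun p => coboundary f p.1 p.2.1 p.2.2 ≠ 1

/-- `X` is a `β`-cosystolic expander (with respect to all coefficient groups), that is,
`h¹(X) ≥ β`. -/
def IsCosystolicExpander (X : WeightedComplex V m) (β : ℝ) : Prop :=
  0 < β ∧ ∀ (Γ : Type v) [Group Γ] (f : V → V → Γ), X.IsOneCochain f →
    ∃ g : V → V → Γ, X.IsOneCocycle g ∧ β * X.edgeDist f g ≤ X.coboundaryWeight f

end WeightedComplex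

/-- A partite complex: the vertices are coloured, and every top-level face has exactly one vertex
of each colour in `colors`. -/
structure PartiteComplex (V : Type u) (colors : Finset ℕ) extends
    WeightedComplex V colors.card where
  /-- the colour of a vertex -/
  col : V → ℕ
  bijOn_col : ∀ s ∈ top, Set.BijOn col (s : Set V) (colors : Set ℕ)

namespace PartiteComplex

variable {V : Type u} {colors : Finset ℕ}

open scoped Classical in
/-- The vertices of `s` whose colour lies in `c`. -/
def colorPart (X : PartiteComplex V colors) (c : Finset ℕ) (s : Finset V) : Finset V :=
  s.filter fun x => X.col x ∈ c

theorem bijOn_colorPart (X : PartiteComplex V colors) (c : Finset ℕ) {s : Finset V}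
    (hs : s ∈ X.top) :
    Set.BijOn X.col (X.colorPart c s : Set V) ((colors ∩ c : Finset ℕ) : Set ℕ) := by
  classical
  obtain ⟨h1, h2, h3⟩ := X.bijOn_col s hs
  refine ⟨?_, ?_, ?_⟩
  · intro x hx
    simp only [colorPart, coe_filter, Set.mem_ofPred_eq] at hx
    simp only [coe_inter, Set.mem_inter_iff, mem_coe]
    exact ⟨by simpa using h1 (by simpa using hx.1), hx.2⟩
  · exact h2.mono (by intro x hx; simp [colorPart] at hx; exact hx.1)
  · intro i hi
    simp only [coe_inter, Set.mem_inter_iff, mem_coe] at hi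
    obtain ⟨x, hx, rfl⟩ := h3 (by simpa using hi.1 : i ∈ (colors : Set ℕ))
    exact ⟨x, by simpa [colorPart] using ⟨by simpa using hx, hi.2⟩, rfl⟩

open scoped Classical in
/-- The colour restriction `X^c`, the subcomplex induced on the vertices with colours in `c`.
A top-level face is distributed as the part with colours in `c` of a random top-level face
of `X`. -/
def colorRestrict (X : PartiteComplex V colors) (c : Finset ℕ) :
    PartiteComplex V (colors ∩ c) where
  top := X.top.image (X.colorPart c)
  weight t := ∑ s ∈ X.top.filter (fun s => X.colorPart c s = t), X.weight s
  col := X.col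
  card_top := by
    intro t ht
    obtain ⟨s, hs, rfl⟩ := mem_image.1 ht
    have h := X.bijOn_colorPart c hs
    have := h.injOn.ncard_image
    rw [h.image_eq, Set.ncard_coe_finset, Set.ncard_coe_finset] at this
    exact this.symm
  weight_pos := by
    intro t ht
    obtain ⟨s, hs, rfl⟩ := mem_image.1 ht
    refine sum_pos (fun r hr => X.weight_pos r (mem_filter.1 hr).1) ⟨s, ?_⟩
    exact mem_filter.2 ⟨hs, rfl⟩
  weight_sum := by
    rw [← X.weight_sum]
    exact sum_fiberwise_of_maps_to (fun s hs => mem_image_of_mem _ hs) _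
  bijOn_col := by
    intro t ht
    obtain ⟨s, hs, rfl⟩ := mem_image.1 ht
    exact X.bijOn_colorPart c hs

end PartiteComplex

section SphericalBuilding

variable (F : Type u) [Field F] [Fintype F] (n : ℕ)

/-- A flag of nontrivial linear subspaces of `F ^ n`. -/
def IsSubspaceFlag (s : Finset (Submodule F (Fin n → F))) : Prop :=
  (∀ W ∈ s, W ≠ ⊥ ∧ W ≠ ⊤) ∧ IsChain (· ≤ ·) (s : Set (Submodule F (Fin n → F)))

/-- The complete flags, which consist of `n - 1` nontrivial subspaces. -/
def completeFlags : Finset (Finset (Submodule F (Fin n → F))) :=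
  (Set.toFinite {s | IsSubspaceFlag F n s ∧ s.card = n - 1}).toFinset

variable {F n}

theorem mem_completeFlags {s : Finset (Submodule F (Fin n → F))} :
    s ∈ completeFlags F n ↔ IsSubspaceFlag F n s ∧ s.card = n - 1 := by
  simp [completeFlags]

theorem IsSubspaceFlag.injOn {s : Finset (Submodule F (Fin n → F))} (h : IsSubspaceFlag F n s) :
    Set.InjOn (fun W : Submodule F (Fin n → F) => Module.finrank F W)
      (s : Set (Submodule F (Fin n → F))) := by
  intro W hW W' hW' e
  rcases h.2.total hW hW' with hle | hle
  · exact Submodule.eq_of_le_of_finrank_eq hle e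
  · exact (Submodule.eq_of_le_of_finrank_eq hle e.symm).symm

theorem IsSubspaceFlag.mapsTo {s : Finset (Submodule F (Fin n → F))}
    (h : IsSubspaceFlag F n s) :
    Set.MapsTo (fun W : Submodule F (Fin n → F) => Module.finrank F W)
      (s : Set (Submodule F (Fin n → F))) (Finset.Ioo 0 n : Set ℕ) := by
  intro W hW
  have h1 := h.1 W hW
  have h2 : Module.finrank F W < Module.finrank F (Fin n → F) :=
    Submodule.finrank_lt h1.2
  have h3 : Module.finrank F W ≠ 0 := fun e => h1.1 (Submodule.finrank_eq_zero.1 e)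
  simp only [Module.finrank_fin_fun] at h2
  simp only [coe_Ioo, Set.mem_Ioo]
  exact ⟨Nat.pos_of_ne_zero h3, h2⟩

theorem bijOn_completeFlags {s : Finset (Submodule F (Fin n → F))}
    (hs : s ∈ completeFlags F n) :
    Set.BijOn (fun W : Submodule F (Fin n → F) => Module.finrank F W)
      (s : Set (Submodule F (Fin n → F))) (Finset.Ioo 0 n : Set ℕ) := by
  obtain ⟨h, hc⟩ := mem_completeFlags.1 hs
  refine ⟨h.mapsTo, h.injOn, ?_⟩
  exact Finset.surjOn_of_injOn_of_card_le _ h.mapsTo h.injOn (by simp [hc])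

variable (F n) in
theorem completeFlags_nonempty : (completeFlags F n).Nonempty := by
  classical
  let b := Pi.basisFun F (Fin n)
  let K : Finset (Fin (n + 1)) := Finset.univ.filter fun k => k ≠ 0 ∧ k ≠ Fin.last n
  refine ⟨K.image b.flag, mem_completeFlags.2 ⟨⟨?_, ?_⟩, ?_⟩⟩
  · intro W hW
    obtain ⟨k, hk, rfl⟩ := mem_image.1 hW
    have hk' := (mem_filter.1 hk).2
    constructor
    · intro e
      exact hk'.1 (b.flag_strictMono.injective (by rw [e, b.flag_zero]))
    · intro e
      exact hk'.2 (b.flag_strictMono.injective (by rw [e, b.flag_last]))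
  · intro W hW W' hW' _
    obtain ⟨k, -, rfl⟩ := mem_image.1 (mem_coe.1 hW)
    obtain ⟨k', -, rfl⟩ := mem_image.1 (mem_coe.1 hW')
    rcases le_total k k' with hle | hle
    · exact Or.inl (b.flag_strictMono.monotone hle)
    · exact Or.inr (b.flag_strictMono.monotone hle)
  · rw [card_image_of_injective _ b.flag_strictMono.injective]
    have hK : K = (Finset.univ.erase 0).erase (Fin.last n) := by
      ext k
      simp [K, and_comm]
    rw [hK]
    rcases Nat.eq_zero_or_pos n with rfl | hn
    · rfl
    · rw [card_erase_of_mem, card_erase_of_mem (mem_univ _)]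
      · simp
      · refine mem_erase.2 ⟨?_, mem_univ _⟩
        intro e
        have := congrArg Fin.val e
        simp at this
        omega

variable (F n) in
/-- The spherical building of `SL_n(F)`: the vertices are the nontrivial subspaces of `F ^ n`,
coloured by their dimension, the faces are the flags, and the complete flags carry the uniform
distribution. -/
def sphericalBuilding : PartiteComplex (Submodule F (Fin n → F)) (Finset.Ioo 0 n) where
  top := completeFlags F n
  weight _ := 1 / ((completeFlags F n).card : ℝ)
  card_top := by
    intro s hs
    rw [(mem_completeFlags.1 hs).2]
    simp
  weight_pos := by
    intro s hs
    have : 0 < (completeFlags F n).card := card_pos.2 ⟨s, hs⟩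
    positivity
  weight_sum := by
    have : 0 < (completeFlags F n).card := card_pos.2 (completeFlags_nonempty F n)
    rw [sum_const, nsmul_eq_mul]
    field_simp
  col W := Module.finrank F W
  bijOn_col _ hs := bijOn_completeFlags hs

end SphericalBuilding

end

/-! Since `q₀` may depend on `n`, flags mix as well as desired: a free coordinate of a random flag
through a fixed partial flag is correlated with all other coordinates by at most `√(2 ^ n / q)`.
With such mixing `h¹` is bounded below by an absolute constant. Both logarithms are nonnegative, so
the logarithmic term only weakens the claim.

The source of expansion is a join. Once a member of the flag is fixed, the parts below and above it
are independent, and coning from one vertex below solves `δg = f` up to a factor 26 in the error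
(`Expands.of_splice`). To exploit this for four dimensions `I`, take three auxiliary dimensions `K`
strictly between `i₀` and `i₂`. Each vertex with colour in `K` carries a near-solution `G` on its
link, because its link is a join. Two near-solutions differ on their common link by an almost
constant left factor `h`, and `h` is an edge function on the colours `K` which is nearly a cocycle.
If `h` is close to the coboundary of `κ`, the corrected solutions `κ * G` agree for most flags and
glue by majority. So expansion of `I` follows from that of the nerve `K`, at the cost of the product
of the two constants (`Expands.of_nerve`).

For three consecutive dimensions above a fixed partial flag, expansion comes from an explicit cone
with 23 triangles, averaged over the stabilizer (`expands_three`). Using these triples as nerves,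
induction on the lowest dimension reaches other triples, with a constant exponentially small in that
dimension (`expands_above`).

This loss is harmless for the final step. Under strong mixing, a triangle of `K` on which `h` is not
a cocycle forces a rare sampling failure, so `δh` carries an additional factor `λ²`. For large `q`
this factor outweighs the small constant of the nerve, which then disappears from the bound
(`Expands.of_nerve_of_mixes`). -/

noncomputable section

namespace FlagFamily

/-! ### Averages and probabilities over finite sets -/

section Averages

variable {S : Type*}

/-- The average of `φ` over a finite set. -/
def avg (Ω : Finset S) (φ : S → ℝ) : ℝ := (∑ ω ∈ Ω, φ ω) / (#Ω : ℝ)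

open scoped Classical in
/-- The probability of `P` for a uniformly random element of a finite set. -/
def prob (Ω : Finset S) (P : S → Prop) : ℝ := avg Ω fun ω => if P ω then 1 else 0

variable {Ω : Finset S} {φ ψ : S → ℝ} {P Q : S → Prop}

theorem avg_mono (h : ∀ ω ∈ Ω, φ ω ≤ ψ ω) : avg Ω φ ≤ avg Ω ψ :=
  div_le_div_of_nonneg_right (sum_le_sum h) (Nat.cast_nonneg _)

theorem avg_congr (h : ∀ ω ∈ Ω, φ ω = ψ ω) : avg Ω φ = avg Ω ψ := by
  unfold avg
  rw [sum_congr rfl h]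

theorem avg_add : avg Ω (fun ω => φ ω + ψ ω) = avg Ω φ + avg Ω ψ := by
  unfold avg
  rw [sum_add_distrib, add_div]

theorem avg_sub : avg Ω (fun ω => φ ω - ψ ω) = avg Ω φ - avg Ω ψ := by
  unfold avg
  rw [sum_sub_distrib, sub_div]

theorem avg_mul_left (c : ℝ) : avg Ω (fun ω => c * φ ω) = c * avg Ω φ := by
  unfold avg
  rw [← mul_sum, mul_div_assoc]

theorem avg_sum {ι : Type*} (s : Finset ι) (φ : ι → S → ℝ) :
    avg Ω (fun ω => ∑ i ∈ s, φ i ω) = ∑ i ∈ s, avg Ω (φ i) := by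
  unfold avg
  rw [sum_comm, sum_div]

theorem avg_nonneg (h : ∀ ω ∈ Ω, 0 ≤ φ ω) : 0 ≤ avg Ω φ :=
  div_nonneg (sum_nonneg h) (Nat.cast_nonneg _)

theorem avg_const (hΩ : Ω.Nonempty) (c : ℝ) : avg Ω (fun _ => c) = c := by
  have : (#Ω : ℝ) ≠ 0 := by exact_mod_cast hΩ.card_pos.ne'
  simp [avg, this]

theorem avg_mul_le_sqrt :
    avg Ω (fun ω => φ ω * ψ ω) ≤
      √(avg Ω fun ω => φ ω ^ 2) * √(avg Ω fun ω => ψ ω ^ 2) := by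
  unfold avg
  rw [Real.sqrt_div (sum_nonneg fun _ _ => sq_nonneg _),
    Real.sqrt_div (sum_nonneg fun _ _ => sq_nonneg _), div_mul_div_comm,
    Real.mul_self_sqrt (Nat.cast_nonneg _)]
  exact div_le_div_of_nonneg_right (Real.sum_mul_le_sqrt_mul_sqrt _ _ _) (Nat.cast_nonneg _)

theorem exists_le_avg (hΩ : Ω.Nonempty) : ∃ ω ∈ Ω, φ ω ≤ avg Ω φ := by
  by_contra! h
  have h1 : (#Ω : ℝ) ≠ 0 := by exact_mod_cast hΩ.card_pos.ne'
  have h2 := sum_lt_sum_of_nonempty hΩ h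
  rw [sum_const, nsmul_eq_mul, avg, mul_div_cancel₀ _ h1] at h2
  exact lt_irrefl _ h2

theorem prob_nonneg : 0 ≤ prob Ω P :=
  avg_nonneg fun ω _ => by split_ifs <;> norm_num

theorem prob_mono (h : ∀ ω ∈ Ω, P ω → Q ω) : prob Ω P ≤ prob Ω Q := by
  refine avg_mono fun ω hω => ?_
  by_cases hP : P ω
  · simp [hP, h ω hω hP]
  · rw [if_neg hP]
    split_ifs <;> norm_num

theorem prob_congr (h : ∀ ω ∈ Ω, P ω ↔ Q ω) : prob Ω P = prob Ω Q :=
  le_antisymm (prob_mono fun ω hω => (h ω hω).1) (prob_mono fun ω hω => (h ω hω).2)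

theorem prob_le_one : prob Ω P ≤ 1 := by
  rcases Ω.eq_empty_or_nonempty with rfl | hΩ
  · simp [prob, avg]
  · rw [← avg_const hΩ 1]
    exact avg_mono fun ω _ => by split_ifs <;> norm_num

theorem prob_eq_one (hΩ : Ω.Nonempty) (h : ∀ ω ∈ Ω, P ω) : prob Ω P = 1 := by
  rw [← avg_const hΩ 1]
  exact avg_congr fun ω hω => if_pos (h ω hω)

theorem prob_eq_zero (h : ∀ ω ∈ Ω, ¬P ω) : prob Ω P = 0 := by
  unfold prob avg
  rw [sum_eq_zero fun ω hω => if_neg (h ω hω), zero_div]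

theorem prob_or_le : prob Ω (fun ω => P ω ∨ Q ω) ≤ prob Ω P + prob Ω Q := by
  unfold prob
  rw [← avg_add]
  refine avg_mono fun ω _ => ?_
  by_cases hP : P ω <;> by_cases hQ : Q ω <;> simp [hP, hQ]

theorem prob_add_prob_not (hΩ : Ω.Nonempty) : prob Ω P + prob Ω (fun ω => ¬P ω) = 1 := by
  unfold prob
  rw [← avg_add]
  refine (avg_congr fun ω _ => ?_).trans (avg_const hΩ 1)
  by_cases hP : P ω <;> simp [hP]

theorem prob_exists_le {ι : Type*} (s : Finset ι) (P : ι → S → Prop) :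
    prob Ω (fun ω => ∃ i ∈ s, P i ω) ≤ ∑ i ∈ s, prob Ω (P i) := by
  classical
  unfold prob
  rw [← avg_sum]
  refine avg_mono fun ω _ => ?_
  split_ifs with h
  · obtain ⟨i, hi, hP⟩ := h
    refine le_trans (by simp [hP])
      (single_le_sum (f := fun i => if P i ω then (1 : ℝ) else 0)
        (fun j _ => by split_ifs <;> norm_num) hi)
  · exact sum_nonneg fun j _ => by split_ifs <;> norm_num

theorem prob_exists_le_card {ι : Type*} (s : Finset ι) (P : ι → S → Prop) {b : ℝ}
    (h : ∀ i ∈ s, prob Ω (P i) ≤ b) :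
    prob Ω (fun ω => ∃ i ∈ s, P i ω) ≤ #s * b := by
  refine (prob_exists_le s P).trans ?_
  rw [← nsmul_eq_mul, ← sum_const]
  exact sum_le_sum h

end Averages

/-! ### Conditioning on one coordinate -/

section Links

variable {α : Type*} {Ω : Finset (ℕ → α)}

open scoped Classical in
/-- The members of a family that have `x` at the coordinate `k`. -/
def link (Ω : Finset (ℕ → α)) (k : ℕ) (x : α) : Finset (ℕ → α) := Ω.filter fun ω => ω k = x

theorem mem_link {k : ℕ} {x : α} {ω : ℕ → α} : ω ∈ link Ω k x ↔ ω ∈ Ω ∧ ω k = x := by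
  simp [link]

theorem link_comm (k l : ℕ) (x y : α) : link (link Ω k x) l y = link (link Ω l y) k x := by
  ext ω
  simp only [mem_link]
  tauto

theorem avg_link (k : ℕ) (φ : (ℕ → α) → ℝ) :
    avg Ω (fun ω => avg (link Ω k (ω k)) φ) = avg Ω φ := by
  classical
  unfold avg
  congr 1
  have h : ∀ ω ∈ Ω, (∑ ω' ∈ link Ω k (ω k), φ ω') / (#(link Ω k (ω k)) : ℝ) =
      ∑ ω' ∈ Ω, if ω' k = ω k then φ ω' / (#(link Ω k (ω' k)) : ℝ) else 0 := by
    intro ω _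
    rw [← sum_filter, sum_div]
    refine sum_congr rfl fun ω' hω' => ?_
    rw [(mem_filter.1 hω').2]
  rw [sum_congr rfl h, sum_comm]
  refine sum_congr rfl fun ω' hω' => ?_
  have h0 : (#(link Ω k (ω' k)) : ℝ) ≠ 0 := by
    exact_mod_cast (card_pos.2 ⟨ω', mem_link.2 ⟨hω', rfl⟩⟩).ne'
  have h1 : (Ω.filter fun ω => ω' k = ω k) = link Ω k (ω' k) := by
    ext ω
    simp [mem_link, eq_comm]
  rw [← sum_filter, sum_const, nsmul_eq_mul, h1]
  field_simp

theorem prob_link (k : ℕ) (P : (ℕ → α) → Prop) :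
    avg Ω (fun ω => prob (link Ω k (ω k)) P) = prob Ω P :=
  avg_link k _

theorem prob_le_of_link (k : ℕ) {P Q : (ℕ → α) → Prop} {c : ℝ}
    (h : ∀ ω ∈ Ω, prob (link Ω k (ω k)) P ≤ c * prob (link Ω k (ω k)) Q) :
    prob Ω P ≤ c * prob Ω Q := by
  rw [← prob_link k P, ← prob_link k Q, ← avg_mul_left]
  exact avg_mono h

end Links

/-! ### Mixing: sampling and majority values -/

section Mixing

variable {α : Type*} {Ω : Finset (ℕ → α)}

/-- Mixing of the coordinate `k` with the other coordinates. -/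
def Mixes (Ω : Finset (ℕ → α)) (k : ℕ) (lam : ℝ) : Prop :=
  ∀ (A : α → Prop) (P : (ℕ → α) → Prop), DependsOn P {k}ᶜ →
    prob Ω (fun ω => A (ω k) ∧ P ω) ≤
      (1 - lam) * (prob Ω (fun ω => A (ω k)) * prob Ω P) +
        lam * √(prob Ω (fun ω => A (ω k)) * prob Ω P)

/-- If `A` is the set of exceptional values, of probability `a`, then `2ta` is at most the
probability of `A` together with `P`. The product term of the mixing bound absorbs at most `ta`, so
`ta ≤ λ√(ap)`; squaring gives the factor `λ²` on which the large-gap argument rests. -/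
theorem Mixes.sampling {k : ℕ} {lam : ℝ} (h0 : 0 ≤ lam) (h : Mixes Ω k lam)
    {P : (ℕ → α) → Prop} (hP : DependsOn P {k}ᶜ) {t : ℝ} (ht : 0 < t) (hPt : prob Ω P ≤ t) :
    prob Ω (fun ω => 2 * t ≤ prob (link Ω k (ω k)) P) ≤ lam ^ 2 / t ^ 2 * prob Ω P := by
  set A : α → Prop := fun x => 2 * t ≤ prob (link Ω k x) P
  set a := prob Ω (fun ω => A (ω k))
  set p := prob Ω P
  have ha : 0 ≤ a := prob_nonneg
  have hp : 0 ≤ p := prob_nonneg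
  have h1 : 2 * t * a ≤ prob Ω (fun ω => A (ω k) ∧ P ω) := by
    change 2 * t * prob Ω (fun ω => A (ω k)) ≤ _
    rw [← prob_link k (fun ω => A (ω k) ∧ P ω)]
    unfold prob
    rw [← avg_mul_left]
    refine avg_mono fun ω _ => ?_
    by_cases hA : A (ω k)
    · rw [if_pos hA, mul_one]
      refine le_trans hA (prob_mono fun ω' hω' hP' => ⟨?_, hP'⟩)
      rwa [(mem_link.1 hω').2]
    · rw [if_neg hA, mul_zero]
      exact prob_nonneg
  have h2 := h1.trans (h A P hP)
  change 2 * t * a ≤ (1 - lam) * (a * p) + lam * √(a * p) at h2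
  have hap : 0 ≤ a * p := mul_nonneg ha hp
  have h3 : t * a ≤ lam * √(a * p) := by nlinarith
  have h4 : (t * a) ^ 2 ≤ lam ^ 2 * (a * p) := by
    calc (t * a) ^ 2 ≤ (lam * √(a * p)) ^ 2 := by gcongr
      _ = lam ^ 2 * (a * p) := by rw [mul_pow, Real.sq_sqrt hap]
  change a ≤ _
  rcases ha.eq_or_lt with h5 | h5
  · rw [← h5]
    positivity
  · have : t ^ 2 * a ≤ lam ^ 2 * p := by
      refine le_of_mul_le_mul_right ?_ h5
      nlinarith
    rw [div_mul_eq_mul_div, le_div_iff₀ (by positivity)]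
    linarith

-- The case of a large mean is charged to an indicator, so that the inequality holds on every link
-- and can be averaged over links.
open scoped Classical in
theorem Mixes.sampling' {k : ℕ} {lam : ℝ} (h0 : 0 ≤ lam) (h : Mixes Ω k lam)
    {P : (ℕ → α) → Prop} (hP : DependsOn P {k}ᶜ) {t : ℝ} (ht : 0 < t) :
    prob Ω (fun ω => 2 * t ≤ prob (link Ω k (ω k)) P) ≤
      lam ^ 2 / t ^ 2 * prob Ω P + if t < prob Ω P then 1 else 0 := by
  split_ifs with hlt
  · have : 0 ≤ lam ^ 2 / t ^ 2 * prob Ω P := mul_nonneg (by positivity) prob_nonneg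
    linarith [prob_le_one (Ω := Ω) (P := fun ω => 2 * t ≤ prob (link Ω k (ω k)) P)]
  · rw [add_zero]
    exact h.sampling h0 hP ht (not_lt.1 hlt)

/-- Take `c` to be the most frequent value of `φ`. Summing the mixing bound over all values, with
AM-GM for the square roots, bounds the probability of agreement by `(a c + 1) / 2`. The coefficient
`1 - lam` in `Mixes` matters here: with coefficient `1` the bound would be `a c + 1 / 2`, which does
not push `a c` towards `1` when disagreement is rare. -/
theorem Mixes.exists_majority {C : Type*} {i j : ℕ} (hij : i ≠ j) (hΩ : Ω.Nonempty)
    (h : Mixes Ω i (1 / 2)) (φ ψ : α → C) :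
    ∃ c, prob Ω (fun ω => φ (ω i) ≠ c) ≤ 2 * prob Ω (fun ω => φ (ω i) ≠ ψ (ω j)) := by
  classical
  set V : Finset C := Ω.image fun ω => φ (ω i)
  have hV : V.Nonempty := hΩ.image _
  set a : C → ℝ := fun c => prob Ω (fun ω => φ (ω i) = c)
  set b : C → ℝ := fun c => prob Ω (fun ω => ψ (ω j) = c)
  obtain ⟨c, hc, hmax⟩ := exists_max_image V a hV
  refine ⟨c, ?_⟩
  have ha : ∑ c ∈ V, a c = 1 := by
    simp only [a, prob]
    rw [← avg_sum]
    refine (avg_congr fun ω hω => ?_).trans (avg_const hΩ 1)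
    rw [sum_ite_eq, if_pos (mem_image_of_mem _ hω)]
  have hb : ∑ c ∈ V, b c ≤ 1 := by
    simp only [b, prob]
    rw [← avg_sum]
    refine (avg_mono fun ω hω => ?_).trans (avg_const hΩ 1).le
    rw [sum_ite_eq]
    split_ifs <;> norm_num
  have h1 : prob Ω (fun ω => φ (ω i) = ψ (ω j)) ≤ (1 / 2) * a c + 1 / 2 := by
    have e1 : prob Ω (fun ω => φ (ω i) = ψ (ω j)) ≤
        ∑ c ∈ V, prob Ω (fun ω => φ (ω i) = c ∧ ψ (ω j) = c) := by
      refine le_trans (prob_mono fun ω hω e => ?_) (prob_exists_le _ _)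
      exact ⟨φ (ω i), mem_image_of_mem _ hω, rfl, e.symm⟩
    have e2 : ∀ d ∈ V, prob Ω (fun ω => φ (ω i) = d ∧ ψ (ω j) = d) ≤
        (1 / 2) * (a c * b d) + (1 / 4) * (a d + b d) := by
      intro d hd
      have hP : DependsOn (fun ω : ℕ → α => ψ (ω j) = d) ({i}ᶜ : Set ℕ) := by
        intro x y hxy
        simp only [hxy j (by simpa using hij.symm)]
      have e3 := h (fun x => φ x = d) (fun ω => ψ (ω j) = d) hP
      have ha0 : 0 ≤ a d := prob_nonneg
      have hb0 : 0 ≤ b d := prob_nonneg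
      have e4 : √(a d * b d) ≤ (a d + b d) / 2 := by
        rw [Real.sqrt_le_left (by positivity)]
        nlinarith [sq_nonneg (a d - b d)]
      have e5 : a d * b d ≤ a c * b d := mul_le_mul_of_nonneg_right (hmax d hd) hb0
      change _ ≤ (1 - 1 / 2) * (a d * b d) + 1 / 2 * √(a d * b d) at e3
      linarith
    refine e1.trans ((sum_le_sum e2).trans ?_)
    rw [sum_add_distrib, ← mul_sum, ← mul_sum, ← mul_sum, sum_add_distrib, ha]
    have : 0 ≤ a c := prob_nonneg
    nlinarith
  have h2 := prob_add_prob_not hΩ (P := fun ω => φ (ω i) = ψ (ω j))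
  have h3 := prob_add_prob_not hΩ (P := fun ω => φ (ω i) = c)
  change a c + _ = 1 at h3
  simp only [ne_eq]
  linarith

/-- A majority value for the coordinate `i` costs `2`; another coordinate misses it only if `i` does
or if the two disagree, which costs `1` more. -/
theorem Mixes.exists_common_value {C : Type*} {I : Finset ℕ} {i j : ℕ} (hi : i ∈ I) (hj : j ∈ I)
    (hij : i ≠ j) (hΩ : Ω.Nonempty) (h : Mixes Ω i (1 / 2)) (φ : ℕ → α → C) :
    ∃ c, prob Ω (fun ω => ∃ k ∈ I, φ k (ω k) ≠ c) ≤
      3 * prob Ω (fun ω => ∃ k ∈ I, ∃ l ∈ I, k < l ∧ φ k (ω k) ≠ φ l (ω l)) := by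
  obtain ⟨c, hc⟩ := h.exists_majority hij hΩ (φ i) (φ j)
  refine ⟨c, ?_⟩
  set δ := prob Ω (fun ω => ∃ k ∈ I, ∃ l ∈ I, k < l ∧ φ k (ω k) ≠ φ l (ω l))
  have key : ∀ ω : ℕ → α, ∀ k ∈ I, ∀ l ∈ I, φ k (ω k) ≠ φ l (ω l) →
      ∃ k ∈ I, ∃ l ∈ I, k < l ∧ φ k (ω k) ≠ φ l (ω l) := by
    intro ω k hk l hl hne
    rcases lt_trichotomy k l with hlt | rfl | hlt
    · exact ⟨k, hk, l, hl, hlt, hne⟩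
    · exact absurd rfl hne
    · exact ⟨l, hl, k, hk, hlt, hne.symm⟩
  have h1 : prob Ω (fun ω => φ i (ω i) ≠ φ j (ω j)) ≤ δ :=
    prob_mono fun ω _ hne => key ω i hi j hj hne
  have h2 : prob Ω (fun ω => ∃ k ∈ I, φ k (ω k) ≠ c) ≤
      prob Ω (fun ω => φ i (ω i) ≠ c) + δ := by
    refine le_trans (prob_mono fun ω _ ⟨k, hk, hne⟩ => ?_) prob_or_le
    by_cases e : φ i (ω i) = c
    · exact Or.inr (key ω k hk i hi (by rwa [e]))
    · exact Or.inl e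
  linarith

end Mixing

/-! ### Gluing local solutions along a nerve -/

section Expansion

variable {α : Type u} {Γ : Type v} [Group Γ]

/-- The coboundary of the vertex function `g` differs from `f` on some edge of `ω` with colours
in `I`. -/
def EdgeBad (I : Finset ℕ) (f : ℕ → ℕ → α → α → Γ) (g : ℕ → α → Γ) (ω : ℕ → α) : Prop :=
  ∃ i ∈ I, ∃ j ∈ I, i < j ∧ f i j (ω i) (ω j) ≠ (g i (ω i))⁻¹ * g j (ω j)

/-- The coboundary of the edge function `f` is nontrivial on some triangle of `ω` with colours
in `I`. -/
def TriangleBad (I : Finset ℕ) (f : ℕ → ℕ → α → α → Γ) (ω : ℕ → α) : Prop :=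
  ∃ i ∈ I, ∃ j ∈ I, ∃ k ∈ I, i < j ∧ j < k ∧
    f i j (ω i) (ω j) * f j k (ω j) (ω k) ≠ f i k (ω i) (ω k)

/-- Coboundary expansion in dimension one of the coordinates in `I` of a random member of `Ω`. -/
def Expands (Ω : Finset (ℕ → α)) (I : Finset ℕ) (β : ℝ) : Prop :=
  ∀ (Γ : Type v) [Group Γ] (f : ℕ → ℕ → α → α → Γ), ∃ g : ℕ → α → Γ,
    β * prob Ω (EdgeBad I f g) ≤ prob Ω (TriangleBad I f)

theorem Expands.mono {Ω : Finset (ℕ → α)} {I : Finset ℕ} {β γ : ℝ}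
    (h : Expands.{u, v} Ω I β) (hle : γ ≤ β) : Expands.{u, v} Ω I γ := by
  intro Γ _ f
  obtain ⟨g, hg⟩ := h Γ f
  exact ⟨g, (mul_le_mul_of_nonneg_right hle prob_nonneg).trans hg⟩

/-- The local solution `G k (ω k)` fails on `ω`. -/
def LocalBad (I : Finset ℕ) (f : ℕ → ℕ → α → α → Γ) (G : ℕ → α → ℕ → α → Γ) (k : ℕ)
    (ω : ℕ → α) : Prop :=
  EdgeBad I f (G k (ω k)) ω

/-- The quotient of the local solutions at `ω k` and `ω l` is not everywhere `h k l` on `ω`. -/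
def NerveBad (I : Finset ℕ) (G : ℕ → α → ℕ → α → Γ) (h : ℕ → ℕ → α → α → Γ) (k l : ℕ)
    (ω : ℕ → α) : Prop :=
  ∃ i ∈ I, G k (ω k) i (ω i) * (G l (ω l) i (ω i))⁻¹ ≠ h k l (ω k) (ω l)

variable {Ω : Finset (ℕ → α)} {I K : Finset ℕ} {β : ℝ}

/-- A coordinate samples only events that ignore it. This is why the nerve is kept disjoint from `I`
in `Expands.of_nerve_of_mixes`. -/
theorem dependsOn_localBad (f : ℕ → ℕ → α → α → Γ) (G : ℕ → α → ℕ → α → Γ) {k l : ℕ}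
    (hkl : k ≠ l) (hl : l ∉ I) : DependsOn (LocalBad I f G k) {l}ᶜ := by
  intro x y hxy
  have h1 : ∀ i ∈ I, x i = y i := fun i hi => hxy i fun e => hl (by rwa [← e])
  have hk : x k = y k := hxy k hkl
  refine propext ⟨?_, ?_⟩
  · rintro ⟨i, hi, j, hj, h⟩
    refine ⟨i, hi, j, hj, ?_⟩
    rwa [← h1 i hi, ← h1 j hj, ← hk]
  · rintro ⟨i, hi, j, hj, h⟩
    refine ⟨i, hi, j, hj, ?_⟩
    rwa [h1 i hi, h1 j hj, hk]

theorem dependsOn_nerveBad (G : ℕ → α → ℕ → α → Γ) (h : ℕ → ℕ → α → α → Γ) {k l m : ℕ}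
    (hkm : k ≠ m) (hlm : l ≠ m) (hm : m ∉ I) : DependsOn (NerveBad I G h k l) {m}ᶜ := by
  intro x y hxy
  have h1 : ∀ i ∈ I, x i = y i := fun i hi => hxy i fun e => hm (by rwa [← e])
  have hk : x k = y k := hxy k hkm
  have hl : x l = y l := hxy l hlm
  refine propext ⟨?_, ?_⟩
  · rintro ⟨i, hi, h⟩
    refine ⟨i, hi, ?_⟩
    rwa [← h1 i hi, ← hk, ← hl]
  · rintro ⟨i, hi, h⟩
    refine ⟨i, hi, ?_⟩
    rwa [h1 i hi, hk, hl]

theorem dependsOn_triangleBad (f : ℕ → ℕ → α → α → Γ) {l : ℕ} (hl : l ∉ I) :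
    DependsOn (TriangleBad I f) {l}ᶜ := by
  intro x y hxy
  have h1 : ∀ i ∈ I, x i = y i := fun i hi => hxy i fun e => hl (by rwa [← e])
  refine propext ⟨?_, ?_⟩
  · rintro ⟨i, hi, j, hj, k, hk, h⟩
    refine ⟨i, hi, j, hj, k, hk, ?_⟩
    rwa [← h1 i hi, ← h1 j hj, ← h1 k hk]
  · rintro ⟨i, hi, j, hj, k, hk, h⟩
    refine ⟨i, hi, j, hj, k, hk, ?_⟩
    rwa [h1 i hi, h1 j hj, h1 k hk]

theorem exists_local_solutions
    (hloc : ∀ k ∈ K, ∀ ω ∈ Ω, Expands.{u, v} (link Ω k (ω k)) I β) (f : ℕ → ℕ → α → α → Γ) :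
    ∃ G : ℕ → α → ℕ → α → Γ, ∀ k ∈ K, ∀ ω ∈ Ω,
      β * prob (link Ω k (ω k)) (LocalBad I f G k) ≤ prob (link Ω k (ω k)) (TriangleBad I f) := by
  have : ∀ k x, ∃ g : ℕ → α → Γ, k ∈ K → ∀ ω ∈ Ω, ω k = x →
      β * prob (link Ω k x) (EdgeBad I f g) ≤ prob (link Ω k x) (TriangleBad I f) := by
    intro k x
    by_cases h : k ∈ K ∧ ∃ ω ∈ Ω, ω k = x
    · obtain ⟨hk, ω, hω, rfl⟩ := h
      obtain ⟨g, hg⟩ := hloc k hk ω hω Γ f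
      exact ⟨g, fun _ _ _ _ => hg⟩
    · exact ⟨1, fun hk ω hω e => absurd ⟨hk, ω, hω, e⟩ h⟩
  choose G hG using this
  refine ⟨G, fun k hk ω hω => ?_⟩
  refine le_trans (le_of_eq ?_) (hG k (ω k) hk ω hω rfl)
  congr 1
  refine prob_congr fun ω' hω' => ?_
  rw [LocalBad, (mem_link.1 hω').2]

/-- Where both local solutions hold, `(G k i)⁻¹ * G k j = (G l i)⁻¹ * G l j`, so `G k i * (G l i)⁻¹`
does not depend on `i ∈ I`. Mixing on the common link of the two vertices turns this into a single
value `h k l`. -/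
theorem exists_nerve_function
    (hmix : ∀ k ∈ K, ∀ l ∈ K, k < l → ∀ ω ∈ Ω, ∃ i ∈ I, ∃ j ∈ I, i ≠ j ∧
      Mixes (link (link Ω k (ω k)) l (ω l)) i (1 / 2))
    (f : ℕ → ℕ → α → α → Γ) (G : ℕ → α → ℕ → α → Γ) :
    ∃ h : ℕ → ℕ → α → α → Γ, ∀ k ∈ K, ∀ l ∈ K, k < l → ∀ ω ∈ Ω,
      prob (link (link Ω k (ω k)) l (ω l)) (NerveBad I G h k l) ≤
        3 * prob (link (link Ω k (ω k)) l (ω l))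
          (fun ω => LocalBad I f G k ω ∨ LocalBad I f G l ω) := by
  have : ∀ k l x y, ∃ c : Γ, k ∈ K → l ∈ K → k < l → ∀ ω ∈ Ω, ω k = x → ω l = y →
      prob (link (link Ω k x) l y) (fun ω => ∃ i ∈ I,
        G k x i (ω i) * (G l y i (ω i))⁻¹ ≠ c) ≤
        3 * prob (link (link Ω k x) l y)
          (fun ω => LocalBad I f G k ω ∨ LocalBad I f G l ω) := by
    intro k l x y
    by_cases H : k ∈ K ∧ l ∈ K ∧ k < l ∧ ∃ ω ∈ Ω, ω k = x ∧ ω l = y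
    · obtain ⟨hk, hl, hkl, ω, hω, rfl, rfl⟩ := H
      obtain ⟨i, hi, j, hj, hij, hm⟩ := hmix k hk l hl hkl ω hω
      have hne : (link (link Ω k (ω k)) l (ω l)).Nonempty :=
        ⟨ω, mem_link.2 ⟨mem_link.2 ⟨hω, rfl⟩, rfl⟩⟩
      obtain ⟨c, hc⟩ := hm.exists_common_value hi hj hij hne
        (fun i z => G k (ω k) i z * (G l (ω l) i z)⁻¹)
      refine ⟨c, fun _ _ _ _ _ _ _ => hc.trans ?_⟩
      refine mul_le_mul_of_nonneg_left (prob_mono ?_) (by norm_num)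
      rintro ω' hω' ⟨i, hi, j, hj, hlt, hne⟩
      by_contra! hcon
      obtain ⟨h1, h2⟩ := hcon
      obtain ⟨hω1, e2⟩ := mem_link.1 hω'
      obtain ⟨-, e1⟩ := mem_link.1 hω1
      simp only [LocalBad, EdgeBad, not_exists, not_and, not_not, e1, e2] at h1 h2
      have h3 := h1 i hi j hj hlt
      have h4 := h2 i hi j hj hlt
      rw [h3] at h4
      apply hne
      have h5 : G k (ω k) j (ω' j) =
          G k (ω k) i (ω' i) * ((G l (ω l) i (ω' i))⁻¹ * G l (ω l) j (ω' j)) := by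
        rw [← h4, mul_inv_cancel_left]
      rw [h5]
      group
    · exact ⟨1, fun hk hl hkl ω hω e1 e2 => absurd ⟨hk, hl, hkl, ω, hω, e1, e2⟩ H⟩
  choose h hh using this
  refine ⟨h, fun k hk l hl hkl ω hω => ?_⟩
  refine le_trans (le_of_eq ?_) (hh k l (ω k) (ω l) hk hl hkl ω hω rfl rfl)
  refine prob_congr fun ω' hω' => ?_
  obtain ⟨hω1, e2⟩ := mem_link.1 hω'
  obtain ⟨-, e1⟩ := mem_link.1 hω1
  rw [NerveBad, e1, e2]

theorem prob_localBad_le (hβ : 0 < β) {f : ℕ → ℕ → α → α → Γ} {G : ℕ → α → ℕ → α → Γ}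
    {k : ℕ} (hG : ∀ ω ∈ Ω,
      β * prob (link Ω k (ω k)) (LocalBad I f G k) ≤ prob (link Ω k (ω k)) (TriangleBad I f)) :
    prob Ω (LocalBad I f G k) ≤ β⁻¹ * prob Ω (TriangleBad I f) := by
  refine prob_le_of_link k fun ω hω => ?_
  rw [inv_mul_eq_div, le_div_iff₀' hβ]
  exact hG ω hω

theorem prob_nerveBad_le (hβ : 0 < β) {f : ℕ → ℕ → α → α → Γ} {G : ℕ → α → ℕ → α → Γ}
    (hG : ∀ k ∈ K, ∀ ω ∈ Ω,
      β * prob (link Ω k (ω k)) (LocalBad I f G k) ≤ prob (link Ω k (ω k)) (TriangleBad I f))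
    {h : ℕ → ℕ → α → α → Γ} (hh : ∀ k ∈ K, ∀ l ∈ K, k < l → ∀ ω ∈ Ω,
      prob (link (link Ω k (ω k)) l (ω l)) (NerveBad I G h k l) ≤
        3 * prob (link (link Ω k (ω k)) l (ω l))
          (fun ω => LocalBad I f G k ω ∨ LocalBad I f G l ω))
    {k l : ℕ} (hk : k ∈ K) (hl : l ∈ K) (hkl : k < l) :
    prob Ω (NerveBad I G h k l) ≤ 6 * (β⁻¹ * prob Ω (TriangleBad I f)) := by
  have h1 : prob Ω (NerveBad I G h k l) ≤
      3 * prob Ω (fun ω => LocalBad I f G k ω ∨ LocalBad I f G l ω) := by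
    refine prob_le_of_link k fun ω hω => prob_le_of_link l fun ω' hω' => ?_
    obtain ⟨hω1, e1⟩ := mem_link.1 hω'
    rw [← e1]
    exact hh k hk l hl hkl ω' hω1
  have h2 := prob_or_le (Ω := Ω) (P := LocalBad I f G k) (Q := LocalBad I f G l)
  have h3 := prob_localBad_le hβ (hG k hk)
  have h4 := prob_localBad_le hβ (hG l hl)
  linarith

/-- When `h` is the coboundary of `κ` and equals the quotients of local solutions, `κ k * G k i`
does not depend on `k ∈ K`; its common value on the link of `ω i` serves as `g i`. Nerve failures
over the pairs in `K` cost at most `3 * 3 * 6 = 54`, and the majority multiplies by `3` for each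
`i`, whence `162`. -/
theorem exists_global_solution (hβ : 0 < β) (hK : #K = 3)
    (hmix : ∀ i ∈ I, ∀ ω ∈ Ω, ∃ k ∈ K, ∃ l ∈ K, k ≠ l ∧ Mixes (link Ω i (ω i)) k (1 / 2))
    {f : ℕ → ℕ → α → α → Γ} {G : ℕ → α → ℕ → α → Γ}
    (hG : ∀ k ∈ K, ∀ ω ∈ Ω,
      β * prob (link Ω k (ω k)) (LocalBad I f G k) ≤ prob (link Ω k (ω k)) (TriangleBad I f))
    {h : ℕ → ℕ → α → α → Γ} (hh : ∀ k ∈ K, ∀ l ∈ K, k < l → ∀ ω ∈ Ω,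
      prob (link (link Ω k (ω k)) l (ω l)) (NerveBad I G h k l) ≤
        3 * prob (link (link Ω k (ω k)) l (ω l))
          (fun ω => LocalBad I f G k ω ∨ LocalBad I f G l ω))
    (κ : ℕ → α → Γ) :
    ∃ g : ℕ → α → Γ, prob Ω (EdgeBad I f g) ≤ (1 + 162 * #I) * (β⁻¹ * prob Ω (TriangleBad I f)) +
      3 * #I * prob Ω (EdgeBad K h κ) := by
  set ε := β⁻¹ * prob Ω (TriangleBad I f)
  let Q : (ℕ → α) → Prop := fun ω =>
    EdgeBad K h κ ω ∨ ∃ k ∈ K, ∃ l ∈ K, k < l ∧ NerveBad I G h k l ω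
  have hQ : prob Ω Q ≤ prob Ω (EdgeBad K h κ) + 54 * ε := by
    refine prob_or_le.trans (add_le_add le_rfl ?_)
    have h1 : ∀ k ∈ K, prob Ω (fun ω => ∃ l ∈ K, k < l ∧ NerveBad I G h k l ω) ≤ #K * (6 * ε) := by
      intro k hk
      refine prob_exists_le_card _ _ fun l hl => ?_
      by_cases hkl : k < l
      · exact (prob_mono fun ω _ h => h.2).trans (prob_nerveBad_le hβ hG hh hk hl hkl)
      · rw [prob_eq_zero fun ω _ h => hkl h.1]
        exact mul_nonneg (by norm_num) (mul_nonneg (inv_nonneg.2 hβ.le) prob_nonneg)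
    refine (prob_exists_le_card _ _ h1).trans (le_of_eq ?_)
    rw [hK]
    norm_num
    ring
  have : ∀ i x, ∃ c : Γ, i ∈ I → ∀ ω ∈ Ω, ω i = x →
      prob (link Ω i x) (fun ω => ∃ k ∈ K, κ k (ω k) * G k (ω k) i x ≠ c) ≤
        3 * prob (link Ω i x) Q := by
    intro i x
    by_cases H : i ∈ I ∧ ∃ ω ∈ Ω, ω i = x
    · obtain ⟨hi, ω, hω, rfl⟩ := H
      obtain ⟨k, hk, l, hl, hkl, hm⟩ := hmix i hi ω hω
      obtain ⟨c, hc⟩ := hm.exists_common_value hk hl hkl ⟨ω, mem_link.2 ⟨hω, rfl⟩⟩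
        (fun k y => κ k y * G k y i (ω i))
      refine ⟨c, fun _ _ _ _ => hc.trans ?_⟩
      refine mul_le_mul_of_nonneg_left (prob_mono ?_) (by norm_num)
      rintro ω' hω' ⟨k, hk, l, hl, hlt, hne⟩
      by_contra hcon
      obtain ⟨h1, h2⟩ := not_or.1 hcon
      simp only [EdgeBad, NerveBad, not_exists, not_and, not_not] at h1 h2
      have h3 := h1 k hk l hl hlt
      have h4 := h2 k hk l hl hlt i hi
      rw [(mem_link.1 hω').2] at h4
      apply hne
      rw [h3] at h4
      have h5 := congrArg (fun z => κ k (ω' k) * z * G l (ω' l) i (ω i)) h4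
      simpa [mul_assoc] using h5
    · exact ⟨1, fun hi ω hω e => absurd ⟨hi, ω, hω, e⟩ H⟩
  choose g hg using this
  refine ⟨g, ?_⟩
  let R : ℕ → (ℕ → α) → Prop := fun i ω => ∃ k ∈ K, κ k (ω k) * G k (ω k) i (ω i) ≠ g i (ω i)
  have hR : ∀ i ∈ I, prob Ω (R i) ≤ 3 * prob Ω Q := by
    intro i hi
    refine prob_le_of_link i fun ω hω => ?_
    refine le_trans (le_of_eq (prob_congr fun ω' hω' => ?_)) (hg i (ω i) hi ω hω rfl)
    change (∃ k ∈ K, κ k (ω' k) * G k (ω' k) i (ω' i) ≠ g i (ω' i)) ↔ _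
    rw [(mem_link.1 hω').2]
  obtain ⟨k, hk⟩ : K.Nonempty := card_pos.1 (by omega)
  have h1 : prob Ω (EdgeBad I f g) ≤
      prob Ω (LocalBad I f G k) + prob Ω (fun ω => ∃ i ∈ I, R i ω) := by
    refine le_trans (prob_mono ?_) prob_or_le
    rintro ω hω ⟨i, hi, j, hj, hlt, hne⟩
    by_contra hcon
    obtain ⟨h1, h2⟩ := not_or.1 hcon
    simp only [LocalBad, EdgeBad, R, not_exists, not_and, not_not] at h1 h2
    apply hne
    rw [h1 i hi j hj hlt, ← h2 i hi k hk, ← h2 j hj k hk]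
    group
  have h2 := prob_exists_le_card I R hR
  have h3 := prob_localBad_le hβ (hG k hk)
  have hI : (0 : ℝ) ≤ #I := Nat.cast_nonneg _
  have h4 : (#I : ℝ) * (3 * prob Ω Q) ≤ #I * (3 * (prob Ω (EdgeBad K h κ) + 54 * ε)) := by
    gcongr
  change _ ≤ ε at h3
  linarith

/-- The quotients of local solutions at any one `i ∈ I` telescope exactly, so `h` can fail the
cocycle condition only where it differs from a quotient. -/
theorem nerveBad_of_triangleBad {G : ℕ → α → ℕ → α → Γ} {h : ℕ → ℕ → α → α → Γ}
    (hI : I.Nonempty) {k l m : ℕ} {ω : ℕ → α}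
    (hne : h k l (ω k) (ω l) * h l m (ω l) (ω m) ≠ h k m (ω k) (ω m)) :
    NerveBad I G h k l ω ∨ NerveBad I G h l m ω ∨ NerveBad I G h k m ω := by
  by_contra hcon
  simp only [NerveBad, not_or, not_exists, not_and, not_not] at hcon
  obtain ⟨i, hi⟩ := hI
  apply hne
  rw [← hcon.1 i hi, ← hcon.2.1 i hi, ← hcon.2.2 i hi]
  group

/-- A family expands if the links of the vertices of an expanding nerve expand. -/
theorem Expands.of_nerve {γ : ℝ} (hβ : 0 < β) (hγ : 0 < γ) (hγ1 : γ ≤ 1)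
    (hK : #K = 3) (hI : I.Nonempty) (hI4 : #I ≤ 4)
    (hloc : ∀ k ∈ K, ∀ ω ∈ Ω, Expands.{u, v} (link Ω k (ω k)) I β)
    (hnerve : Expands.{u, v} Ω K γ)
    (hmix₁ : ∀ k ∈ K, ∀ l ∈ K, k < l → ∀ ω ∈ Ω, ∃ i ∈ I, ∃ j ∈ I, i ≠ j ∧
      Mixes (link (link Ω k (ω k)) l (ω l)) i (1 / 2))
    (hmix₂ : ∀ i ∈ I, ∀ ω ∈ Ω, ∃ k ∈ K, ∃ l ∈ K, k ≠ l ∧ Mixes (link Ω i (ω i)) k (1 / 2)) :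
    Expands.{u, v} Ω I (β * γ / 2000) := by
  intro Γ _ f
  obtain ⟨G, hG⟩ := exists_local_solutions hloc f
  obtain ⟨h, hh⟩ := exists_nerve_function hmix₁ f G
  obtain ⟨κ, hκ⟩ := hnerve Γ h
  obtain ⟨g, hg⟩ := exists_global_solution hβ hK hmix₂ hG hh κ
  refine ⟨g, ?_⟩
  set ε := prob Ω (TriangleBad I f)
  have hε : 0 ≤ ε := prob_nonneg
  have hx : 0 ≤ β⁻¹ * ε := mul_nonneg (inv_nonneg.2 hβ.le) hε
  have h1 : prob Ω (TriangleBad K h) ≤ 54 * (β⁻¹ * ε) := by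
    have h1 : ∀ k ∈ K, prob Ω (fun ω => ∃ l ∈ K, k < l ∧ NerveBad I G h k l ω) ≤
        #K * (6 * (β⁻¹ * ε)) := by
      intro k hk
      refine prob_exists_le_card _ _ fun l hl => ?_
      by_cases hkl : k < l
      · exact (prob_mono fun ω _ h => h.2).trans (prob_nerveBad_le hβ hG hh hk hl hkl)
      · rw [prob_eq_zero fun ω _ h => hkl h.1]
        positivity
    refine le_trans (prob_mono ?_) ((prob_exists_le_card K _ h1).trans (le_of_eq ?_))
    · rintro ω hω ⟨k, hk, l, hl, m, hm, hkl, hlm, hne⟩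
      rcases nerveBad_of_triangleBad hI hne with H | H | H
      · exact ⟨k, hk, l, hl, hkl, H⟩
      · exact ⟨l, hl, m, hm, hlm, H⟩
      · exact ⟨k, hk, m, hm, hkl.trans hlm, H⟩
    · rw [hK]
      norm_num
      ring
  have h2 : (#I : ℝ) ≤ 4 := by exact_mod_cast hI4
  have h3 : prob Ω (EdgeBad K h κ) ≤ 54 * (β⁻¹ * ε) / γ := by
    rw [le_div_iff₀' hγ]
    exact hκ.trans h1
  have h4 : β⁻¹ * ε ≤ β⁻¹ * ε / γ := by
    rw [le_div_iff₀ hγ]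
    exact mul_le_of_le_one_right hx hγ1
  -- With `#I ≤ 4` the two contributions are `1 + 162 * 4 = 649` and `12 * 54 = 648`; the sum is
  -- rounded up.
  have h5 : prob Ω (EdgeBad I f g) ≤ 2000 * (β⁻¹ * ε / γ) := by
    refine hg.trans ?_
    have e1 : (1 + 162 * (#I : ℝ)) * (β⁻¹ * ε) ≤ 649 * (β⁻¹ * ε / γ) :=
      mul_le_mul (by linarith) h4 hx (by norm_num)
    have e2 : 3 * (#I : ℝ) * prob Ω (EdgeBad K h κ) ≤ 12 * (54 * (β⁻¹ * ε) / γ) :=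
      mul_le_mul (by linarith) h3 prob_nonneg (by norm_num)
    have e3 : 54 * (β⁻¹ * ε) / γ = 54 * (β⁻¹ * ε / γ) := by ring
    have e4 : 0 ≤ β⁻¹ * ε / γ := by positivity
    linarith
  calc β * γ / 2000 * prob Ω (EdgeBad I f g) ≤ β * γ / 2000 * (2000 * (β⁻¹ * ε / γ)) := by gcongr
    _ = ε := by field_simp

end Expansion

/-! ### Strong mixing removes the constant of the nerve -/

section LargeGap

variable {α : Type u} {Γ : Type v} [Group Γ]
variable {Ω : Finset (ℕ → α)} {I K : Finset ℕ} {β : ℝ}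

/-- Sampling by `l` inside the link of `ω k`, averaged over `ω`. Links in which the mean already
exceeds `t` make up the last term. -/
theorem prob_link_link_le {lam : ℝ} (h0 : 0 ≤ lam) {k l : ℕ}
    (hmix : ∀ ω ∈ Ω, Mixes (link Ω k (ω k)) l lam) {D : (ℕ → α) → Prop} (hD : DependsOn D {l}ᶜ)
    {t : ℝ} (ht : 0 < t) :
    prob Ω (fun ω => 2 * t ≤ prob (link (link Ω k (ω k)) l (ω l)) D) ≤
      lam ^ 2 / t ^ 2 * prob Ω D + prob Ω (fun ω => t < prob (link Ω k (ω k)) D) := by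
  rw [← prob_link k (fun ω => 2 * t ≤ prob (link (link Ω k (ω k)) l (ω l)) D), ← prob_link k D]
  conv_rhs => rw [prob]
  rw [← avg_mul_left, ← avg_add]
  refine avg_mono fun ω hω => ?_
  refine le_trans (le_of_eq (prob_congr fun ω' hω' => ?_)) ((hmix ω hω).sampling' h0 hD ht)
  rw [(mem_link.1 hω').2]

theorem prob_link_link_link_le {lam : ℝ} (h0 : 0 ≤ lam) {k l m : ℕ}
    (hmix : ∀ ω ∈ Ω, Mixes (link (link Ω k (ω k)) l (ω l)) m lam) {D : (ℕ → α) → Prop}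
    (hD : DependsOn D {m}ᶜ) {t : ℝ} (ht : 0 < t) :
    prob Ω (fun ω => 2 * t ≤ prob (link (link (link Ω k (ω k)) l (ω l)) m (ω m)) D) ≤
      lam ^ 2 / t ^ 2 * prob Ω D +
        prob Ω (fun ω => t < prob (link (link Ω k (ω k)) l (ω l)) D) := by
  rw [← prob_link k
    (fun ω => 2 * t ≤ prob (link (link (link Ω k (ω k)) l (ω l)) m (ω m)) D), ← prob_link k D,
    ← prob_link k (fun ω => t < prob (link (link Ω k (ω k)) l (ω l)) D),
    ← avg_mul_left, ← avg_add]
  refine avg_mono fun ω hω => ?_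
  have h1 := prob_link_link_le (Ω := link Ω k (ω k)) h0 (k := l) (l := m) (fun ω' hω' => ?_) hD ht
  · refine le_trans (le_of_eq (prob_congr fun ω' hω' => ?_)) (h1.trans (le_of_eq ?_))
    · rw [(mem_link.1 hω').2]
    · congr 1
      refine prob_congr fun ω' hω' => ?_
      rw [(mem_link.1 hω').2]
  · have := hmix ω' (mem_link.1 hω').1
    rwa [(mem_link.1 hω').2] at this

/-- A local solution can be bad on a fixed proportion of a double link for two reasons. Either it is
already bad on the link of `ω k`, which forces `TriangleBad` to have probability at least `β / 72`
there, twice the admitted mean; or `ω l` samples it badly. Both are sampling failures and carry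
`λ²`, with constants `144 ^ 2` and `72 ^ 2`. -/
theorem prob_localBad_link_le {lam : ℝ} (h0 : 0 ≤ lam) (hβ : 0 < β) {f : ℕ → ℕ → α → α → Γ}
    {G : ℕ → α → ℕ → α → Γ} {k l : ℕ} (hkl : k ≠ l) (hk : k ∉ I) (hl : l ∉ I)
    (hmix₁ : Mixes Ω k lam) (hmix₂ : ∀ ω ∈ Ω, Mixes (link Ω k (ω k)) l lam)
    (hG : ∀ ω ∈ Ω,
      β * prob (link Ω k (ω k)) (LocalBad I f G k) ≤ prob (link Ω k (ω k)) (TriangleBad I f))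
    (hε : prob Ω (TriangleBad I f) ≤ β / 144) :
    prob Ω (fun ω => 1 / 36 ≤ prob (link (link Ω k (ω k)) l (ω l)) (LocalBad I f G k)) ≤
      lam ^ 2 * (5184 * (β⁻¹ * prob Ω (TriangleBad I f)) +
        20736 * (β⁻¹ * (β⁻¹ * prob Ω (TriangleBad I f)))) := by
  have h1 := prob_link_link_le h0 hmix₂ (dependsOn_localBad f G hkl hl)
    (t := 1 / 72) (by norm_num)
  have h2 := prob_localBad_le hβ hG
  have h3 : prob Ω (fun ω => 1 / 72 < prob (link Ω k (ω k)) (LocalBad I f G k)) ≤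
      prob Ω (fun ω => 2 * (β / 144) ≤ prob (link Ω k (ω k)) (TriangleBad I f)) := by
    refine prob_mono fun ω hω h => le_trans ?_ (hG ω hω)
    nlinarith
  have h4 := hmix₁.sampling h0 (dependsOn_triangleBad f hk) (t := β / 144) (by positivity) hε
  have h5 : lam ^ 2 / (β / 144) ^ 2 * prob Ω (TriangleBad I f) =
      lam ^ 2 * (20736 * (β⁻¹ * (β⁻¹ * prob Ω (TriangleBad I f)))) := by
    field_simp
    ring
  have h6 : lam ^ 2 / (1 / 72) ^ 2 * prob Ω (LocalBad I f G k) ≤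
      lam ^ 2 * (5184 * (β⁻¹ * prob Ω (TriangleBad I f))) := by
    calc lam ^ 2 / (1 / 72) ^ 2 * prob Ω (LocalBad I f G k)
        = lam ^ 2 * (5184 * prob Ω (LocalBad I f G k)) := by ring
      _ ≤ _ := by gcongr
  norm_num at h1 h6 ⊢
  linarith

/-- If the mixing is good enough, the expansion of the nerve does not enter the bound. -/
theorem Expands.of_nerve_of_mixes {γ lam : ℝ} (hβ : 0 < β) (hβ1 : β ≤ 1)
    (hγ : 0 < γ) (h0 : 0 ≤ lam) (hlam : 1500000 * lam ^ 2 ≤ β * γ)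
    (hK : #K = 3) (hI : I.Nonempty) (hI4 : #I ≤ 4) (hKI : ∀ k ∈ K, k ∉ I)
    (hloc : ∀ k ∈ K, ∀ ω ∈ Ω, Expands.{u, v} (link Ω k (ω k)) I β)
    (hnerve : Expands.{u, v} Ω K γ)
    (hmix₁ : ∀ k ∈ K, ∀ l ∈ K, k < l → ∀ ω ∈ Ω, ∃ i ∈ I, ∃ j ∈ I, i ≠ j ∧
      Mixes (link (link Ω k (ω k)) l (ω l)) i (1 / 2))
    (hmix₂ : ∀ i ∈ I, ∀ ω ∈ Ω, ∃ k ∈ K, ∃ l ∈ K, k ≠ l ∧ Mixes (link Ω i (ω i)) k (1 / 2))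
    (hs₁ : ∀ k ∈ K, Mixes Ω k lam)
    (hs₂ : ∀ k ∈ K, ∀ l ∈ K, k ≠ l → ∀ ω ∈ Ω, Mixes (link Ω k (ω k)) l lam)
    (hs₃ : ∀ k ∈ K, ∀ l ∈ K, ∀ m ∈ K, k ≠ l → k ≠ m → l ≠ m → ∀ ω ∈ Ω,
      Mixes (link (link Ω k (ω k)) l (ω l)) m lam) :
    Expands.{u, v} Ω I (β / 1000) := by
  intro Γ _ f
  -- If this fails, every `g` satisfies the claim, since `β / 1000 ≤ β / 144`. If it holds, the mean
  -- is small enough for sampling.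
  by_cases hε : prob Ω (TriangleBad I f) ≤ β / 144
  swap
  · refine ⟨1, ?_⟩
    have : β / 1000 * prob Ω (EdgeBad I f 1) ≤ β / 1000 * 1 := by
      gcongr
      exact prob_le_one
    linarith
  obtain ⟨G, hG⟩ := exists_local_solutions hloc f
  obtain ⟨h, hh⟩ := exists_nerve_function hmix₁ f G
  obtain ⟨κ, hκ⟩ := hnerve Γ h
  obtain ⟨g, hg⟩ := exists_global_solution hβ hK hmix₂ hG hh κ
  refine ⟨g, ?_⟩
  set ε := prob Ω (TriangleBad I f) with hεdef
  have hε0 : 0 ≤ ε := prob_nonneg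
  set x := β⁻¹ * ε with hx
  have hx0 : 0 ≤ x := mul_nonneg (inv_nonneg.2 hβ.le) hε0
  have hxx : x ≤ β⁻¹ * x := le_mul_of_one_le_left hx0 ((one_le_inv₀ hβ).2 hβ1)
  -- On the flags through three fixed vertices the values of `h` on their triangle are fixed. If
  -- `δh` is nontrivial there, each of these flags violates one of three nerve relations, so one
  -- relation is violated with probability at least a third.
  let S : ℕ → ℕ → ℕ → (ℕ → α) → Prop := fun k l m ω =>
    1 / 3 ≤ prob (link (link (link Ω k (ω k)) l (ω l)) m (ω m)) (NerveBad I G h k l)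
  -- A third on the triple link needs a sampling failure or more than `1 / 6` on the double link.
  -- The latter needs `1 / 36` for one of the two local solutions, as `3 * (1 / 36 + 1 / 36) = 1 /
  -- 6`. The constant is `216 + 2 * (5184 + 20736) = 52056`.
  have hS : ∀ k ∈ K, ∀ l ∈ K, ∀ m ∈ K, k < l → k ≠ m → l ≠ m →
      prob Ω (S k l m) ≤ lam ^ 2 * (52056 * (β⁻¹ * x)) := by
    intro k hk l hl m hm hkl hkm hlm
    have h1 := prob_link_link_link_le h0 (hs₃ k hk l hl m hm hkl.ne hkm hlm)
      (dependsOn_nerveBad G h hkm hlm (hKI m hm)) (t := 1 / 6) (by norm_num)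
    have h2 := prob_nerveBad_le hβ hG hh hk hl hkl
    have h3 : prob Ω (fun ω => 1 / 6 <
        prob (link (link Ω k (ω k)) l (ω l)) (NerveBad I G h k l)) ≤
        prob Ω (fun ω => 1 / 36 ≤ prob (link (link Ω k (ω k)) l (ω l)) (LocalBad I f G k)) +
        prob Ω (fun ω =>
          1 / 36 ≤ prob (link (link Ω l (ω l)) k (ω k)) (LocalBad I f G l)) := by
      refine le_trans (prob_mono fun ω hω H => ?_) prob_or_le
      have e1 := hh k hk l hl hkl ω hω
      have e2 := prob_or_le (Ω := link (link Ω k (ω k)) l (ω l)) (P := LocalBad I f G k)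
        (Q := LocalBad I f G l)
      by_contra hcon
      obtain ⟨e3, e4⟩ := not_or.1 hcon
      rw [link_comm] at e4
      linarith
    have h4 := prob_localBad_link_le h0 hβ hkl.ne (hKI k hk) (hKI l hl) (hs₁ k hk)
      (hs₂ k hk l hl hkl.ne) (hG k hk) hε
    have h5 := prob_localBad_link_le h0 hβ hkl.ne' (hKI l hl) (hKI k hk) (hs₁ l hl)
      (hs₂ l hl k hk hkl.ne') (hG l hl) hε
    rw [← hεdef, ← hx] at h4 h5 h2
    have h6 : lam ^ 2 / (1 / 6) ^ 2 * prob Ω (NerveBad I G h k l) ≤ lam ^ 2 * (216 * x) := by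
      calc lam ^ 2 / (1 / 6) ^ 2 * prob Ω (NerveBad I G h k l)
          = lam ^ 2 * (36 * prob Ω (NerveBad I G h k l)) := by ring
        _ ≤ lam ^ 2 * (36 * (6 * x)) := by gcongr
        _ = _ := by ring
    have h7 : lam ^ 2 * x ≤ lam ^ 2 * (β⁻¹ * x) := by gcongr
    have h8 : prob Ω (S k l m) = prob Ω (fun ω => 2 * (1 / 6) ≤
        prob (link (link (link Ω k (ω k)) l (ω l)) m (ω m)) (NerveBad I G h k l)) := by
      norm_num [S]
    rw [h8]
    linarith
  -- There are `27` choices of `k, l, m`, and `27 * 52056 < 1500000`. By `hlam` the factor `λ²` then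
  -- supplies the `γ` that the expansion of the nerve divides by.
  have hθ : prob Ω (TriangleBad K h) ≤ γ * x := by
    have hb : 0 ≤ lam ^ 2 * (52056 * (β⁻¹ * x)) := by positivity
    have h1 : prob Ω (TriangleBad K h) ≤ prob Ω (fun ω => ∃ k ∈ K, ∃ l ∈ K, ∃ m ∈ K,
        (k < l ∧ k ≠ m ∧ l ≠ m) ∧ S k l m ω) := by
      refine prob_mono ?_
      rintro ω hω ⟨k, hk, l, hl, m, hm, hkl, hlm, hne⟩
      set L := link (link (link Ω k (ω k)) l (ω l)) m (ω m)
      have hL : ∀ ω' ∈ L, ω' k = ω k ∧ ω' l = ω l ∧ ω' m = ω m := by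
        intro ω' hω'
        obtain ⟨h3, e3⟩ := mem_link.1 hω'
        obtain ⟨h2, e2⟩ := mem_link.1 h3
        exact ⟨(mem_link.1 h2).2, e2, e3⟩
      have e1 : prob L (fun ω => NerveBad I G h k l ω ∨ NerveBad I G h l m ω ∨
          NerveBad I G h k m ω) = 1 := by
        refine prob_eq_one ⟨ω, ?_⟩ fun ω' hω' => ?_
        · simp [L, mem_link, hω]
        · refine nerveBad_of_triangleBad hI ?_
          obtain ⟨e1, e2, e3⟩ := hL ω' hω'
          rwa [e1, e2, e3]
      have e2 := prob_or_le (Ω := L) (P := NerveBad I G h k l)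
        (Q := fun ω => NerveBad I G h l m ω ∨ NerveBad I G h k m ω)
      have e3 := prob_or_le (Ω := L) (P := NerveBad I G h l m) (Q := NerveBad I G h k m)
      by_contra hcon
      have f1 : ¬S k l m ω := fun H =>
        hcon ⟨k, hk, l, hl, m, hm, ⟨hkl, (hkl.trans hlm).ne, hlm.ne⟩, H⟩
      have f2 : ¬S l m k ω := fun H =>
        hcon ⟨l, hl, m, hm, k, hk, ⟨hlm, hkl.ne', (hkl.trans hlm).ne'⟩, H⟩
      have f3 : ¬S k m l ω := fun H =>
        hcon ⟨k, hk, m, hm, l, hl, ⟨hkl.trans hlm, hkl.ne, hlm.ne'⟩, H⟩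
      have g2 : link (link (link Ω l (ω l)) m (ω m)) k (ω k) = L := by
        rw [link_comm m k, link_comm l k]
      have g3 : link (link (link Ω k (ω k)) m (ω m)) l (ω l) = L := by
        rw [link_comm m l]
      simp only [S] at f1 f2 f3
      rw [g2] at f2
      rw [g3] at f3
      linarith
    have h2 : prob Ω (fun ω => ∃ k ∈ K, ∃ l ∈ K, ∃ m ∈ K,
        (k < l ∧ k ≠ m ∧ l ≠ m) ∧ S k l m ω) ≤
        #K * (#K * (#K * (lam ^ 2 * (52056 * (β⁻¹ * x))))) := by
      refine prob_exists_le_card _ _ fun k hk => prob_exists_le_card _ _ fun l hl =>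
        prob_exists_le_card _ _ fun m hm => ?_
      by_cases H : k < l ∧ k ≠ m ∧ l ≠ m
      · exact (prob_mono fun ω _ h => h.2).trans (hS k hk l hl m hm H.1 H.2.1 H.2.2)
      · rw [prob_eq_zero fun ω _ h => H h.1]
        exact hb
    rw [hK] at h2
    have h3 : 1500000 * lam ^ 2 * (β⁻¹ * x) ≤ β * γ * (β⁻¹ * x) := by gcongr
    have h4 : β * γ * (β⁻¹ * x) = γ * x := by field_simp
    have h5 : 0 ≤ lam ^ 2 * (β⁻¹ * x) := by positivity
    push_cast at h2
    linarith
  have h1 : prob Ω (EdgeBad K h κ) ≤ x := le_of_mul_le_mul_left (hκ.trans hθ) hγ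
  have hI4' : (#I : ℝ) ≤ 4 := by exact_mod_cast hI4
  have h2 : prob Ω (EdgeBad I f g) ≤ 1000 * x := by
    refine hg.trans ?_
    have e1 : (1 + 162 * (#I : ℝ)) * x ≤ 649 * x :=
      mul_le_mul_of_nonneg_right (by linarith) hx0
    have e2 : 3 * (#I : ℝ) * prob Ω (EdgeBad K h κ) ≤ 12 * x :=
      mul_le_mul (by linarith) h1 prob_nonneg (by norm_num)
    linarith
  calc β / 1000 * prob Ω (EdgeBad I f g) ≤ β / 1000 * (1000 * x) := by gcongr
    _ = ε := by rw [hx]; field_simp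

end LargeGap

/-! ### Expansion of joins -/

section Join

variable {α : Type u}

/-- The coordinates up to `k` of `ω`, followed by those of `ω'`. -/
def splice (k : ℕ) (ω ω' : ℕ → α) : ℕ → α := fun i => if i ≤ k then ω i else ω' i

theorem splice_of_le {k i : ℕ} (h : i ≤ k) (ω ω' : ℕ → α) : splice k ω ω' i = ω i := if_pos h

theorem splice_of_lt {k i : ℕ} (h : k < i) (ω ω' : ℕ → α) : splice k ω ω' i = ω' i :=
  if_neg (not_le.2 h)

/-- Exchanging the upper parts of two members is an involution of `Ω ×ˢ Ω`, so a splice of two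
independent uniform members is uniform. -/
theorem avg_avg_splice {Ω : Finset (ℕ → α)} {k : ℕ} (hΩ : Ω.Nonempty)
    (hs : ∀ ω ∈ Ω, ∀ ω' ∈ Ω, splice k ω ω' ∈ Ω) (φ : (ℕ → α) → ℝ) :
    avg Ω (fun ω => avg Ω fun ω' => φ (splice k ω ω')) = avg Ω φ := by
  have h1 : ∑ p ∈ Ω ×ˢ Ω, φ (splice k p.1 p.2) = ∑ p ∈ Ω ×ˢ Ω, φ p.1 := by
    refine sum_nbij' (fun p => (splice k p.1 p.2, splice k p.2 p.1))
      (fun p => (splice k p.1 p.2, splice k p.2 p.1)) ?_ ?_ ?_ ?_ ?_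
    · intro p hp
      obtain ⟨h1, h2⟩ := mem_product.1 hp
      exact mem_product.2 ⟨hs _ h1 _ h2, hs _ h2 _ h1⟩
    · intro p hp
      obtain ⟨h1, h2⟩ := mem_product.1 hp
      exact mem_product.2 ⟨hs _ h1 _ h2, hs _ h2 _ h1⟩
    · intro p _
      ext i <;> simp only [splice] <;> split_ifs <;> rfl
    · intro p _
      ext i <;> simp only [splice] <;> split_ifs <;> rfl
    · intro p _
      rfl
  rw [sum_product, sum_product] at h1
  have h0 : (#Ω : ℝ) ≠ 0 := by exact_mod_cast hΩ.card_pos.ne'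
  unfold avg
  rw [← sum_div, h1]
  simp only [sum_const, nsmul_eq_mul]
  rw [← mul_sum, mul_div_cancel_left₀ _ h0]

theorem avg_prob_splice {Ω : Finset (ℕ → α)} {k : ℕ} (hΩ : Ω.Nonempty)
    (hs : ∀ ω ∈ Ω, ∀ ω' ∈ Ω, splice k ω ω' ∈ Ω) (P : (ℕ → α) → Prop) :
    avg Ω (fun ω => prob Ω fun ω' => P (splice k ω ω')) = prob Ω P := by
  classical
  exact avg_avg_splice hΩ hs fun ω => if P ω then 1 else 0

/-- Joins expand. -/
theorem Expands.of_splice {Ω : Finset (ℕ → α)} {I : Finset ℕ} {k i₁ j₁ j₂ : ℕ} (hΩ : Ω.Nonempty)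
    (hs : ∀ ω ∈ Ω, ∀ ω' ∈ Ω, splice k ω ω' ∈ Ω) (hI4 : #I ≤ 4) (hi₁ : i₁ ∈ I) (hi₁k : i₁ ≤ k)
    (hj₁ : j₁ ∈ I) (hj₂ : j₂ ∈ I) (hkj₁ : k < j₁) (hkj₂ : k < j₂) (hne : j₁ ≠ j₂)
    (hmix : ∀ i ∈ I, i ≤ k → ∀ ω ∈ Ω, Mixes (link Ω i (ω i)) j₁ (1 / 2)) :
    Expands.{u, v} Ω I (1 / 26) := by
  intro Γ _ f
  set ε := prob Ω (TriangleBad I f)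
  -- A lower part no worse than average. Its vertex `ω₀ i₁` is joined to all upper parts and becomes
  -- the apex of a cone, which defines the solution `γ` on the upper colours.
  obtain ⟨ω₀, hω₀, hle⟩ := exists_le_avg (φ := fun ω => prob Ω fun ω' =>
    TriangleBad I f (splice k ω ω')) hΩ
  have hle' : prob Ω (fun ω => TriangleBad I f (splice k ω₀ ω)) ≤ ε :=
    hle.trans (avg_prob_splice hΩ hs _).le
  set Q : (ℕ → α) → Prop := fun ω => TriangleBad I f ω ∨ TriangleBad I f (splice k ω₀ ω)
  have hQ : prob Ω Q ≤ 2 * ε :=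
    (prob_or_le.trans (add_le_add le_rfl hle')).trans_eq (two_mul ε).symm
  let γ : ℕ → α → Γ := fun j y => f i₁ j (ω₀ i₁) y
  have hγ : ∀ ω, ¬Q ω → ∀ i ∈ I, ∀ j ∈ I, k < i → i < j →
      f i j (ω i) (ω j) = (γ i (ω i))⁻¹ * γ j (ω j) := by
    intro ω hω i hi j hj hki hij
    have h1 := (not_or.1 hω).2
    simp only [TriangleBad, not_exists, not_and, not_not] at h1
    have h2 := h1 i₁ hi₁ i hi j hj (hi₁k.trans_lt hki) hij
    rw [splice_of_le hi₁k, splice_of_lt hki, splice_of_lt (hki.trans hij)] at h2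
    change _ = (f i₁ i (ω₀ i₁) (ω i))⁻¹ * f i₁ j (ω₀ i₁) (ω j)
    rw [← h2, inv_mul_cancel_left]
  set I₂ := I.filter (k < ·)
  -- For a lower vertex the triangles with two upper vertices show that `γ j * (f i j)⁻¹` is almost
  -- independent of the upper colour `j`; the value of `g` is its majority.
  have : ∀ i x, ∃ c : Γ, i ∈ I → i ≤ k → ∀ ω ∈ Ω, ω i = x →
      prob (link Ω i x) (fun ω => ∃ j ∈ I₂, γ j (ω j) * (f i j x (ω j))⁻¹ ≠ c) ≤
        3 * prob (link Ω i x) Q := by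
    intro i x
    by_cases H : i ∈ I ∧ i ≤ k ∧ ∃ ω ∈ Ω, ω i = x
    · obtain ⟨hi, hik, ω, hω, rfl⟩ := H
      obtain ⟨c, hc⟩ := (hmix i hi hik ω hω).exists_common_value
        (I := I₂) (mem_filter.2 ⟨hj₁, hkj₁⟩)
        (mem_filter.2 ⟨hj₂, hkj₂⟩) hne ⟨ω, mem_link.2 ⟨hω, rfl⟩⟩
        (fun j y => γ j y * (f i j (ω i) y)⁻¹)
      refine ⟨c, fun _ _ _ _ _ => hc.trans ?_⟩
      refine mul_le_mul_of_nonneg_left (prob_mono ?_) (by norm_num)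
      rintro ω' hω' ⟨j, hj, l, hl, hlt, hne⟩
      by_contra hcon
      obtain ⟨hj, hkj⟩ := mem_filter.1 hj
      obtain ⟨hl, hkl⟩ := mem_filter.1 hl
      have h1 := hγ ω' hcon j hj l hl hkj hlt
      have h2 := (not_or.1 hcon).1
      simp only [TriangleBad, not_exists, not_and, not_not] at h2
      have h3 := h2 i hi j hj l hl (hik.trans_lt hkj) hlt
      rw [(mem_link.1 hω').2, h1] at h3
      apply hne
      rw [← h3]
      group
    · exact ⟨1, fun hi hik ω hω e => absurd ⟨hi, hik, ω, hω, e⟩ H⟩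
  choose g₁ hg₁ using this
  let g : ℕ → α → Γ := fun i x => if i ≤ k then g₁ i x else γ i x
  refine ⟨g, ?_⟩
  let R : ℕ → (ℕ → α) → Prop := fun i ω => i ≤ k ∧ ∃ j ∈ I₂,
    γ j (ω j) * (f i j (ω i) (ω j))⁻¹ ≠ g₁ i (ω i)
  have hR : ∀ i ∈ I, prob Ω (R i) ≤ 6 * ε := by
    intro i hi
    by_cases hik : i ≤ k
    · have : prob Ω (R i) ≤ 3 * prob Ω Q := by
        refine prob_le_of_link i fun ω hω => ?_
        refine le_trans (le_of_eq (prob_congr fun ω' hω' => ?_)) (hg₁ i (ω i) hi hik ω hω rfl)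
        change (i ≤ k ∧ ∃ j ∈ I₂, γ j (ω' j) * (f i j (ω' i) (ω' j))⁻¹ ≠ g₁ i (ω' i)) ↔ _
        rw [(mem_link.1 hω').2]
        exact and_iff_right hik
      linarith
    · rw [prob_eq_zero fun ω _ h => hik h.1]
      exact mul_nonneg (by norm_num) prob_nonneg
  have h1 : prob Ω (EdgeBad I f g) ≤ prob Ω Q + prob Ω (fun ω => ∃ i ∈ I, R i ω) := by
    refine le_trans (prob_mono ?_) prob_or_le
    rintro ω hω ⟨i, hi, j, hj, hij, hne⟩
    by_contra hcon
    obtain ⟨hq, hr⟩ := not_or.1 hcon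
    have hr' : ∀ i ∈ I, i ≤ k → ∀ j ∈ I, k < j →
        γ j (ω j) * (f i j (ω i) (ω j))⁻¹ = g₁ i (ω i) := by
      intro i hi hik j hj hkj
      by_contra hne
      exact hr ⟨i, hi, hik, j, mem_filter.2 ⟨hj, hkj⟩, hne⟩
    apply hne
    by_cases hik : i ≤ k
    · have e1 : g i (ω i) = g₁ i (ω i) := if_pos hik
      by_cases hjk : j ≤ k
      · have e2 : g j (ω j) = g₁ j (ω j) := if_pos hjk
        -- An edge below `k` is recovered from its triangle with the upper colour `j₁`.
        have h2 := (not_or.1 hq).1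
        simp only [TriangleBad, not_exists, not_and, not_not] at h2
        have h3 := h2 i hi j hj j₁ hj₁ hij (hjk.trans_lt hkj₁)
        rw [e1, e2, ← hr' i hi hik j₁ hj₁ hkj₁, ← hr' j hj hjk j₁ hj₁ hkj₁, ← h3]
        group
      · have e2 : g j (ω j) = γ j (ω j) := if_neg hjk
        rw [e1, e2, ← hr' i hi hik j hj (not_le.1 hjk)]
        group
    · have hki := not_le.1 hik
      have e1 : g i (ω i) = γ i (ω i) := if_neg hik
      have e2 : g j (ω j) = γ j (ω j) := if_neg (not_le.2 (hki.trans hij))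
      rw [e1, e2]
      exact hγ ω hq i hi j hj hki hij
  -- The event `Q` costs `2ε` and each of at most four events `R i` costs `6ε`, whence `26`.
  have h2 := prob_exists_le_card I R hR
  have hI4' : (#I : ℝ) ≤ 4 := by exact_mod_cast hI4
  have h3 : (#I : ℝ) * (6 * ε) ≤ 4 * (6 * ε) :=
    mul_le_mul_of_nonneg_right hI4' (mul_nonneg (by norm_num) prob_nonneg)
  linarith

end Join

/-! ### Chains and intervals of subspaces -/

section LinearAlgebra

variable {F V : Type*} [Field F] [AddCommGroup V] [Module F V] [FiniteDimensional F V]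

open Module

/-- Two subspaces are joined by a saturated chain. -/
theorem exists_segment {X Y : Submodule F V} (h : X ≤ Y) :
    ∃ c : ℕ → Submodule F V, Monotone c ∧ (∀ i ≤ finrank F X, c i = X) ∧
      (∀ i, finrank F Y ≤ i → c i = Y) ∧
      ∀ i, finrank F X ≤ i → i ≤ finrank F Y → finrank F (c i) = i := by
  obtain ⟨d, hd⟩ := Nat.exists_eq_add_of_le (Submodule.finrank_mono h)
  induction d generalizing X with
  | zero =>
    have e : X = Y := Submodule.eq_of_le_of_finrank_eq h (by omega)
    subst e
    exact ⟨fun _ => X, monotone_const, fun _ _ => rfl, fun _ _ => rfl, fun i h1 h2 =>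
      le_antisymm h1 h2⟩
  | succ d ih =>
    have hlt : X < Y := lt_of_le_of_ne h fun e => by subst e; omega
    obtain ⟨v, hvY, hvX⟩ := SetLike.exists_of_lt hlt
    have hr := Submodule.finrank_sup_span_singleton hvX
    have hle : X ⊔ F ∙ v ≤ Y := sup_le h ((Submodule.span_singleton_le_iff_mem _ _).2 hvY)
    obtain ⟨c, hc1, hc2, hc3, hc4⟩ := ih hle (by omega)
    refine ⟨fun i => if i ≤ finrank F X then X else c i, ?_, ?_, ?_, ?_⟩
    · intro i j hij
      dsimp only
      split_ifs with h1 h2 h2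
      · exact le_rfl
      · calc X ≤ X ⊔ F ∙ v := le_sup_left
          _ = c (finrank F X + 1) := (hc2 _ hr.ge).symm
          _ ≤ c j := hc1 (by omega)
      · omega
      · exact hc1 hij
    · intro i hi
      exact if_pos hi
    · intro i hi
      have : ¬i ≤ finrank F X := by omega
      simp only [this, if_false]
      exact hc3 i hi
    · intro i h1 h2
      by_cases hi : i ≤ finrank F X
      · change finrank F (if i ≤ finrank F X then X else c i : Submodule F V) = i
        rw [if_pos hi]
        omega
      · change finrank F (if i ≤ finrank F X then X else c i : Submodule F V) = i
        rw [if_neg hi]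
        exact hc4 i (by omega) h2

/-- For `a`, `b` independent modulo `Y`, the subspaces spanned by `Y` and `b + t • a` are distinct:
if two coincided, they would contain both `a` and `b`, which is one dimension too many. -/
theorem le_card_between [Fintype F] {Y Z : Submodule F V} (h : Y ≤ Z)
    (hr : finrank F Z = finrank F Y + 2) {S : Finset (Submodule F V)}
    (hS : ∀ W, Y ≤ W → W ≤ Z → finrank F W = finrank F Y + 1 → W ∈ S) :
    Fintype.card F ≤ #S := by
  obtain ⟨a, haZ, haY⟩ := SetLike.exists_of_lt (lt_of_le_of_ne h fun e => by subst e; omega)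
  have hra := Submodule.finrank_sup_span_singleton haY
  have hle : Y ⊔ F ∙ a ≤ Z := sup_le h ((Submodule.span_singleton_le_iff_mem _ _).2 haZ)
  obtain ⟨b, hbZ, hbY⟩ := SetLike.exists_of_lt (lt_of_le_of_ne hle fun e => by rw [e] at hra; omega)
  have hb : ∀ t : F, b + t • a ∉ Y := by
    intro t ht
    apply hbY
    have h1 : t • a ∈ Y ⊔ F ∙ a :=
      Submodule.mem_sup_right (Submodule.smul_mem _ _ (Submodule.mem_span_singleton_self a))
    have h2 : b + t • a ∈ Y ⊔ F ∙ a := Submodule.mem_sup_left ht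
    simpa using Submodule.sub_mem _ h2 h1
  have hmem : ∀ t : F, b + t • a ∈ Y ⊔ F ∙ (b + t • a) := fun t =>
    Submodule.mem_sup_right (Submodule.mem_span_singleton_self _)
  refine Finset.card_le_card_of_injOn (s := Finset.univ) (fun t : F => Y ⊔ F ∙ (b + t • a)) ?_ ?_
  · intro t _
    refine hS _ le_sup_left (sup_le h ((Submodule.span_singleton_le_iff_mem _ _).2 ?_))
      (Submodule.finrank_sup_span_singleton (hb t))
    exact Submodule.add_mem _ hbZ (Submodule.smul_mem _ _ haZ)
  · intro s _ t _ e
    by_contra hne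
    have e : Y ⊔ F ∙ (b + s • a) = Y ⊔ F ∙ (b + t • a) := e
    have h1 : b + s • a ∈ Y ⊔ F ∙ (b + s • a) := hmem s
    have h2 : b + t • a ∈ Y ⊔ F ∙ (b + s • a) := e ▸ hmem t
    have h3 : (s - t) • a ∈ Y ⊔ F ∙ (b + s • a) := by
      have := Submodule.sub_mem _ h1 h2
      rwa [add_sub_add_left_eq_sub, ← sub_smul] at this
    have h4 : a ∈ Y ⊔ F ∙ (b + s • a) := by
      have := Submodule.smul_mem _ (s - t)⁻¹ h3
      rwa [smul_smul, inv_mul_cancel₀ (sub_ne_zero.2 hne), one_smul] at this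
    have h5 : b ∈ Y ⊔ F ∙ (b + s • a) := by
      have := Submodule.sub_mem _ h1 (Submodule.smul_mem _ s h4)
      simpa using this
    have h6 : (Y ⊔ F ∙ a) ⊔ F ∙ b ≤ Y ⊔ F ∙ (b + s • a) :=
      sup_le (sup_le le_sup_left ((Submodule.span_singleton_le_iff_mem _ _).2 h4))
        ((Submodule.span_singleton_le_iff_mem _ _).2 h5)
    have h7 := Submodule.finrank_mono h6
    rw [Submodule.finrank_sup_span_singleton hbY, hra, Submodule.finrank_sup_span_singleton (hb s)] at h7
    omega

end LinearAlgebra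

/-! ### Complete flags and the action of the general linear group -/

section FullFlags

open Module

variable {F : Type u} [Field F] {n : ℕ}

/-- A complete flag of subspaces of `F ^ n`, indexed by the dimension. -/
def IsFullFlag (ω : ℕ → Submodule F (Fin n → F)) : Prop :=
  Monotone ω ∧ ∀ i, finrank F (ω i) = min i n

theorem IsFullFlag.finrank_eq {ω : ℕ → Submodule F (Fin n → F)} (h : IsFullFlag ω) {i : ℕ}
    (hi : i ≤ n) : finrank F (ω i) = i := by
  rw [h.2, min_eq_left hi]

theorem IsFullFlag.eq_top {ω : ℕ → Submodule F (Fin n → F)} (h : IsFullFlag ω) {i : ℕ}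
    (hi : n ≤ i) : ω i = ⊤ := by
  apply Submodule.eq_top_of_finrank_eq
  rw [h.2, min_eq_right hi, finrank_fin_fun]

theorem IsFullFlag.eq_bot {ω : ℕ → Submodule F (Fin n → F)} (h : IsFullFlag ω) : ω 0 = ⊥ := by
  rw [← Submodule.finrank_eq_zero (R := F), h.2, Nat.zero_min]

theorem monotone_splice {α : Type*} [Preorder α] {ω ω' : ℕ → α} {k : ℕ} (h : Monotone ω)
    (h' : Monotone ω') (hk : ω k ≤ ω' k) : Monotone (splice k ω ω') := by
  intro i j hij
  rcases le_or_gt j k with hj | hj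
  · rw [splice_of_le hj, splice_of_le (hij.trans hj)]
    exact h hij
  · rw [splice_of_lt hj]
    rcases le_or_gt i k with hi | hi
    · rw [splice_of_le hi]
      exact (h hi).trans (hk.trans (h' hj.le))
    · rw [splice_of_lt hi]
      exact h' hij

theorem IsFullFlag.splice {ω ω' : ℕ → Submodule F (Fin n → F)} {k : ℕ} (h : IsFullFlag ω)
    (h' : IsFullFlag ω') (hk : ω k = ω' k) : IsFullFlag (splice k ω ω') := by
  refine ⟨monotone_splice h.1 h'.1 hk.le, fun i => ?_⟩
  rcases le_or_gt i k with hi | hi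
  · rw [splice_of_le hi, h.2]
  · rw [splice_of_lt hi, h'.2]

/-- A flag can be changed between two of its members so that it passes through a given
subspace. -/
theorem IsFullFlag.exists_through {ω : ℕ → Submodule F (Fin n → F)} (h : IsFullFlag ω)
    {l k m : ℕ} (hlk : l ≤ k) (hkm : k ≤ m) (hm : m ≤ n) {W : Submodule F (Fin n → F)}
    (h1 : ω l ≤ W) (h2 : W ≤ ω m) (hW : finrank F W = k) :
    ∃ ω', IsFullFlag ω' ∧ (∀ i ≤ l, ω' i = ω i) ∧ (∀ i, m ≤ i → ω' i = ω i) ∧ ω' k = W := by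
  obtain ⟨c, hc1, hc2, hc3, hc4⟩ := exists_segment h1
  obtain ⟨d, hd1, hd2, hd3, hd4⟩ := exists_segment h2
  have hl := h.finrank_eq ((hlk.trans hkm).trans hm)
  have hm' := h.finrank_eq hm
  rw [hl, hW] at hc4
  rw [hW, hm'] at hd4
  rw [hl] at hc2
  rw [hW] at hc3 hd2
  rw [hm'] at hd3
  set e := FlagFamily.splice m d ω
  set e' := FlagFamily.splice k c e
  have e1 : ∀ i ≤ m, e i = d i := fun i hi => splice_of_le hi _ _
  have e2 : ∀ i, m < i → e i = ω i := fun i hi => splice_of_lt hi _ _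
  have e3 : ∀ i ≤ k, e' i = c i := fun i hi => splice_of_le hi _ _
  have e4 : ∀ i, k < i → e' i = e i := fun i hi => splice_of_lt hi _ _
  have he : Monotone e := monotone_splice hd1 h.1 (hd3 m le_rfl).le
  have hek : e k = W := (splice_of_le hkm _ _).trans (hd2 k le_rfl)
  have he' : Monotone e' := monotone_splice hc1 he ((hc3 k le_rfl).trans hek.symm).le
  have hel : e' l = ω l := (splice_of_le hlk _ _).trans (hc2 l le_rfl)
  refine ⟨FlagFamily.splice l ω e', ⟨monotone_splice h.1 he' hel.ge, fun i => ?_⟩, ?_, ?_, ?_⟩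
  · rcases le_or_gt i l with hi | hi
    · rw [splice_of_le hi, h.2]
    · rw [splice_of_lt hi]
      rcases le_or_gt i k with hik | hik
      · rw [e3 i hik, hc4 i hi.le hik]
        omega
      · rw [e4 i hik]
        rcases le_or_gt i m with him | him
        · rw [e1 i him, hd4 i hik.le him]
          omega
        · rw [e2 i him, h.2]
  · intro i hi
    exact splice_of_le hi _ _
  · intro i hi
    rcases le_or_gt i l with hi' | hi'
    · exact splice_of_le hi' _ _
    · rw [splice_of_lt hi']
      rcases le_or_gt i k with hik | hik
      · have f1 : i = k := by omega
        have f2 : i = m := by omega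
        rw [e3 i hik, hc3 i f1.ge, ← hd2 i f1.le, hd3 i f2.ge, f2]
      · rw [e4 i hik]
        rcases le_or_gt i m with him | him
        · have f2 : i = m := by omega
          rw [e1 i him, hd3 i f2.ge, f2]
        · exact e2 i him
  · rcases le_or_gt k l with hi' | hi'
    · rw [splice_of_le hi']
      have : k = l := by omega
      subst this
      exact Submodule.eq_of_le_of_finrank_eq h1 (hl.trans hW.symm)
    · rw [splice_of_lt hi', e3 k le_rfl, hc3 k le_rfl]

theorem IsFullFlag.exists_basis {ω : ℕ → Submodule F (Fin n → F)} (h : IsFullFlag ω) :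
    ∃ b : Basis (Fin n) F (Fin n → F), ∀ i,
      ω i = Submodule.span F (b '' {j | (j : ℕ) < i}) := by
  have hex : ∀ j : Fin n, ∃ v, v ∈ ω (j + 1) ∧ v ∉ ω j := by
    intro j
    refine SetLike.exists_of_lt (lt_of_le_of_ne (h.1 (Nat.le_succ _)) fun e => ?_)
    have h1 := h.finrank_eq j.2.le
    have h2 := h.finrank_eq (i := j + 1) j.2
    rw [e] at h1
    omega
  choose v hv1 hv2 using hex
  have hspan : ∀ i ≤ n, Submodule.span F (v '' {j | (j : ℕ) < i}) = ω i := by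
    intro i
    induction i with
    | zero =>
      intro _
      simp [h.eq_bot]
    | succ i ih =>
      intro hi
      have e : {j : Fin n | (j : ℕ) < i + 1} = {j : Fin n | (j : ℕ) < i} ∪ {⟨i, hi⟩} := by
        ext j
        simp only [Set.mem_ofPred_eq, Set.mem_union, Set.mem_singleton_iff, Fin.ext_iff]
        omega
      rw [e, Set.image_union, Submodule.span_union, ih (by omega), Set.image_singleton]
      have h1 := Submodule.finrank_sup_span_singleton (hv2 ⟨i, hi⟩)
      refine Submodule.eq_of_le_of_finrank_eq
        (sup_le (h.1 (Nat.le_succ _)) ((Submodule.span_singleton_le_iff_mem _ _).2 (hv1 ⟨i, hi⟩)))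
        ?_
      rw [h1, h.finrank_eq hi, h.finrank_eq (by simp; omega)]
  have htop : ⊤ ≤ Submodule.span F (Set.range v) := by
    have h1 := hspan n le_rfl
    rw [h.eq_top le_rfl] at h1
    rw [← h1]
    exact Submodule.span_mono (Set.image_subset_range _ _)
  refine ⟨basisOfTopLeSpanOfCardEqFinrank v htop (by simp), fun i => ?_⟩
  rw [coe_basisOfTopLeSpanOfCardEqFinrank]
  rcases le_or_gt i n with hi | hi
  · exact (hspan i hi).symm
  · rw [h.eq_top hi.le, ← h.eq_top le_rfl, ← hspan n le_rfl]
    congr 2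
    ext j
    simp only [Set.mem_ofPred_eq]
    have := j.2
    omega

/-- The action of the general linear group on sequences of subspaces. -/
def act (g : (Fin n → F) ≃ₗ[F] (Fin n → F)) (ω : ℕ → Submodule F (Fin n → F)) :
    ℕ → Submodule F (Fin n → F) := fun i => (ω i).map (g : (Fin n → F) →ₗ[F] (Fin n → F))

theorem map_map_symm (g : (Fin n → F) ≃ₗ[F] (Fin n → F)) (W : Submodule F (Fin n → F)) :
    (W.map (g.symm : (Fin n → F) →ₗ[F] (Fin n → F))).map
      (g : (Fin n → F) →ₗ[F] (Fin n → F)) = W := by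
  rw [← Submodule.map_comp]
  simp

theorem map_symm_map (g : (Fin n → F) ≃ₗ[F] (Fin n → F)) (W : Submodule F (Fin n → F)) :
    (W.map (g : (Fin n → F) →ₗ[F] (Fin n → F))).map
      (g.symm : (Fin n → F) →ₗ[F] (Fin n → F)) = W := by
  rw [← Submodule.map_comp]
  simp

theorem IsFullFlag.act {ω : ℕ → Submodule F (Fin n → F)} (h : IsFullFlag ω)
    (g : (Fin n → F) ≃ₗ[F] (Fin n → F)) : IsFullFlag (act g ω) :=
  ⟨fun _ _ hij => Submodule.map_mono (h.1 hij), fun i =>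
    (LinearEquiv.finrank_map_eq g (ω i)).trans (h.2 i)⟩

/-- Send a basis adapted to one flag to a basis adapted to the other. This transitivity is behind
all the uniform counts below. -/
theorem IsFullFlag.exists_act_eq {ω ω' : ℕ → Submodule F (Fin n → F)} (h : IsFullFlag ω)
    (h' : IsFullFlag ω') : ∃ g, FlagFamily.act g ω = ω' := by
  obtain ⟨b, hb⟩ := h.exists_basis
  obtain ⟨b', hb'⟩ := h'.exists_basis
  refine ⟨b.equiv b' (Equiv.refl _), ?_⟩
  ext1 i
  rw [FlagFamily.act, hb, hb', Submodule.map_span, ← Set.image_comp]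
  congr 2
  ext j
  simp

theorem act_symm_act (g : (Fin n → F) ≃ₗ[F] (Fin n → F)) (ω : ℕ → Submodule F (Fin n → F)) :
    act g.symm (act g ω) = ω := funext fun i => map_symm_map g (ω i)

theorem act_act_symm (g : (Fin n → F) ≃ₗ[F] (Fin n → F)) (ω : ℕ → Submodule F (Fin n → F)) :
    act g (act g.symm ω) = ω := funext fun i => map_map_symm g (ω i)

theorem act_injective (g : (Fin n → F) ≃ₗ[F] (Fin n → F)) : Function.Injective (act g) :=
  Function.LeftInverse.injective (act_symm_act g)

theorem exists_isFullFlag : ∃ ω : ℕ → Submodule F (Fin n → F), IsFullFlag ω := by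
  obtain ⟨c, h1, h2, h3, h4⟩ := exists_segment (bot_le : (⊥ : Submodule F (Fin n → F)) ≤ ⊤)
  rw [finrank_top, finrank_fin_fun] at h3 h4
  refine ⟨c, h1, fun i => ?_⟩
  rcases le_total i n with hi | hi
  · rw [h4 i (by simp) hi, min_eq_left hi]
  · rw [h3 i hi, min_eq_right hi, finrank_top, finrank_fin_fun]

theorem finite_setOf_isFullFlag [Finite F] :
    {ω : ℕ → Submodule F (Fin n → F) | IsFullFlag ω}.Finite := by
  refine Set.Finite.of_injOn (f := fun ω (i : Fin n) => ω i) (t := Set.univ)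
    (fun _ _ => Set.mem_univ _) ?_ Set.finite_univ
  intro ω hω ω' hω' e
  ext1 i
  rcases lt_or_ge i n with hi | hi
  · exact congrFun e ⟨i, hi⟩
  · rw [IsFullFlag.eq_top hω hi, IsFullFlag.eq_top hω' hi]

theorem map_injective (g : (Fin n → F) ≃ₗ[F] (Fin n → F)) :
    Function.Injective fun W : Submodule F (Fin n → F) =>
      W.map (g : (Fin n → F) →ₗ[F] (Fin n → F)) :=
  Submodule.map_injective_of_injective g.injective

theorem finrank_inf_le {j : ℕ} {W W' : Submodule F (Fin n → F)} (hW : finrank F W = j + 1)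
    (hW' : finrank F W' = j + 1) (hne : W ≠ W') :
    finrank F (W ⊓ W' : Submodule F (Fin n → F)) ≤ j := by
  by_contra! hcon
  have h1 : W ⊓ W' = W := Submodule.eq_of_le_of_finrank_le inf_le_left (by omega)
  have h2 : W ⊓ W' = W' := Submodule.eq_of_le_of_finrank_le inf_le_right (by omega)
  exact hne (h1.symm.trans h2)

variable [Finite F]

/-- The complete flags that agree with `ω₀` in the dimensions in `T`. -/
def flagsThrough (T : Set ℕ) (ω₀ : ℕ → Submodule F (Fin n → F)) :
    Finset (ℕ → Submodule F (Fin n → F)) :=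
  (finite_setOf_isFullFlag.subset fun _ h => h.1 :
    {ω : ℕ → Submodule F (Fin n → F) | IsFullFlag ω ∧ ∀ t ∈ T, ω t = ω₀ t}.Finite).toFinset

theorem mem_flagsThrough {T : Set ℕ} {ω₀ ω : ℕ → Submodule F (Fin n → F)} :
    ω ∈ flagsThrough T ω₀ ↔ IsFullFlag ω ∧ ∀ t ∈ T, ω t = ω₀ t := by
  simp [flagsThrough]

/-- Links of such families are again such families, so inductions may vary `T` and the base flag
instead of handling iterated links. -/
theorem link_flagsThrough {T : Set ℕ} {ω₀ ω : ℕ → Submodule F (Fin n → F)}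
    (hω : ω ∈ flagsThrough T ω₀) (k : ℕ) :
    link (flagsThrough T ω₀) k (ω k) = flagsThrough (insert k T) ω := by
  ext ω'
  simp only [mem_link, mem_flagsThrough, Set.mem_insert_iff, forall_eq_or_imp] at hω ⊢
  constructor
  · rintro ⟨⟨h1, h2⟩, h3⟩
    exact ⟨h1, h3, fun t ht => (h2 t ht).trans (hω.2 t ht).symm⟩
  · rintro ⟨h1, h2, h3⟩
    exact ⟨⟨h1, fun t ht => (h3 t ht).trans (hω.2 t ht)⟩, h2⟩

theorem flagsThrough_nonempty {T : Set ℕ} {ω₀ : ℕ → Submodule F (Fin n → F)}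
    (h : IsFullFlag ω₀) : (flagsThrough T ω₀).Nonempty :=
  ⟨ω₀, mem_flagsThrough.2 ⟨h, fun _ _ => rfl⟩⟩

theorem splice_mem_flagsThrough {T : Set ℕ} {ω₀ ω ω' : ℕ → Submodule F (Fin n → F)} {k : ℕ}
    (hk : k ∈ T) (hω : ω ∈ flagsThrough T ω₀) (hω' : ω' ∈ flagsThrough T ω₀) :
    splice k ω ω' ∈ flagsThrough T ω₀ := by
  rw [mem_flagsThrough] at *
  refine ⟨hω.1.splice hω'.1 ((hω.2 k hk).trans (hω'.2 k hk).symm), fun t ht => ?_⟩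
  rcases le_or_gt t k with h | h
  · rw [splice_of_le h, hω.2 t ht]
  · rw [splice_of_lt h, hω'.2 t ht]

theorem act_mem_flagsThrough {T : Set ℕ} {ω₀ ω : ℕ → Submodule F (Fin n → F)}
    {g : (Fin n → F) ≃ₗ[F] (Fin n → F)} (hg : ∀ t ∈ T, act g ω₀ t = ω₀ t) :
    act g ω ∈ flagsThrough T ω₀ ↔ ω ∈ flagsThrough T ω₀ := by
  rw [mem_flagsThrough, mem_flagsThrough]
  constructor
  · rintro ⟨h1, h2⟩
    refine ⟨act_symm_act g ω ▸ h1.act g.symm, fun t ht => ?_⟩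
    have := (h2 t ht).trans (hg t ht).symm
    exact Submodule.map_injective_of_injective g.injective this
  · rintro ⟨h1, h2⟩
    refine ⟨h1.act g, fun t ht => ?_⟩
    rw [← hg t ht, act, act, h2 t ht]

end FullFlags

/-! ### Variance contraction for incidence relations -/

section Incidence

variable {S R : Type*}

open scoped Classical in
/-- The elements of `X` incident with `b`. -/
def left (X : Finset S) (inc : S → R → Prop) (b : R) : Finset S := X.filter fun x => inc x b

theorem mem_left {X : Finset S} {inc : S → R → Prop} {b : R} {x : S} :
    x ∈ left X inc b ↔ x ∈ X ∧ inc x b := by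
  simp [left]

/-- All elements of `B` are incident with `k` elements of `X`, and all elements of `X` with `r`
elements of `B`. -/
structure Biregular (X : Finset S) (B : Finset R) (inc : S → R → Prop) (k r : ℕ) : Prop where
  card_left : ∀ b ∈ B, #(left X inc b) = k
  card_right : ∀ x ∈ X, #(left B (fun b x => inc x b) x) = r

variable {X : Finset S} {B : Finset R} {inc : S → R → Prop} {k r : ℕ}

theorem Biregular.symm (h : Biregular X B inc k r) : Biregular B X (fun b x => inc x b) r k :=
  ⟨h.card_right, h.card_left⟩

theorem sum_left (f : S → ℝ) (b : R) [∀ x b, Decidable (inc x b)] :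
    ∑ x ∈ left X inc b, f x = ∑ x ∈ X, if inc x b then f x else 0 := by
  rw [← sum_filter]
  congr 1
  ext x
  simp [mem_left]

theorem Biregular.mul_eq (h : Biregular X B inc k r) : (#B : ℝ) * k = #X * r := by
  classical
  have h1 : ∑ b ∈ B, ∑ x ∈ left X inc b, (1 : ℝ) =
      ∑ x ∈ X, ∑ b ∈ left B (fun b x => inc x b) x, (1 : ℝ) := by
    simp_rw [sum_left]
    exact sum_comm
  simp only [sum_const, nsmul_eq_mul, mul_one] at h1
  rw [sum_congr rfl fun b hb => congrArg Nat.cast (h.card_left b hb),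
    sum_congr rfl fun x hx => congrArg Nat.cast (h.card_right x hx)] at h1
  simpa using h1

theorem Biregular.avg_avg (h : Biregular X B inc k r) (φ : S → R → ℝ) :
    avg B (fun b => avg (left X inc b) fun x => φ x b) =
      avg X fun x => avg (left B (fun b x => inc x b) x) fun b => φ x b := by
  classical
  have h1 : avg B (fun b => avg (left X inc b) fun x => φ x b) =
      (∑ b ∈ B, ∑ x ∈ X, if inc x b then φ x b else 0) / (#B * k) := by
    unfold avg
    rw [mul_comm (#B : ℝ), ← div_div]
    congr 1
    rw [sum_div]
    refine (sum_congr rfl fun b hb => ?_)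
    dsimp only
    rw [h.card_left b hb, sum_left]
  have h2 : avg X (fun x => avg (left B (fun b x => inc x b) x) fun b => φ x b) =
      (∑ x ∈ X, ∑ b ∈ B, if inc x b then φ x b else 0) / (#X * r) := by
    unfold avg
    rw [mul_comm (#X : ℝ), ← div_div]
    congr 1
    rw [sum_div]
    refine (sum_congr rfl fun x hx => ?_)
    dsimp only
    rw [h.card_right x hx, sum_left]
  rw [h1, h2, sum_comm, h.mul_eq]

/-- Averaging along the incidence relation contracts the variance by the factor `τ`. -/
def Contracts (X : Finset S) (B : Finset R) (inc : S → R → Prop) (τ : ℝ) : Prop :=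
  ∀ f : S → ℝ, avg X f = 0 →
    avg B (fun b => avg (left X inc b) f ^ 2) ≤ τ * avg X fun x => f x ^ 2

/-- Averaging in the two directions gives adjoint operators, which have equal norms; biregularity is
what makes them adjoint for the uniform measures. -/
theorem Contracts.symm {τ : ℝ} (hτ : 0 ≤ τ) (h : Contracts X B inc τ)
    (hb : Biregular X B inc k r) (hk : 0 < k) : Contracts B X (fun b x => inc x b) τ := by
  intro f hf
  set a : S → ℝ := fun x => avg (left B (fun b x => inc x b) x) f
  have ha : avg X a = 0 := by
    rw [← hf, ← hb.avg_avg fun _ b => f b]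
    refine avg_congr fun b hbB => avg_const ?_ _
    rw [← card_pos, hb.card_left b hbB]
    exact hk
  set H := avg B fun b => f b ^ 2
  set P := avg X fun x => a x ^ 2
  have hH : 0 ≤ H := avg_nonneg fun _ _ => sq_nonneg _
  have hP : 0 ≤ P := avg_nonneg fun _ _ => sq_nonneg _
  have h1 : P ≤ √H * √(τ * P) := by
    calc P = avg X (fun x => avg (left B (fun b x => inc x b) x) fun b => a x * f b) :=
          avg_congr fun x _ => by rw [avg_mul_left, sq]
      _ = avg B (fun b => avg (left X inc b) fun x => a x * f b) := (hb.avg_avg _).symm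
      _ = avg B (fun b => f b * avg (left X inc b) a) :=
          avg_congr fun b _ => by rw [← avg_mul_left]; simp_rw [mul_comm]
      _ ≤ √H * √(avg B fun b => avg (left X inc b) a ^ 2) := avg_mul_le_sqrt
      _ ≤ √H * √(τ * P) := by
          gcongr
          exact h a ha
  have h2 : P ^ 2 ≤ H * (τ * P) := by
    calc P ^ 2 ≤ (√H * √(τ * P)) ^ 2 := by gcongr
      _ = H * (τ * P) := by rw [mul_pow, Real.sq_sqrt hH, Real.sq_sqrt (mul_nonneg hτ hP)]
  change P ≤ τ * H
  rcases hP.eq_or_lt with h3 | h3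
  · rw [← h3]
    positivity
  · refine le_of_mul_le_mul_right ?_ h3
    nlinarith

open scoped Classical in
/-- Distinct elements are incident with one common block if they are adjacent, and with none
otherwise. -/
def IsBlockSystem (X : Finset S) (B : Finset R) (inc : S → R → Prop) (adj : S → S → Prop) : Prop :=
  ∀ x ∈ X, ∀ y ∈ X, x ≠ y → #(B.filter fun b => inc x b ∧ inc y b) = if adj x y then 1 else 0

theorem isBlockSystem_of_unique {adj : S → S → Prop}
    (h₁ : ∀ x ∈ X, ∀ y ∈ X, x ≠ y → adj x y →
      ∃ b ∈ B, (inc x b ∧ inc y b) ∧ ∀ b' ∈ B, inc x b' → inc y b' → b' = b)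
    (h₂ : ∀ x ∈ X, ∀ y ∈ X, x ≠ y → ∀ b ∈ B, inc x b → inc y b → adj x y) :
    IsBlockSystem X B inc adj := by
  classical
  intro x hx y hy hne
  split_ifs with hadj
  · obtain ⟨b, hb, hxy, hu⟩ := h₁ x hx y hy hne hadj
    refine card_eq_one.2 ⟨b, ?_⟩
    ext b'
    simp only [mem_filter, mem_singleton]
    constructor
    · rintro ⟨h1, h2, h3⟩
      exact hu b' h1 h2 h3
    · rintro rfl
      exact ⟨hb, hxy⟩
  · refine card_eq_zero.2 (filter_eq_empty_iff.2 ?_)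
    rintro b hb ⟨h1, h2⟩
    exact hadj (h₂ x hx y hy hne b hb h1 h2)

-- Expanding the square, the diagonal yields the lazy term `1 / k`. The rest is an average over
-- adjacent pairs, each lying in exactly one block, and so depends on the adjacency relation alone
-- and not on the blocks.
open scoped Classical in
theorem IsBlockSystem.avg_sq {adj : S → S → Prop} (h : IsBlockSystem X B inc adj)
    (hb : Biregular X B inc k r) (hk : 0 < k) (hX : X.Nonempty) (hB : B.Nonempty) (f : S → ℝ) :
    avg B (fun b => avg (left X inc b) f ^ 2) = (1 / k) * avg X (fun x => f x ^ 2) +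
      (1 - 1 / k) * avg ((X ×ˢ X).filter fun p => p.1 ≠ p.2 ∧ adj p.1 p.2)
        fun p => f p.1 * f p.2 := by
  set A := (X ×ˢ X).filter fun p => p.1 ≠ p.2 ∧ adj p.1 p.2
  have hX0 : (#X : ℝ) ≠ 0 := by exact_mod_cast hX.card_pos.ne'
  have hB0 : (#B : ℝ) ≠ 0 := by exact_mod_cast hB.card_pos.ne'
  have hk0 : (k : ℝ) ≠ 0 := by exact_mod_cast hk.ne'
  have key : ∀ f : S → ℝ, ∑ b ∈ B, (∑ x ∈ left X inc b, f x) ^ 2 =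
      r * ∑ x ∈ X, f x ^ 2 + ∑ p ∈ A, f p.1 * f p.2 := by
    intro f
    have e1 : ∀ b ∈ B, (∑ x ∈ left X inc b, f x) ^ 2 =
        ∑ p ∈ X ×ˢ X, if inc p.1 b ∧ inc p.2 b then f p.1 * f p.2 else 0 := by
      intro b _
      rw [sum_left, sq, sum_mul_sum, ← sum_product']
      refine sum_congr rfl fun p _ => ?_
      by_cases h1 : inc p.1 b <;> by_cases h2 : inc p.2 b <;> simp [h1, h2]
    rw [sum_congr rfl e1, sum_comm]
    have e2 : ∀ p ∈ X ×ˢ X, (∑ b ∈ B, if inc p.1 b ∧ inc p.2 b then f p.1 * f p.2 else 0) =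
        (if p.1 = p.2 then r * (f p.1 * f p.2) else 0) +
          if p.1 ≠ p.2 ∧ adj p.1 p.2 then f p.1 * f p.2 else 0 := by
      intro p hp
      obtain ⟨hp1, hp2⟩ := mem_product.1 hp
      rw [← sum_filter, sum_const, nsmul_eq_mul]
      by_cases he : p.1 = p.2
      · have : #(B.filter fun b => inc p.1 b ∧ inc p.2 b) = r := by
          rw [← hb.card_right p.1 hp1]
          congr 1
          ext b
          simp [mem_left, he]
        rw [this, if_pos he, if_neg fun h => h.1 he, add_zero]
      · rw [h p.1 hp1 p.2 hp2 he]
        by_cases ha : adj p.1 p.2 <;> simp [he, ha]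
    rw [sum_congr rfl e2, sum_add_distrib, sum_filter]
    congr 1
    rw [sum_product, mul_sum]
    refine sum_congr rfl fun x hx => ?_
    rw [sum_ite_eq, if_pos hx, sq]
  have h1 := key fun _ => 1
  have hM : (#A : ℝ) = k * (k - 1) * #B := by
    have e : ∀ b ∈ B, (∑ x ∈ left X inc b, (1 : ℝ)) ^ 2 = k ^ 2 := by
      intro b hbB
      rw [sum_const, nsmul_eq_mul, hb.card_left b hbB, mul_one]
    rw [sum_congr rfl e] at h1
    simp only [sum_const, nsmul_eq_mul, one_pow, mul_one] at h1
    linarith [hb.mul_eq]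
  have h2 : avg B (fun b => avg (left X inc b) f ^ 2) =
      (r * ∑ x ∈ X, f x ^ 2 + ∑ p ∈ A, f p.1 * f p.2) / (#B * k ^ 2) := by
    unfold avg
    rw [← key, mul_comm (#B : ℝ), ← div_div]
    congr 1
    rw [sum_div]
    refine (sum_congr rfl fun b hbB => ?_)
    dsimp only
    rw [hb.card_left b hbB, div_pow]
  have h3 : r * (∑ x ∈ X, f x ^ 2) / (#B * k ^ 2) = (1 / k) * avg X (fun x => f x ^ 2) := by
    have := hb.mul_eq
    rw [avg]
    field_simp
    linear_combination (-∑ x ∈ X, f x ^ 2) * this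
  have h4 : (∑ p ∈ A, f p.1 * f p.2) / (#B * k ^ 2) =
      (1 - 1 / k) * avg A fun p => f p.1 * f p.2 := by
    rw [avg, hM]
    by_cases hk1 : (k : ℝ) - 1 = 0
    · have : #A = 0 := by
        have : (#A : ℝ) = 0 := by rw [hM, hk1]; ring
        exact_mod_cast this
      rw [card_eq_zero.1 this]
      simp
    · field_simp
  rw [h2, add_div, h3, h4]

/-- Both block systems share the off-diagonal average `N`. From the first, `k ≥ 2` gives `N ≤ 2τE`
with `E` the mean of `f ^ 2`; in the second, the lazy term is at most `E / q` because its blocks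
have at least `q` elements. -/
theorem Contracts.of_blocks {R' : Type*} {B' : Finset R'} {inc' : S → R' → Prop} {k' r' : ℕ}
    {adj : S → S → Prop} {τ q : ℝ} (hτ : 0 ≤ τ) (hq : 0 < q) (hX : X.Nonempty)
    (hB : B.Nonempty) (hB' : B'.Nonempty) (h : IsBlockSystem X B inc adj)
    (h' : IsBlockSystem X B' inc' adj) (hb : Biregular X B inc k r)
    (hb' : Biregular X B' inc' k' r') (hk : 2 ≤ k) (hk' : q ≤ k')
    (hc : Contracts X B inc τ) : Contracts X B' inc' (1 / q + 2 * τ) := by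
  classical
  intro f hf
  have hk'0 : (0 : ℝ) < k' := hq.trans_le hk'
  have h1 := h.avg_sq hb (by omega) hX hB f
  have h2 := h'.avg_sq hb' (by exact_mod_cast hk'0) hX hB' f
  have h3 := hc f hf
  rw [h1] at h3
  rw [h2]
  set E := avg X fun x => f x ^ 2
  set N := avg ((X ×ˢ X).filter fun p => p.1 ≠ p.2 ∧ adj p.1 p.2) fun p => f p.1 * f p.2
  have hE : 0 ≤ E := avg_nonneg fun _ _ => sq_nonneg _
  have hk2 : (2 : ℝ) ≤ k := by exact_mod_cast hk
  have e1 : (1 : ℝ) / k ≤ 1 / 2 := one_div_le_one_div_of_le (by norm_num) hk2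
  have e2 : (0 : ℝ) ≤ 1 / k := by positivity
  have e3 : (1 : ℝ) / k' ≤ 1 / q := one_div_le_one_div_of_le hq hk'
  have e4 : (0 : ℝ) ≤ 1 / k' := by positivity
  have e5 : (1 : ℝ) / k' ≤ 1 := by
    rw [div_le_one hk'0]
    have : 0 < k' := by exact_mod_cast hk'0
    exact_mod_cast this
  have e6 : 1 / (k' : ℝ) * E ≤ 1 / q * E := by gcongr
  have e7 : 0 ≤ 1 / (k : ℝ) * E := by positivity
  have e8 : 0 ≤ τ * E := by positivity
  have e9 : (1 - 1 / (k' : ℝ)) * N ≤ 2 * τ * E := by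
    rcases le_or_gt N 0 with hN | hN
    · have : (1 - 1 / (k' : ℝ)) * N ≤ 0 := mul_nonpos_of_nonneg_of_nonpos (by linarith) hN
      linarith
    · nlinarith
  linarith

/-- The hypothesis supplies injections in both directions between any two blocks. In the
applications they come from a group acting transitively on the blocks. -/
theorem exists_card_left_eq (h : ∀ b ∈ B, ∀ b' ∈ B, ∃ φ : S → S, Function.Injective φ ∧
    ∀ x ∈ X, inc x b → φ x ∈ X ∧ inc (φ x) b') : ∃ k, ∀ b ∈ B, #(left X inc b) = k := by
  rcases B.eq_empty_or_nonempty with rfl | ⟨b₀, hb₀⟩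
  · exact ⟨0, by simp⟩
  · have hle : ∀ b ∈ B, ∀ b' ∈ B, #(left X inc b) ≤ #(left X inc b') := by
      intro b hb b' hb'
      obtain ⟨φ, hφ, hm⟩ := h b hb b' hb'
      refine card_le_card_of_injOn φ (fun x hx => ?_) hφ.injOn
      obtain ⟨h1, h2⟩ := mem_left.1 hx
      exact mem_left.2 (hm x h1 h2)
    exact ⟨_, fun b hb => le_antisymm (hle b hb b₀ hb₀) (hle b₀ hb₀ b hb)⟩

theorem avg_comp_of_card_fiber {Ω : Finset S} {π : S → R} (hπ : ∀ ω ∈ Ω, π ω ∈ B)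
    (hk : 0 < k) (hc : ∀ b ∈ B, #(left Ω (fun ω b => π ω = b) b) = k) (φ : R → ℝ) :
    avg Ω (fun ω => φ (π ω)) = avg B φ := by
  classical
  have h1 : ∀ φ : R → ℝ, ∑ ω ∈ Ω, φ (π ω) = k * ∑ b ∈ B, φ b := by
    intro φ
    rw [← sum_fiberwise_of_maps_to hπ, mul_sum]
    refine sum_congr rfl fun b hb => ?_
    have : Ω.filter (fun ω => π ω = b) = left Ω (fun ω b => π ω = b) b := by
      ext ω
      simp [mem_left]
    rw [this, sum_congr rfl fun ω hω => congrArg φ (mem_left.1 hω).2, sum_const, hc b hb,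
      nsmul_eq_mul]
  have h2 := h1 fun _ => 1
  simp only [sum_const, nsmul_eq_mul, mul_one] at h2
  have hk0 : (k : ℝ) ≠ 0 := by exact_mod_cast hk.ne'
  rw [avg, avg, h1, h2, mul_div_mul_left _ _ hk0]

end Incidence

/-! ### Contraction in intervals of the subspace lattice -/

section Grassmannian

open Module

variable {F : Type u} [Field F] [Finite F] {n : ℕ}

/-- The subspaces of dimension `k` between two members of a flag. -/
def grass (ω₀ : ℕ → Submodule F (Fin n → F)) (l m k : ℕ) : Finset (Submodule F (Fin n → F)) :=
  (Set.toFinite {W | ω₀ l ≤ W ∧ W ≤ ω₀ m ∧ finrank F W = k}).toFinset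

variable {ω₀ : ℕ → Submodule F (Fin n → F)} {T : Set ℕ} {l m : ℕ}

theorem mem_grass {k : ℕ} {W : Submodule F (Fin n → F)} :
    W ∈ grass ω₀ l m k ↔ ω₀ l ≤ W ∧ W ≤ ω₀ m ∧ finrank F W = k := by
  simp [grass]

open scoped Classical in
/-- The pairs of nested subspaces of dimensions `j` and `j + 2` between two members of a flag. -/
def grassPairs (ω₀ : ℕ → Submodule F (Fin n → F)) (l m j : ℕ) :
    Finset (Submodule F (Fin n → F) × Submodule F (Fin n → F)) :=
  (grass ω₀ l m j ×ˢ grass ω₀ l m (j + 2)).filter fun p => p.1 ≤ p.2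

theorem mem_grassPairs {j : ℕ} {p : Submodule F (Fin n → F) × Submodule F (Fin n → F)} :
    p ∈ grassPairs ω₀ l m j ↔
      (p.1 ∈ grass ω₀ l m j ∧ p.2 ∈ grass ω₀ l m (j + 2)) ∧ p.1 ≤ p.2 := by
  simp [grassPairs]

theorem apply_mem_grass (hl : l ∈ T) (hm : m ∈ T) (hmn : m ≤ n)
    {ω : ℕ → Submodule F (Fin n → F)} (hω : ω ∈ flagsThrough T ω₀) {k : ℕ} (hlk : l ≤ k)
    (hkm : k ≤ m) : ω k ∈ grass ω₀ l m k := by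
  obtain ⟨h1, h2⟩ := mem_flagsThrough.1 hω
  refine mem_grass.2 ⟨?_, ?_, h1.finrank_eq (hkm.trans hmn)⟩
  · rw [← h2 l hl]
    exact h1.1 hlk
  · rw [← h2 m hm]
    exact h1.1 hkm

theorem exists_flag_of_le (h : IsFullFlag ω₀) (hT : ∀ t ∈ T, t ≤ l ∨ m ≤ t) (hmn : m ≤ n)
    {j k : ℕ} (hlj : l ≤ j) (hjk : j ≤ k) (hkm : k ≤ m) {Y Z : Submodule F (Fin n → F)}
    (hY : Y ∈ grass ω₀ l m j) (hZ : Z ∈ grass ω₀ l m k) (hYZ : Y ≤ Z) :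
    ∃ ω ∈ flagsThrough T ω₀, ω j = Y ∧ ω k = Z := by
  obtain ⟨hY1, hY2, hY3⟩ := mem_grass.1 hY
  obtain ⟨hZ1, hZ2, hZ3⟩ := mem_grass.1 hZ
  obtain ⟨ω, h1, h2, h3, h4⟩ := h.exists_through hlj (hjk.trans hkm) hmn hY1 hY2 hY3
  obtain ⟨ω', h1', h2', h3', h4'⟩ := h1.exists_through hjk hkm hmn (h4.trans_le hYZ)
    (by rwa [h3 m le_rfl]) hZ3
  refine ⟨ω', mem_flagsThrough.2 ⟨h1', fun t ht => ?_⟩, (h2' j le_rfl).trans h4, h4'⟩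
  rcases hT t ht with htl | htm
  · rw [h2' t (htl.trans hlj), h2 t htl]
  · rw [h3' t htm, h3 t htm]

theorem exists_flag_of_mem_grass (h : IsFullFlag ω₀) (hT : ∀ t ∈ T, t ≤ l ∨ m ≤ t) (hmn : m ≤ n)
    {j : ℕ} (hlj : l ≤ j) (hjm : j ≤ m) {Y : Submodule F (Fin n → F)}
    (hY : Y ∈ grass ω₀ l m j) : ∃ ω ∈ flagsThrough T ω₀, ω j = Y := by
  obtain ⟨ω, h1, h2, -⟩ := exists_flag_of_le h hT hmn hlj le_rfl hjm hY hY le_rfl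
  exact ⟨ω, h1, h2⟩

theorem exists_act_eq_of_mem {ω ω' : ℕ → Submodule F (Fin n → F)} (hω : ω ∈ flagsThrough T ω₀)
    (hω' : ω' ∈ flagsThrough T ω₀) : ∃ g, act g ω = ω' ∧ ∀ t ∈ T, act g ω₀ t = ω₀ t := by
  obtain ⟨h1, h2⟩ := mem_flagsThrough.1 hω
  obtain ⟨h1', h2'⟩ := mem_flagsThrough.1 hω'
  obtain ⟨g, rfl⟩ := h1.exists_act_eq h1'
  refine ⟨g, rfl, fun t ht => ?_⟩
  rw [← h2' t ht, act, act, h2 t ht]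

theorem map_mem_grass {g : (Fin n → F) ≃ₗ[F] (Fin n → F)} (hl : act g ω₀ l = ω₀ l)
    (hm : act g ω₀ m = ω₀ m) {k : ℕ} {W : Submodule F (Fin n → F)} (hW : W ∈ grass ω₀ l m k) :
    W.map (g : (Fin n → F) →ₗ[F] (Fin n → F)) ∈ grass ω₀ l m k := by
  obtain ⟨h1, h2, h3⟩ := mem_grass.1 hW
  refine mem_grass.2 ⟨?_, ?_, (LinearEquiv.finrank_map_eq g W).trans h3⟩
  · rw [← hl]
    exact Submodule.map_mono h1
  · rw [← hm]
    exact Submodule.map_mono h2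

theorem biregular_grass (h : IsFullFlag ω₀) (hmn : m ≤ n) {j k : ℕ} (hlj : l ≤ j) (hjk : j ≤ k)
    (hkm : k ≤ m) : ∃ a b, Biregular (grass ω₀ l m j) (grass ω₀ l m k) (· ≤ ·) a b := by
  have hT : ∀ t ∈ ({l, m} : Set ℕ), t ≤ l ∨ m ≤ t := by
    rintro t (rfl | rfl)
    · exact Or.inl le_rfl
    · exact Or.inr le_rfl
  have H : ∀ i, l ≤ i → i ≤ m → ∀ b ∈ grass ω₀ l m i, ∀ b' ∈ grass ω₀ l m i,
      ∃ g : (Fin n → F) ≃ₗ[F] (Fin n → F),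
        b.map (g : (Fin n → F) →ₗ[F] (Fin n → F)) = b' ∧ act g ω₀ l = ω₀ l ∧
          act g ω₀ m = ω₀ m := by
    intro i hli him b hb b' hb'
    obtain ⟨ω, hω, rfl⟩ := exists_flag_of_mem_grass h hT hmn hli him hb
    obtain ⟨ω', hω', rfl⟩ := exists_flag_of_mem_grass h hT hmn hli him hb'
    obtain ⟨g, h1, h2⟩ := exists_act_eq_of_mem hω hω'
    exact ⟨g, congrFun h1 i, h2 l (by simp), h2 m (by simp)⟩
  obtain ⟨a, ha⟩ := exists_card_left_eq (X := grass ω₀ l m j) (B := grass ω₀ l m k)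
    (inc := (· ≤ ·)) (by
      intro b hb b' hb'
      obtain ⟨g, rfl, h2, h3⟩ := H k (hlj.trans hjk) hkm b hb b' hb'
      exact ⟨_, map_injective g, fun x hx hxb =>
        ⟨map_mem_grass h2 h3 hx, Submodule.map_mono hxb⟩⟩)
  obtain ⟨c, hc⟩ := exists_card_left_eq (X := grass ω₀ l m k) (B := grass ω₀ l m j)
    (inc := fun b x => x ≤ b) (by
      intro b hb b' hb'
      obtain ⟨g, rfl, h2, h3⟩ := H j hlj (hjk.trans hkm) b hb b' hb'
      exact ⟨_, map_injective g, fun x hx hxb =>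
        ⟨map_mem_grass h2 h3 hx, Submodule.map_mono hxb⟩⟩)
  exact ⟨a, c, ha, hc⟩

/-- The incidence of a subspace with a pair of nested subspaces. -/
def Between (W : Submodule F (Fin n → F))
    (p : Submodule F (Fin n → F) × Submodule F (Fin n → F)) : Prop := p.1 ≤ W ∧ W ≤ p.2

theorem biregular_grassPairs (h : IsFullFlag ω₀) (hmn : m ≤ n) {j : ℕ} (hlj : l ≤ j)
    (hjm : j + 2 ≤ m) :
    ∃ a b, Biregular (grass ω₀ l m (j + 1)) (grassPairs ω₀ l m j) Between a b := by
  have hT : ∀ t ∈ ({l, m} : Set ℕ), t ≤ l ∨ m ≤ t := by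
    rintro t (rfl | rfl)
    · exact Or.inl le_rfl
    · exact Or.inr le_rfl
  obtain ⟨a, ha⟩ := exists_card_left_eq (X := grass ω₀ l m (j + 1)) (B := grassPairs ω₀ l m j)
    (inc := Between) (by
      rintro ⟨Y, Z⟩ hb ⟨Y', Z'⟩ hb'
      obtain ⟨⟨hY, hZ⟩, hYZ⟩ := mem_grassPairs.1 hb
      obtain ⟨⟨hY', hZ'⟩, hYZ'⟩ := mem_grassPairs.1 hb'
      obtain ⟨ω, hω, rfl, rfl⟩ := exists_flag_of_le h hT hmn hlj (by omega) hjm hY hZ hYZ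
      obtain ⟨ω', hω', rfl, rfl⟩ := exists_flag_of_le h hT hmn hlj (by omega) hjm hY' hZ' hYZ'
      obtain ⟨g, rfl, h2⟩ := exists_act_eq_of_mem hω hω'
      exact ⟨_, map_injective g, fun x hx hxb =>
        ⟨map_mem_grass (h2 l (by simp)) (h2 m (by simp)) hx,
          Submodule.map_mono hxb.1, Submodule.map_mono hxb.2⟩⟩)
  obtain ⟨c, hc⟩ := exists_card_left_eq (X := grassPairs ω₀ l m j) (B := grass ω₀ l m (j + 1))
    (inc := fun b x => Between x b) (by
      intro b hb b' hb'
      obtain ⟨ω, hω, rfl⟩ := exists_flag_of_mem_grass h hT hmn (by omega) (by omega) hb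
      obtain ⟨ω', hω', rfl⟩ := exists_flag_of_mem_grass h hT hmn (by omega) (by omega) hb'
      obtain ⟨g, rfl, h2⟩ := exists_act_eq_of_mem hω hω'
      refine ⟨fun p => (p.1.map (g : (Fin n → F) →ₗ[F] (Fin n → F)),
        p.2.map (g : (Fin n → F) →ₗ[F] (Fin n → F))), (map_injective g).prodMap (map_injective g),
        fun p hp hpb => ⟨mem_grassPairs.2 ?_, Submodule.map_mono hpb.1, Submodule.map_mono hpb.2⟩⟩
      obtain ⟨⟨h3, h4⟩, h5⟩ := mem_grassPairs.1 hp
      exact ⟨⟨map_mem_grass (h2 l (by simp)) (h2 m (by simp)) h3,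
        map_mem_grass (h2 l (by simp)) (h2 m (by simp)) h4⟩, Submodule.map_mono h5⟩)
  exact ⟨a, c, ha, hc⟩

/-- Two subspaces of the same dimension `j + 1` whose intersection has dimension `j`. -/
def Adjacent (j : ℕ) (W W' : Submodule F (Fin n → F)) : Prop :=
  finrank F (W ⊓ W' : Submodule F (Fin n → F)) = j

/-- Distinct `W`, `W'` of dimension `j + 1` have a common subspace of dimension `j` exactly when
they have a common superspace of dimension `j + 2`, and then these are `W ⊓ W'` and `W ⊔ W'`. So
blocks below, blocks above and pairs of both define the same adjacency. -/
theorem isBlockSystem_below (j : ℕ) :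
    IsBlockSystem (grass ω₀ l m (j + 1)) (grass ω₀ l m j) (fun W Y => Y ≤ W) (Adjacent j) := by
  refine isBlockSystem_of_unique ?_ ?_
  · intro W hW W' hW' hne hadj
    obtain ⟨h1, h2, h3⟩ := mem_grass.1 hW
    obtain ⟨h1', h2', h3'⟩ := mem_grass.1 hW'
    refine ⟨W ⊓ W', mem_grass.2 ⟨le_inf h1 h1', inf_le_left.trans h2, hadj⟩,
      ⟨inf_le_left, inf_le_right⟩, fun Y hY hY1 hY2 => ?_⟩
    exact Submodule.eq_of_le_of_finrank_le (le_inf hY1 hY2)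
      (hadj.trans (mem_grass.1 hY).2.2.symm).le
  · intro W hW W' hW' hne Y hY hY1 hY2
    have := Submodule.finrank_mono (le_inf hY1 hY2)
    rw [(mem_grass.1 hY).2.2] at this
    exact le_antisymm (finrank_inf_le (mem_grass.1 hW).2.2 (mem_grass.1 hW').2.2 hne) this

theorem isBlockSystem_above (j : ℕ) :
    IsBlockSystem (grass ω₀ l m (j + 1)) (grass ω₀ l m (j + 2)) (· ≤ ·) (Adjacent j) := by
  refine isBlockSystem_of_unique ?_ ?_
  · intro W hW W' hW' hne hadj
    obtain ⟨h1, h2, h3⟩ := mem_grass.1 hW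
    obtain ⟨h1', h2', h3'⟩ := mem_grass.1 hW'
    have hadj' : finrank F (W ⊓ W' : Submodule F (Fin n → F)) = j := hadj
    have hsum := Submodule.finrank_sup_add_finrank_inf_eq W W'
    refine ⟨W ⊔ W', mem_grass.2 ⟨h1.trans le_sup_left, sup_le h2 h2', by omega⟩,
      ⟨le_sup_left, le_sup_right⟩, fun Z hZ hZ1 hZ2 => ?_⟩
    have := (mem_grass.1 hZ).2.2
    exact (Submodule.eq_of_le_of_finrank_le (sup_le hZ1 hZ2) (by omega)).symm
  · intro W hW W' hW' hne Z hZ hZ1 hZ2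
    have h3 := (mem_grass.1 hW).2.2
    have h3' := (mem_grass.1 hW').2.2
    have hsum := Submodule.finrank_sup_add_finrank_inf_eq W W'
    have := Submodule.finrank_mono (sup_le hZ1 hZ2)
    rw [(mem_grass.1 hZ).2.2] at this
    exact le_antisymm (finrank_inf_le h3 h3' hne) (by omega)

theorem isBlockSystem_pairs (j : ℕ) :
    IsBlockSystem (grass ω₀ l m (j + 1)) (grassPairs ω₀ l m j) Between (Adjacent j) := by
  refine isBlockSystem_of_unique ?_ ?_
  · intro W hW W' hW' hne hadj
    obtain ⟨h1, h2, h3⟩ := mem_grass.1 hW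
    obtain ⟨h1', h2', h3'⟩ := mem_grass.1 hW'
    have hadj' : finrank F (W ⊓ W' : Submodule F (Fin n → F)) = j := hadj
    have hsum := Submodule.finrank_sup_add_finrank_inf_eq W W'
    refine ⟨(W ⊓ W', W ⊔ W'), mem_grassPairs.2 ⟨⟨mem_grass.2 ⟨le_inf h1 h1',
      inf_le_left.trans h2, hadj⟩, mem_grass.2 ⟨h1.trans le_sup_left, sup_le h2 h2',
      by dsimp only; omega⟩⟩, inf_le_left.trans le_sup_left⟩,
      ⟨⟨inf_le_left, le_sup_left⟩, inf_le_right, le_sup_right⟩, ?_⟩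
    rintro ⟨Y, Z⟩ hp ⟨hY1, hZ1⟩ ⟨hY2, hZ2⟩
    obtain ⟨⟨hY, hZ⟩, -⟩ := mem_grassPairs.1 hp
    have e1 := (mem_grass.1 hY).2.2
    have e2 := (mem_grass.1 hZ).2.2
    dsimp only at e1 e2 hY1 hY2 hZ1 hZ2
    have f1 : Y = W ⊓ W' := Submodule.eq_of_le_of_finrank_le (le_inf hY1 hY2) (by omega)
    have f2 : W ⊔ W' = Z := Submodule.eq_of_le_of_finrank_le (sup_le hZ1 hZ2) (by omega)
    exact Prod.ext f1 f2.symm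
  · intro W hW W' hW' hne p hp hp1 hp2
    obtain ⟨⟨hY, -⟩, -⟩ := mem_grassPairs.1 hp
    have := Submodule.finrank_mono (le_inf hp1.1 hp2.1)
    rw [(mem_grass.1 hY).2.2] at this
    exact le_antisymm (finrank_inf_le (mem_grass.1 hW).2.2 (mem_grass.1 hW').2.2 hne) this

theorem grass_nonempty (h : IsFullFlag ω₀) (hmn : m ≤ n) {k : ℕ} (hlk : l ≤ k) (hkm : k ≤ m) :
    (grass ω₀ l m k).Nonempty :=
  ⟨ω₀ k, mem_grass.2 ⟨h.1 hlk, h.1 hkm, h.finrank_eq (hkm.trans hmn)⟩⟩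

theorem grassPairs_nonempty (h : IsFullFlag ω₀) (hmn : m ≤ n) {j : ℕ} (hlj : l ≤ j)
    (hjm : j + 2 ≤ m) : (grassPairs ω₀ l m j).Nonempty :=
  ⟨(ω₀ j, ω₀ (j + 2)), mem_grassPairs.2 ⟨⟨mem_grass.2 ⟨h.1 hlj, h.1 (by omega),
    h.finrank_eq (by omega)⟩, mem_grass.2 ⟨h.1 (by omega), h.1 hjm, h.finrank_eq (by omega)⟩⟩,
    h.1 (by simp)⟩⟩

theorem card_le_card_left [Fintype F] (h : IsFullFlag ω₀) (hmn : m ≤ n) {j : ℕ} (hlj : l ≤ j)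
    (hjm : j + 2 ≤ m) {R : Type*} {inc : Submodule F (Fin n → F) → R → Prop} {b : R}
    (hb : ∀ W, ω₀ j ≤ W → W ≤ ω₀ (j + 2) → finrank F W = j + 1 → inc W b) :
    Fintype.card F ≤ #(left (grass ω₀ l m (j + 1)) inc b) := by
  have h1 := h.finrank_eq (i := j) (by omega)
  have h2 := h.finrank_eq (i := j + 2) (by omega)
  refine le_card_between (h.1 (Nat.le_add_right j 2)) (by omega) fun W hW1 hW2 hW3 => ?_
  rw [h1] at hW3
  exact mem_left.2 ⟨mem_grass.2 ⟨(h.1 hlj).trans hW1, hW2.trans (h.1 hjm), hW3⟩, hb W hW1 hW2 hW3⟩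

theorem two_le_card (F : Type*) [Field F] [Fintype F] : 2 ≤ Fintype.card F :=
  Fintype.one_lt_card

/-- Transposing the hypothesis gives contraction for the blocks below dimension `j + 1`; the common
adjacency transfers it to the blocks above and to the pairs. -/
theorem contracts_step [Fintype F] (h : IsFullFlag ω₀) (hmn : m ≤ n) {j : ℕ} (hlj : l ≤ j)
    (hjm : j + 2 ≤ m) {τ : ℝ} (hτ : 0 ≤ τ)
    (hc : Contracts (grass ω₀ l m j) (grass ω₀ l m (j + 1)) (· ≤ ·) τ) :
    Contracts (grass ω₀ l m (j + 1)) (grass ω₀ l m (j + 2)) (· ≤ ·)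
      (1 / (Fintype.card F : ℝ) + 2 * τ) ∧
    Contracts (grass ω₀ l m (j + 1)) (grassPairs ω₀ l m j) Between
      (1 / (Fintype.card F : ℝ) + 2 * τ) := by
  have hq : (0 : ℝ) < Fintype.card F := by exact_mod_cast Fintype.card_pos
  have n0 := grass_nonempty h hmn hlj (by omega : j ≤ m)
  have n1 := grass_nonempty h hmn (by omega : l ≤ j + 1) (by omega)
  have n2 := grass_nonempty h hmn (by omega : l ≤ j + 2) hjm
  have n3 := grassPairs_nonempty h hmn hlj hjm
  obtain ⟨a, b, hb⟩ := biregular_grass h hmn hlj (Nat.le_succ j) (by omega)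
  obtain ⟨a', b', hb'⟩ := biregular_grass h hmn (by omega : l ≤ j + 1) (Nat.le_succ (j + 1)) hjm
  obtain ⟨a'', b'', hb''⟩ := biregular_grassPairs h hmn hlj hjm
  have m0 : ω₀ j ∈ grass ω₀ l m j := mem_grass.2 ⟨h.1 hlj, h.1 (by omega), h.finrank_eq (by omega)⟩
  have m2 : ω₀ (j + 2) ∈ grass ω₀ l m (j + 2) :=
    mem_grass.2 ⟨h.1 (by omega), h.1 hjm, h.finrank_eq (by omega)⟩
  have m1 : ω₀ (j + 1) ∈ grass ω₀ l m (j + 1) :=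
    mem_grass.2 ⟨h.1 (by omega), h.1 (by omega), h.finrank_eq (by omega)⟩
  have m3 : (ω₀ j, ω₀ (j + 2)) ∈ grassPairs ω₀ l m j :=
    mem_grassPairs.2 ⟨⟨m0, m2⟩, h.1 (by simp)⟩
  have q0 : Fintype.card F ≤ b := by
    rw [← hb.card_right _ m0]
    exact card_le_card_left h hmn hlj hjm fun W h1 _ _ => h1
  have q2 : Fintype.card F ≤ a' := by
    rw [← hb'.card_left _ m2]
    exact card_le_card_left h hmn hlj hjm fun W _ h2 _ => h2
  have q3 : Fintype.card F ≤ a'' := by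
    rw [← hb''.card_left _ m3]
    exact card_le_card_left h hmn hlj hjm fun W h1 h2 _ => ⟨h1, h2⟩
  have ha : 0 < a := by
    rw [← hb.card_left _ m1, card_pos]
    exact ⟨ω₀ j, mem_left.2 ⟨m0, h.1 (Nat.le_succ j)⟩⟩
  have hc' := hc.symm hτ hb ha
  exact ⟨hc'.of_blocks hτ hq n1 n0 n2 (isBlockSystem_below j) (isBlockSystem_above j) hb.symm hb'
      ((two_le_card F).trans q0) (by exact_mod_cast q2),
    hc'.of_blocks hτ hq n1 n0 n3 (isBlockSystem_below j) (isBlockSystem_pairs j) hb.symm hb''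
      ((two_le_card F).trans q0) (by exact_mod_cast q3)⟩

/-- The recursion `τ ↦ 1 / q + 2τ` starts from `0`: at the bottom of the interval there is a single
subspace, on which a function of mean zero vanishes. -/
theorem contracts_grass [Fintype F] (h : IsFullFlag ω₀) (hmn : m ≤ n) (d : ℕ)
    (hd : l + d + 1 ≤ m) :
    Contracts (grass ω₀ l m (l + d)) (grass ω₀ l m (l + d + 1)) (· ≤ ·)
      ((2 ^ d - 1) / (Fintype.card F : ℝ)) := by
  induction d with
  | zero =>
    intro f hf
    have hX : ∀ W ∈ grass ω₀ l m (l + 0), W = ω₀ l := by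
      intro W hW
      obtain ⟨h1, -, h3⟩ := mem_grass.1 hW
      refine (Submodule.eq_of_le_of_finrank_eq h1 ?_).symm
      rw [h3, h.finrank_eq (by omega), add_zero]
    have hf0 : f (ω₀ l) = 0 := by
      rw [← hf, ← avg_const (grass_nonempty h hmn (by omega : l ≤ l + 0) (by omega)) (f (ω₀ l))]
      exact avg_congr fun W hW => by rw [hX W hW]
    refine le_of_eq ?_
    rw [pow_zero, sub_self, zero_div, zero_mul]
    unfold avg
    rw [sum_eq_zero, zero_div]
    intro b _
    rw [sum_eq_zero, zero_div, sq, zero_mul]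
    intro W hW
    rw [hX W (mem_left.1 hW).1, hf0]
  | succ d ih =>
    have h1 := ih (by omega)
    have hτ : 0 ≤ ((2 : ℝ) ^ d - 1) / (Fintype.card F : ℝ) :=
      div_nonneg (sub_nonneg.2 (one_le_pow₀ (by norm_num))) (Nat.cast_nonneg _)
    have h2 := (contracts_step h hmn (by omega) (by omega) hτ h1).1
    have e : 1 / (Fintype.card F : ℝ) + 2 * ((2 ^ d - 1) / (Fintype.card F : ℝ)) =
        (2 ^ (d + 1) - 1) / (Fintype.card F : ℝ) := by ring
    rw [e] at h2
    exact h2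

theorem contracts_grassPairs [Fintype F] (h : IsFullFlag ω₀) (hmn : m ≤ n) {j : ℕ} (hlj : l ≤ j)
    (hjm : j + 2 ≤ m) :
    Contracts (grass ω₀ l m (j + 1)) (grassPairs ω₀ l m j) Between
      (2 ^ n / (Fintype.card F : ℝ)) := by
  obtain ⟨d, rfl⟩ := Nat.exists_eq_add_of_le hlj
  have hτ : 0 ≤ ((2 : ℝ) ^ d - 1) / (Fintype.card F : ℝ) :=
    div_nonneg (sub_nonneg.2 (one_le_pow₀ (by norm_num))) (Nat.cast_nonneg _)
  have h2 := (contracts_step h hmn (by omega) (by omega) hτ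
    (contracts_grass h hmn d (by omega))).2
  intro f hf
  refine (h2 f hf).trans (mul_le_mul_of_nonneg_right ?_ (avg_nonneg fun _ _ => sq_nonneg _))
  have e : 1 / (Fintype.card F : ℝ) + 2 * ((2 ^ d - 1) / (Fintype.card F : ℝ)) =
      (2 ^ (d + 1) - 1) / (Fintype.card F : ℝ) := by ring
  rw [e]
  have h3 : (2 : ℝ) ^ (d + 1) ≤ 2 ^ n := pow_le_pow_right₀ (by norm_num) (by omega)
  gcongr
  linarith

end Grassmannian

/-! ### Mixing of random flags -/

section MixingOfFlags

open Module

open scoped Classical in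
theorem avg_sub_prob_sq {S : Type*} {Ω : Finset S} (hΩ : Ω.Nonempty) (P : S → Prop) :
    avg Ω (fun ω => ((if P ω then (1 : ℝ) else 0) - prob Ω P) ^ 2) =
      prob Ω P * (1 - prob Ω P) := by
  set p := prob Ω P with hp
  have h : ∀ ω ∈ Ω, ((if P ω then (1 : ℝ) else 0) - p) ^ 2 =
      (1 - 2 * p) * (if P ω then (1 : ℝ) else 0) + p ^ 2 := by
    intro ω _
    split_ifs <;> ring
  rw [avg_congr h, avg_add, avg_mul_left, avg_const hΩ]
  change (1 - 2 * p) * prob Ω P + p ^ 2 = _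
  rw [← hp]
  ring

/-- Regrouping the four factors, AM-GM in the form `2√(ap) ≤ a + p` gives `√((1 - a)(1 - p)) ≤ 1 -
√(ap)`. This converts a covariance bound into the shape required by `Mixes`. -/
theorem sqrt_mul_sqrt_le {lam τ a p : ℝ} (hlam : 0 ≤ lam) (hτ : τ ≤ lam ^ 2) (ha0 : 0 ≤ a)
    (ha1 : a ≤ 1) (hp0 : 0 ≤ p) (hp1 : p ≤ 1) :
    √(τ * (a * (1 - a))) * √(p * (1 - p)) ≤ lam * (√(a * p) - a * p) := by
  have h1 : √(τ * (a * (1 - a))) ≤ lam * √(a * (1 - a)) := by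
    calc √(τ * (a * (1 - a))) ≤ √(lam ^ 2 * (a * (1 - a))) := by
          refine Real.sqrt_le_sqrt (mul_le_mul_of_nonneg_right hτ (mul_nonneg ha0 (by linarith)))
      _ = lam * √(a * (1 - a)) := by rw [Real.sqrt_mul (sq_nonneg _), Real.sqrt_sq hlam]
  have hap : 0 ≤ a * p := mul_nonneg ha0 hp0
  have h2 : √(a * (1 - a)) * √(p * (1 - p)) = √(a * p) * √((1 - a) * (1 - p)) := by
    rw [← Real.sqrt_mul (mul_nonneg ha0 (by linarith)), ← Real.sqrt_mul hap]
    congr 1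
    ring
  have h3 : √(a * p) ≤ (a + p) / 2 := by
    rw [Real.sqrt_le_left (by positivity)]
    nlinarith [sq_nonneg (a - p)]
  have h4 : √((1 - a) * (1 - p)) ≤ 1 - √(a * p) := by
    rw [Real.sqrt_le_left (by linarith)]
    nlinarith [Real.sq_sqrt hap]
  calc √(τ * (a * (1 - a))) * √(p * (1 - p)) ≤ lam * √(a * (1 - a)) * √(p * (1 - p)) := by gcongr
    _ = lam * (√(a * p) * √((1 - a) * (1 - p))) := by rw [mul_assoc, h2]
    _ ≤ lam * (√(a * p) * (1 - √(a * p))) := by gcongr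
    _ = lam * (√(a * p) - a * p) := by rw [mul_sub, mul_one, Real.mul_self_sqrt hap]

variable {F : Type u} [Field F] {n : ℕ}

theorem IsFullFlag.update {ω : ℕ → Submodule F (Fin n → F)} (h : IsFullFlag ω) {j : ℕ}
    (hj : j + 1 ≤ n) {W : Submodule F (Fin n → F)} (h1 : ω j ≤ W) (h2 : W ≤ ω (j + 2))
    (hW : finrank F W = j + 1) : IsFullFlag (Function.update ω (j + 1) W) := by
  refine ⟨fun a b hab => ?_, fun i => ?_⟩
  · by_cases ha : a = j + 1
    · subst ha
      rw [Function.update_self]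
      by_cases hb : b = j + 1
      · subst hb
        rw [Function.update_self]
      · rw [Function.update_of_ne hb]
        exact h2.trans (h.1 (by omega))
    · rw [Function.update_of_ne ha]
      by_cases hb : b = j + 1
      · subst hb
        rw [Function.update_self]
        exact (h.1 (by omega)).trans h1
      · rw [Function.update_of_ne hb]
        exact h.1 hab
  · by_cases hi : i = j + 1
    · subst hi
      rw [Function.update_self, hW, min_eq_left hj]
    · rw [Function.update_of_ne hi, h.2]

variable [Finite F] {ω₀ : ℕ → Submodule F (Fin n → F)} {T : Set ℕ} {l m : ℕ}

theorem pair_mem_grassPairs (hl : l ∈ T) (hm : m ∈ T) (hmn : m ≤ n)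
    {ω : ℕ → Submodule F (Fin n → F)} (hω : ω ∈ flagsThrough T ω₀) {j : ℕ} (hlj : l ≤ j)
    (hjm : j + 2 ≤ m) : (ω j, ω (j + 2)) ∈ grassPairs ω₀ l m j :=
  mem_grassPairs.2 ⟨⟨apply_mem_grass hl hm hmn hω hlj (by omega),
    apply_mem_grass hl hm hmn hω (by omega) hjm⟩, (mem_flagsThrough.1 hω).1.1 (by simp)⟩

theorem avg_apply (h : IsFullFlag ω₀) (hl : l ∈ T) (hm : m ∈ T)
    (hT : ∀ t ∈ T, t ≤ l ∨ m ≤ t) (hmn : m ≤ n) {k : ℕ} (hlk : l ≤ k) (hkm : k ≤ m)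
    (φ : Submodule F (Fin n → F) → ℝ) :
    avg (flagsThrough T ω₀) (fun ω => φ (ω k)) = avg (grass ω₀ l m k) φ := by
  obtain ⟨c, hc⟩ := exists_card_left_eq (X := flagsThrough T ω₀) (B := grass ω₀ l m k)
    (inc := fun ω b => ω k = b) (by
      intro b hb b' hb'
      obtain ⟨ω, hω, rfl⟩ := exists_flag_of_mem_grass h hT hmn hlk hkm hb
      obtain ⟨ω', hω', rfl⟩ := exists_flag_of_mem_grass h hT hmn hlk hkm hb'
      obtain ⟨g, rfl, h2⟩ := exists_act_eq_of_mem hω hω'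
      refine ⟨act g, act_injective g, fun x hx e => ?_⟩
      exact ⟨(act_mem_flagsThrough h2).2 hx, by rw [act, act, e]⟩)
  refine avg_comp_of_card_fiber (fun ω hω => apply_mem_grass hl hm hmn hω hlk hkm) ?_ hc φ
  have h0 := flagsThrough_nonempty (T := T) h
  have hm0 : ω₀ ∈ flagsThrough T ω₀ := mem_flagsThrough.2 ⟨h, fun _ _ => rfl⟩
  rw [← hc (ω₀ k) (apply_mem_grass hl hm hmn hm0 hlk hkm), card_pos]
  exact ⟨ω₀, mem_left.2 ⟨hm0, rfl⟩⟩

theorem avg_apply_pair (h : IsFullFlag ω₀) (hl : l ∈ T) (hm : m ∈ T)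
    (hT : ∀ t ∈ T, t ≤ l ∨ m ≤ t) (hmn : m ≤ n) {j : ℕ} (hlj : l ≤ j) (hjm : j + 2 ≤ m)
    (φ : Submodule F (Fin n → F) × Submodule F (Fin n → F) → ℝ) :
    avg (flagsThrough T ω₀) (fun ω => φ (ω j, ω (j + 2))) = avg (grassPairs ω₀ l m j) φ := by
  obtain ⟨c, hc⟩ := exists_card_left_eq (X := flagsThrough T ω₀) (B := grassPairs ω₀ l m j)
    (inc := fun ω b => (ω j, ω (j + 2)) = b) (by
      rintro ⟨Y, Z⟩ hb ⟨Y', Z'⟩ hb'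
      obtain ⟨⟨hY, hZ⟩, hYZ⟩ := mem_grassPairs.1 hb
      obtain ⟨⟨hY', hZ'⟩, hYZ'⟩ := mem_grassPairs.1 hb'
      obtain ⟨ω, hω, rfl, rfl⟩ := exists_flag_of_le h hT hmn hlj (by omega) hjm hY hZ hYZ
      obtain ⟨ω', hω', rfl, rfl⟩ := exists_flag_of_le h hT hmn hlj (by omega) hjm hY' hZ' hYZ'
      obtain ⟨g, rfl, h2⟩ := exists_act_eq_of_mem hω hω'
      refine ⟨act g, act_injective g, fun x hx e => ?_⟩
      rw [Prod.mk.injEq] at e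
      exact ⟨(act_mem_flagsThrough h2).2 hx, by rw [act, act, act, act, e.1, e.2]⟩)
  refine avg_comp_of_card_fiber (fun ω hω => pair_mem_grassPairs hl hm hmn hω hlj hjm) ?_ hc φ
  have hm0 : ω₀ ∈ flagsThrough T ω₀ := mem_flagsThrough.2 ⟨h, fun _ _ => rfl⟩
  rw [← hc _ (pair_mem_grassPairs hl hm hmn hm0 hlj hjm), card_pos]
  exact ⟨ω₀, mem_left.2 ⟨hm0, rfl⟩⟩

/-- Given the other members of the flag, the one of dimension `j + 1` is uniform among the subspaces
between its two neighbours. Exchanging the current member with a resampled one is an involution that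
proves this. -/
theorem avg_resample (hl : l ∈ T) (hm : m ∈ T)
    (hT : ∀ t ∈ T, t ≤ l ∨ m ≤ t) (hmn : m ≤ n) {j : ℕ} (hlj : l ≤ j) (hjm : j + 2 ≤ m)
    (φ : Submodule F (Fin n → F) → ℝ) {p : (ℕ → Submodule F (Fin n → F)) → ℝ}
    (hp : DependsOn p {j + 1}ᶜ) :
    avg (flagsThrough T ω₀) (fun ω =>
      avg (left (grass ω₀ l m (j + 1)) Between (ω j, ω (j + 2))) φ * p ω) =
    avg (flagsThrough T ω₀) (fun ω => φ (ω (j + 1)) * p ω) := by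
  set Ω := flagsThrough T ω₀
  let N : (ℕ → Submodule F (Fin n → F)) → Finset (Submodule F (Fin n → F)) := fun ω =>
    left (grass ω₀ l m (j + 1)) Between (ω j, ω (j + 2))
  have hN : ∀ ω W, N (Function.update ω (j + 1) W) = N ω := by
    intro ω W
    simp only [N]
    rw [Function.update_of_ne (by omega), Function.update_of_ne (by omega)]
  have hpu : ∀ ω W, p (Function.update ω (j + 1) W) = p ω := by
    intro ω W
    exact hp fun i hi => Function.update_of_ne (by simpa using hi) _ _
  have hmem : ∀ ω ∈ Ω, ω (j + 1) ∈ N ω := by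
    intro ω hω
    have h1 := (mem_flagsThrough.1 hω).1.1
    exact mem_left.2 ⟨apply_mem_grass hl hm hmn hω (by omega) (by omega), h1 (by simp),
      h1 (by simp)⟩
  have hupd : ∀ ω ∈ Ω, ∀ W ∈ N ω, Function.update ω (j + 1) W ∈ Ω := by
    intro ω hω W hW
    obtain ⟨h1, h2⟩ := mem_flagsThrough.1 hω
    obtain ⟨h3, h4, h5⟩ := mem_left.1 hW
    refine mem_flagsThrough.2 ⟨h1.update (by omega) h4 h5 (mem_grass.1 h3).2.2, fun t ht => ?_⟩
    have := hT t ht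
    rw [Function.update_of_ne (by omega), h2 t ht]
  have key : ∑ ω ∈ Ω, ∑ W ∈ N ω, φ W * (p ω / #(N ω)) =
      ∑ ω ∈ Ω, ∑ W ∈ N ω, φ (ω (j + 1)) * (p ω / #(N ω)) := by
    rw [sum_sigma', sum_sigma']
    refine sum_nbij' (fun x => ⟨Function.update x.1 (j + 1) x.2, x.1 (j + 1)⟩)
      (fun x => ⟨Function.update x.1 (j + 1) x.2, x.1 (j + 1)⟩) ?_ ?_ ?_ ?_ ?_
    · rintro ⟨ω, W⟩ hx
      obtain ⟨h1, h2⟩ := mem_sigma.1 hx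
      exact mem_sigma.2 ⟨hupd ω h1 W h2, by rw [hN]; exact hmem ω h1⟩
    · rintro ⟨ω, W⟩ hx
      obtain ⟨h1, h2⟩ := mem_sigma.1 hx
      exact mem_sigma.2 ⟨hupd ω h1 W h2, by rw [hN]; exact hmem ω h1⟩
    · rintro ⟨ω, W⟩ hx
      simp
    · rintro ⟨ω, W⟩ hx
      simp
    · rintro ⟨ω, W⟩ hx
      simp [hN, hpu]
  unfold avg
  congr 1
  refine Eq.trans (sum_congr rfl fun ω hω => ?_) (key.trans (sum_congr rfl fun ω hω => ?_))
  · rw [← sum_mul]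
    ring
  · have h0 : (#(N ω) : ℝ) ≠ 0 := by exact_mod_cast (card_pos.2 ⟨_, hmem ω hω⟩).ne'
    rw [sum_const, nsmul_eq_mul]
    field_simp

/-- The flags through a given partial flag are mixing. -/
theorem mixes_flagsThrough [Fintype F] (h : IsFullFlag ω₀) {k : ℕ} (hk : k ∉ T) (hk0 : 0 < k)
    (hkn : k < n) {lam : ℝ} (hlam : 0 ≤ lam) (hq : 2 ^ n ≤ lam ^ 2 * Fintype.card F) :
    Mixes (flagsThrough T ω₀) k lam := by
  classical
  -- The dimensions `0` and `n` are fixed anyway. Including them ensures that `k` lies between two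
  -- fixed dimensions `l` and `m`, which may be taken nearest to it.
  set T' : Set ℕ := insert 0 (insert n T)
  have hTT' : flagsThrough T ω₀ = flagsThrough T' ω₀ := by
    ext ω
    simp only [mem_flagsThrough, T', Set.mem_insert_iff, forall_eq_or_imp]
    constructor
    · rintro ⟨h1, h2⟩
      exact ⟨h1, h1.eq_bot.trans h.eq_bot.symm, (h1.eq_top le_rfl).trans (h.eq_top le_rfl).symm, h2⟩
    · rintro ⟨h1, -, -, h2⟩
      exact ⟨h1, h2⟩
  have hk' : k ∉ T' := by
    simp only [T', Set.mem_insert_iff, not_or]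
    exact ⟨by omega, by omega, hk⟩
  rw [hTT']
  set l := Nat.findGreatest (· ∈ T') k
  have hl : l ∈ T' := Nat.findGreatest_spec (P := (· ∈ T')) (Nat.zero_le k) (by simp [T'])
  have hlk : l < k := lt_of_le_of_ne (Nat.findGreatest_le k) fun e => hk' (e ▸ hl)
  have hex : ∃ t, k < t ∧ t ∈ T' := ⟨n, hkn, by simp [T']⟩
  set m := Nat.find hex
  obtain ⟨hkm, hm⟩ := Nat.find_spec hex
  have hmn : m ≤ n := Nat.find_min' hex ⟨hkn, by simp [T']⟩
  have hT : ∀ t ∈ T', t ≤ l ∨ m ≤ t := by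
    intro t ht
    rcases le_or_gt t k with htk | htk
    · exact Or.inl (Nat.le_findGreatest htk ht)
    · exact Or.inr (Nat.find_min' hex ⟨htk, ht⟩)
  change k < m at hkm
  change m ∈ T' at hm
  obtain ⟨j, rfl⟩ : ∃ j, k = j + 1 := ⟨k - 1, by omega⟩
  clear_value l m T'
  have hlj : l ≤ j := by omega
  have hjm : j + 2 ≤ m := by omega
  have hq0 : (0 : ℝ) < Fintype.card F := by exact_mod_cast Fintype.card_pos
  have hτ : (2 : ℝ) ^ n / (Fintype.card F : ℝ) ≤ lam ^ 2 := by rwa [div_le_iff₀ hq0]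
  intro A P hP
  set Ω := flagsThrough T' ω₀
  have hΩ : Ω.Nonempty := flagsThrough_nonempty h
  set X := grass ω₀ l m (j + 1)
  have hX : X.Nonempty := grass_nonempty h hmn (by omega) (by omega)
  set a := prob Ω fun ω => A (ω (j + 1))
  set p := prob Ω P
  have haX : a = prob X A :=
    avg_apply h hl hm hT hmn (by omega) (by omega) fun W => if A W then 1 else 0
  let φ : Submodule F (Fin n → F) → ℝ := fun W => (if A W then 1 else 0) - a
  let ψ : (ℕ → Submodule F (Fin n → F)) → ℝ := fun ω => (if P ω then 1 else 0) - p
  -- The conditional mean of `φ` given the neighbouring members. It may replace `φ` in the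
  -- covariance with `ψ`; Cauchy–Schwarz and the contraction for pairs then finish.
  let M : (ℕ → Submodule F (Fin n → F)) → ℝ := fun ω => avg (left X Between (ω j, ω (j + 2))) φ
  have hψ : DependsOn ψ {j + 1}ᶜ := by
    intro x y hxy
    simp only [ψ]
    rw [hP hxy]
  have e1 : avg Ω (fun ω => φ (ω (j + 1)) * ψ ω) = avg Ω (fun ω => M ω * ψ ω) :=
    (avg_resample hl hm hT hmn hlj hjm φ hψ).symm
  have e2 : avg Ω (fun ω => φ (ω (j + 1)) * ψ ω) =
      prob Ω (fun ω => A (ω (j + 1)) ∧ P ω) - a * p := by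
    have e3 : ∀ ω ∈ Ω, φ (ω (j + 1)) * ψ ω = (if A (ω (j + 1)) ∧ P ω then (1 : ℝ) else 0) -
        (p * (if A (ω (j + 1)) then (1 : ℝ) else 0) +
          (a * (if P ω then (1 : ℝ) else 0) - a * p)) := by
      intro ω _
      by_cases h1 : A (ω (j + 1)) <;> by_cases h2 : P ω <;> simp [φ, ψ, h1, h2] <;> ring
    rw [avg_congr e3, avg_sub, avg_add, avg_sub, avg_mul_left, avg_mul_left, avg_const hΩ]
    have e7 : avg Ω (fun ω => if A (ω (j + 1)) ∧ P ω then (1 : ℝ) else 0) =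
        prob Ω (fun ω => A (ω (j + 1)) ∧ P ω) := by
      unfold prob
      refine avg_congr fun ω _ => ?_
      by_cases h1 : A (ω (j + 1)) ∧ P ω <;> simp [h1]
    have e8 : avg Ω (fun ω => if A (ω (j + 1)) then (1 : ℝ) else 0) = a := by
      simp only [a, prob]
    have e9 : avg Ω (fun ω => if P ω then (1 : ℝ) else 0) = p := by
      simp only [p, prob]
    rw [e7, e8, e9]
    ring
  have e4 : avg Ω (fun ω => M ω ^ 2) ≤ 2 ^ n / (Fintype.card F : ℝ) * (a * (1 - a)) := by
    have h1 : avg X φ = 0 := by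
      simp only [φ]
      rw [avg_sub, avg_const hX, haX]
      exact sub_self _
    have h2 := contracts_grassPairs h hmn hlj hjm φ h1
    rw [← avg_apply_pair h hl hm hT hmn hlj hjm
      fun b => avg (left (grass ω₀ l m (j + 1)) Between b) φ ^ 2] at h2
    refine h2.trans (le_of_eq ?_)
    congr 1
    simp only [φ]
    rw [haX, avg_sub_prob_sq hX]
  have e5 : avg Ω (fun ω => ψ ω ^ 2) = p * (1 - p) := avg_sub_prob_sq hΩ P
  have e6 : avg Ω (fun ω => M ω * ψ ω) ≤ lam * (√(a * p) - a * p) := by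
    refine avg_mul_le_sqrt.trans ?_
    rw [e5]
    refine le_trans ?_ (sqrt_mul_sqrt_le hlam hτ prob_nonneg prob_le_one prob_nonneg prob_le_one)
    gcongr
  rw [← e1, e2] at e6
  linarith

end MixingOfFlags

/-! ### Three consecutive dimensions: a cone and its translates -/

section Cone

open Module

variable {F : Type u} [Field F] {n : ℕ}

theorem exists_common_upper {L x y Z : Submodule F (Fin n → F)} (hLx : L ≤ x) (hLy : L ≤ y)
    (hxZ : x ≤ Z) (hyZ : y ≤ Z) {k : ℕ} (hx : finrank F x = finrank F L + 1)
    (hy : finrank F y = k) (hZ : k + 1 ≤ finrank F Z) :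
    ∃ W, x ≤ W ∧ y ≤ W ∧ W ≤ Z ∧ finrank F W = k + 1 := by
  have h1 := Submodule.finrank_sup_add_finrank_inf_eq x y
  have h2 := Submodule.finrank_mono (le_inf hLx hLy)
  obtain ⟨c, hc1, hc2, hc3, hc4⟩ := exists_segment (sup_le hxZ hyZ)
  have h3 : x ⊔ y ≤ c (k + 1) := (hc2 _ le_rfl).ge.trans (hc1 (by omega))
  exact ⟨c (k + 1), le_sup_left.trans h3, le_sup_right.trans h3,
    (hc1 hZ).trans (hc3 _ le_rfl).le, hc4 _ (by omega) hZ⟩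

variable [Finite F] {ω₀ : ℕ → Submodule F (Fin n → F)} {T : Set ℕ} {r : ℕ}

theorem exists_flag_of_chain (h : IsFullFlag ω₀) (hT : ∀ t ∈ T, t ≤ r) (hn : r + 3 ≤ n)
    {p l m : Submodule F (Fin n → F)} (hp : ω₀ r ≤ p) (hpl : p ≤ l) (hlm : l ≤ m)
    (hp1 : finrank F p = r + 1) (hl1 : finrank F l = r + 2) (hm1 : finrank F m = r + 3) :
    ∃ ω ∈ flagsThrough T ω₀, ω (r + 1) = p ∧ ω (r + 2) = l ∧ ω (r + 3) = m := by
  obtain ⟨ω, h1, h2, -, h3⟩ := h.exists_through (Nat.le_succ r) (by omega : r + 1 ≤ n) le_rfl hp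
    (by rw [h.eq_top le_rfl]; exact le_top) hp1
  obtain ⟨ω', h1', h2', -, h3'⟩ := h1.exists_through (Nat.le_succ (r + 1)) (by omega : r + 2 ≤ n)
    le_rfl (h3.trans_le hpl) (by rw [h1.eq_top le_rfl]; exact le_top) hl1
  obtain ⟨ω'', h1'', h2'', -, h3''⟩ := h1'.exists_through (Nat.le_succ (r + 2)) hn
    le_rfl (h3'.trans_le hlm) (by rw [h1'.eq_top le_rfl]; exact le_top) hm1
  refine ⟨ω'', mem_flagsThrough.2 ⟨h1'', fun t ht => ?_⟩, ?_, ?_, h3''⟩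
  · have := hT t ht
    rw [h2'' t (by omega), h2' t (by omega), h2 t this]
  · rw [h2'' _ (by omega), h2' _ le_rfl, h3]
  · rw [h2'' _ le_rfl, h3']

/-- The cone over a subspace of dimension `r + 1`: off a bounded set of triangles every edge
function is a coboundary. -/
theorem exists_cone (h : IsFullFlag ω₀) (hr : r ∈ T) (hT : ∀ t ∈ T, t ≤ r) (hn : r + 3 ≤ n) :
    ∃ S : (ℕ → Submodule F (Fin n → F)) → Finset (ℕ → Submodule F (Fin n → F)),
      (∀ ω ∈ flagsThrough T ω₀, S ω ⊆ flagsThrough T ω₀ ∧ #(S ω) ≤ 23) ∧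
      ∀ (Γ : Type v) [Group Γ]
        (f : ℕ → ℕ → Submodule F (Fin n → F) → Submodule F (Fin n → F) → Γ),
        ∃ g : ℕ → Submodule F (Fin n → F) → Γ, ∀ ω ∈ flagsThrough T ω₀,
          (∀ s ∈ S ω, ¬TriangleBad {r + 1, r + 2, r + 3} f s) →
            ¬EdgeBad {r + 1, r + 2, r + 3} f g ω := by
  classical
  set Ω := flagsThrough T ω₀
  set L := ω₀ r
  have hL : finrank F L = r := h.finrank_eq (by omega)
  -- Modulo `L`, the subspaces in `A 1`, `A 2`, `A 3` are points, lines and planes of projective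
  -- space; `o` is the base point of the cone.
  let A : ℕ → Submodule F (Fin n → F) → Prop := fun d W => L ≤ W ∧ finrank F W = r + d
  set o := ω₀ (r + 1)
  have ho : A 1 o := ⟨h.1 (Nat.le_succ r), h.finrank_eq (by omega)⟩
  have htop : finrank F (⊤ : Submodule F (Fin n → F)) = n := by simp
  have hfl : ∀ p l m, ∃ s ∈ Ω, A 1 p → A 2 l → A 3 m → p ≤ l → l ≤ m →
      s (r + 1) = p ∧ s (r + 2) = l ∧ s (r + 3) = m := by
    intro p l m
    by_cases H : A 1 p ∧ A 2 l ∧ A 3 m ∧ p ≤ l ∧ l ≤ m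
    · obtain ⟨h1, h2, h3, h4, h5⟩ := H
      obtain ⟨s, hs, e⟩ := exists_flag_of_chain h hT hn h1.1 h4 h5 h1.2 h2.2 h3.2
      exact ⟨s, hs, fun _ _ _ _ _ => e⟩
    · exact ⟨ω₀, mem_flagsThrough.2 ⟨h, fun _ _ => rfl⟩, fun h1 h2 h3 h4 h5 =>
        absurd ⟨h1, h2, h3, h4, h5⟩ H⟩
  have hline : ∀ p, ∃ l, A 1 p → A 2 l ∧ o ≤ l ∧ p ≤ l ∧
      (p ≠ o → ∀ m, o ≤ m → p ≤ m → l ≤ m) := by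
    intro p
    by_cases H : A 1 p
    · obtain ⟨W, h1, h2, -, h3⟩ := exists_common_upper ho.1 H.1 le_top le_top (by rw [ho.2, hL]) H.2
        (by rw [htop]; omega)
      refine ⟨W, fun _ => ⟨⟨H.1.trans h2, h3⟩, h1, h2, fun hne m hom hpm => ?_⟩⟩
      have h4 := finrank_inf_le H.2 ho.2 hne
      have h5 := Submodule.finrank_sup_add_finrank_inf_eq p o
      rw [H.2, ho.2] at h5
      rw [← Submodule.eq_of_le_of_finrank_le (sup_le h2 h1) (by omega)]
      exact sup_le hpm hom
    · exact ⟨⊥, fun h1 => absurd h1 H⟩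
  have hup : ∀ l, ∃ m, A 2 l → A 3 m ∧ o ≤ m ∧ l ≤ m := by
    intro l
    by_cases H : A 2 l
    · obtain ⟨W, h1, h2, -, h3⟩ := exists_common_upper ho.1 H.1 le_top le_top (by rw [ho.2, hL]) H.2
        (by rw [htop]; omega)
      exact ⟨W, fun _ => ⟨⟨H.1.trans h2, h3⟩, h1, h2⟩⟩
    · exact ⟨⊥, fun h1 => absurd h1 H⟩
  have hpt : ∀ W, ∃ p, L ≤ W → r + 1 ≤ finrank F W → A 1 p ∧ p ≤ W := by
    intro W
    by_cases H : L ≤ W ∧ r + 1 ≤ finrank F W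
    · obtain ⟨d, hd1, hd2, hd3, hd4⟩ := exists_segment H.1
      exact ⟨d (r + 1), fun _ _ => ⟨⟨(hd2 r hL.ge).ge.trans (hd1 (Nat.le_succ r)),
        hd4 _ (by omega) H.2⟩, (hd1 H.2).trans (hd3 _ le_rfl).le⟩⟩
    · exact ⟨⊥, fun h1 h2 => absurd ⟨h1, h2⟩ H⟩
  have hmid : ∀ p p' m, ∃ l, A 1 p → A 1 p' → A 3 m → p ≤ m → p' ≤ m →
      A 2 l ∧ p ≤ l ∧ p' ≤ l ∧ l ≤ m := by
    intro p p' m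
    by_cases H : A 1 p ∧ A 1 p' ∧ A 3 m ∧ p ≤ m ∧ p' ≤ m
    · obtain ⟨h1, h2, h3, h4, h5⟩ := H
      obtain ⟨W, g1, g2, g3, g4⟩ := exists_common_upper h1.1 h2.1 h4 h5 (by rw [h1.2, hL]) h2.2
        (by rw [h3.2]; omega)
      exact ⟨W, fun _ _ _ _ _ => ⟨⟨h1.1.trans g1, g4⟩, g1, g2, g3⟩⟩
    · exact ⟨⊥, fun h1 h2 h3 h4 h5 => absurd ⟨h1, h2, h3, h4, h5⟩ H⟩
  choose fl hflΩ hfl using hfl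
  choose line hline using hline
  choose up hup using hup
  choose pt hpt using hpt
  choose mid hmid using hmid
  -- The triangles through the plane `up l`, which contains `o` and `l`, that determine `γ p * f p
  -- l` from `l` alone (`c1`). Similarly `S₂` serves to compare two points of a plane `m` along the
  -- line `mid` joining them (`c2`).
  let S₁ : Submodule F (Fin n → F) → Submodule F (Fin n → F) →
      Finset (ℕ → Submodule F (Fin n → F)) := fun p l =>
    {fl o (line p) (up l), fl p (line p) (up l), fl p l (up l)}
  let S₂ : Submodule F (Fin n → F) → Submodule F (Fin n → F) → Submodule F (Fin n → F) →
      Finset (ℕ → Submodule F (Fin n → F)) := fun p p' m =>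
    (S₁ p (mid p p' m) ∪ S₁ p' (mid p p' m)) ∪ {fl p (mid p p' m) m, fl p' (mid p p' m) m}
  have s1 : ∀ p l, S₁ p l ⊆ Ω ∧ #(S₁ p l) ≤ 3 := fun p l =>
    ⟨by simp [S₁, insert_subset_iff, hflΩ], card_le_three⟩
  have s2 : ∀ p p' m, S₂ p p' m ⊆ Ω ∧ #(S₂ p p' m) ≤ 8 := by
    refine fun p p' m => ⟨union_subset (union_subset (s1 _ _).1 (s1 _ _).1)
      (by simp [insert_subset_iff, hflΩ]), ?_⟩
    refine (card_union_le _ _).trans ?_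
    have h1 := card_union_le (S₁ p (mid p p' m)) (S₁ p' (mid p p' m))
    have h2 := (s1 p (mid p p' m)).2
    have h3 := (s1 p' (mid p p' m)).2
    have h4 : #{fl p (mid p p' m) m, fl p' (mid p p' m) m} ≤ 2 := card_le_two
    omega
  -- The count is `3 + 3 + 8 + 8 + 1 = 23`. The set is chosen before `Γ` and `f`, as the averaging
  -- in `expands_three` requires.
  refine ⟨fun ω => ((S₁ (ω (r + 1)) (ω (r + 2)) ∪ S₁ (pt (ω (r + 2))) (ω (r + 2))) ∪
    S₂ (ω (r + 1)) (pt (ω (r + 3))) (ω (r + 3))) ∪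
    (S₂ (pt (ω (r + 2))) (pt (ω (r + 3))) (ω (r + 3)) ∪
      {fl (pt (ω (r + 2))) (ω (r + 2)) (ω (r + 3))}), fun ω hω => ⟨?_, ?_⟩, ?_⟩
  · exact union_subset (union_subset (union_subset (s1 _ _).1 (s1 _ _).1) (s2 _ _ _).1)
      (union_subset (s2 _ _ _).1 (singleton_subset_iff.2 (hflΩ _ _ _)))
  · refine (card_union_le _ _).trans ?_
    have h1 := card_union_le (S₁ (ω (r + 1)) (ω (r + 2)) ∪ S₁ (pt (ω (r + 2))) (ω (r + 2)))
      (S₂ (ω (r + 1)) (pt (ω (r + 3))) (ω (r + 3)))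
    have h2 := card_union_le (S₁ (ω (r + 1)) (ω (r + 2))) (S₁ (pt (ω (r + 2))) (ω (r + 2)))
    have h3 := card_union_le (S₂ (pt (ω (r + 2))) (pt (ω (r + 3))) (ω (r + 3)))
      {fl (pt (ω (r + 2))) (ω (r + 2)) (ω (r + 3))}
    rw [card_singleton] at h3
    have h4 := (s1 (ω (r + 1)) (ω (r + 2))).2
    have h5 := (s1 (pt (ω (r + 2))) (ω (r + 2))).2
    have h6 := (s2 (ω (r + 1)) (pt (ω (r + 3))) (ω (r + 3))).2
    have h7 := (s2 (pt (ω (r + 2))) (pt (ω (r + 3))) (ω (r + 3))).2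
    omega
  intro Γ _ f
  set a := r + 1 with ha
  set b := r + 2 with hb
  set c := r + 3 with hc
  -- Transport from `o` to `p` through a line containing both. Lines and planes receive their values
  -- through an arbitrarily chosen point `pt`; `c1` and `c2` say that another point gives the same
  -- value.
  let γ : Submodule F (Fin n → F) → Γ := fun p => f a b o (line p) * (f a b p (line p))⁻¹
  let g : ℕ → Submodule F (Fin n → F) → Γ := fun i x =>
    if i = a then γ x else if i = b then γ (pt x) * f a b (pt x) x else γ (pt x) * f a c (pt x) x
  have good : ∀ {p l m}, A 1 p → A 2 l → A 3 m → p ≤ l → l ≤ m →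
      ¬TriangleBad {a, b, c} f (fl p l m) → f a b p l * f b c l m = f a c p m := by
    intro p l m h1 h2 h3 h4 h5 hgood
    obtain ⟨e1, e2, e3⟩ := hfl p l m h1 h2 h3 h4 h5
    by_contra hne
    refine hgood ⟨a, by simp, b, by simp, c, by simp, by omega, by omega, ?_⟩
    rwa [e1, e2, e3]
  have c1 : ∀ {p l}, A 1 p → A 2 l → p ≤ l → (∀ s ∈ S₁ p l, ¬TriangleBad {a, b, c} f s) →
      γ p * f a b p l = f a c o (up l) * (f b c l (up l))⁻¹ := by
    intro p l hp hl hpl hS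
    obtain ⟨hu1, hu2, hu3⟩ := hup l hl
    obtain ⟨hl1, hl2, hl3, hl4⟩ := hline p hp
    have g3 := good hp hl hu1 hpl hu3 (hS _ (by simp [S₁]))
    have e : γ p = f a c o (up l) * (f a c p (up l))⁻¹ := by
      by_cases hpo : p = o
      · simp [γ, hpo]
      · have hle := hl4 hpo _ hu2 (hpl.trans hu3)
        have g1 := good ho hl1 hu1 hl2 hle (hS _ (by simp [S₁]))
        have g2 := good hp hl1 hu1 hl3 hle (hS _ (by simp [S₁]))
        simp only [γ]
        rw [← g1, ← g2]
        group
    rw [e, ← g3]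
    group
  have c2 : ∀ {p p' m}, A 1 p → A 1 p' → A 3 m → p ≤ m → p' ≤ m →
      (∀ s ∈ S₂ p p' m, ¬TriangleBad {a, b, c} f s) →
      γ p * f a c p m = γ p' * f a c p' m := by
    intro p p' m hp hp' hm hpm hpm' hS
    obtain ⟨h1, h2, h3, h4⟩ := hmid p p' m hp hp' hm hpm hpm'
    have g1 := good hp h1 hm h2 h4 (hS _ (by simp [S₂]))
    have g2 := good hp' h1 hm h3 h4 (hS _ (by simp [S₂]))
    have g3 := c1 hp h1 h2 fun s hs => hS s (by simp only [S₂, mem_union]; tauto)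
    have g4 := c1 hp' h1 h3 fun s hs => hS s (by simp only [S₂, mem_union]; tauto)
    rw [← g1, ← g2, ← mul_assoc, ← mul_assoc, g3, g4]
  refine ⟨g, fun ω hω hS => ?_⟩
  obtain ⟨hω1, hω2⟩ := mem_flagsThrough.1 hω
  have hLω : ∀ d, L ≤ ω (r + d) := fun d => (hω2 r hr).ge.trans (hω1.1 (Nat.le_add_right r d))
  have hp : A 1 (ω a) := ⟨hLω 1, hω1.finrank_eq (by omega)⟩
  have hl : A 2 (ω b) := ⟨hLω 2, hω1.finrank_eq (by omega)⟩
  have hm : A 3 (ω c) := ⟨hLω 3, hω1.finrank_eq (by omega)⟩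
  have hpl : ω a ≤ ω b := hω1.1 (by omega)
  have hlm : ω b ≤ ω c := hω1.1 (by omega)
  obtain ⟨hq1, hq2⟩ := hpt (ω b) hl.1 (by rw [hl.2]; omega)
  obtain ⟨hs1, hs2⟩ := hpt (ω c) hm.1 (by rw [hm.2]; omega)
  have ga : g a (ω a) = γ (ω a) := by simp [g]
  have gb : g b (ω b) = γ (pt (ω b)) * f a b (pt (ω b)) (ω b) :=
    (if_neg (by omega)).trans (if_pos rfl)
  have gc : g c (ω c) = γ (pt (ω c)) * f a c (pt (ω c)) (ω c) :=
    (if_neg (by omega)).trans (if_neg (by omega))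
  simp only [mem_union, mem_singleton] at hS
  have e1 : g a (ω a) * f a b (ω a) (ω b) = g b (ω b) := by
    rw [ga, gb, c1 hp hl hpl fun s hs => hS s (by tauto),
      c1 hq1 hl hq2 fun s hs => hS s (by tauto)]
  have e2 : g a (ω a) * f a c (ω a) (ω c) = g c (ω c) := by
    rw [ga, gc, c2 hp hs1 hm (hpl.trans hlm) hs2 fun s hs => hS s (by tauto)]
  have e3 : g b (ω b) * f b c (ω b) (ω c) = g c (ω c) := by
    rw [gb, gc, mul_assoc, good hq1 hl hm hq2 hlm (hS _ (by tauto)),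
      c2 hq1 hs1 hm (hq2.trans hlm) hs2 fun s hs => hS s (by tauto)]
  rintro ⟨i, hi, j, hj, hij, hne⟩
  apply hne
  rw [eq_inv_mul_iff_mul_eq]
  simp only [mem_insert, mem_singleton] at hi hj
  rcases hi with rfl | rfl | rfl <;> rcases hj with rfl | rfl | rfl <;>
    first | exact e1 | exact e2 | exact e3 | omega

theorem avg_comm {S R : Type*} (X : Finset S) (Y : Finset R) (φ : S → R → ℝ) :
    avg X (fun x => avg Y (φ x)) = avg Y fun y => avg X fun x => φ x y := by
  unfold avg
  rw [← sum_div, ← sum_div, sum_comm, div_right_comm]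

theorem avg_act {g : (Fin n → F) ≃ₗ[F] (Fin n → F)} (hg : ∀ t ∈ T, act g ω₀ t = ω₀ t)
    (φ : (ℕ → Submodule F (Fin n → F)) → ℝ) :
    avg (flagsThrough T ω₀) (fun ω => φ (act g ω)) = avg (flagsThrough T ω₀) φ := by
  refine congrArg (· / _) (sum_bij (fun ω _ => act g ω) (fun ω hω => (act_mem_flagsThrough hg).2 hω)
    (fun _ _ _ _ e => act_injective g e) (fun ω hω => ?_) fun _ _ => rfl)
  refine ⟨act g.symm ω, ?_, act_act_symm g ω⟩
  rwa [← act_mem_flagsThrough hg, act_act_symm]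

variable (ω₀ T) in
/-- The linear automorphisms that fix the members of `ω₀` in the dimensions in `T`. -/
def stabilizer : Finset ((Fin n → F) ≃ₗ[F] (Fin n → F)) :=
  haveI : Finite ((Fin n → F) ≃ₗ[F] (Fin n → F)) := Finite.of_injective _ DFunLike.coe_injective
  (Set.toFinite {g | ∀ t ∈ T, act g ω₀ t = ω₀ t}).toFinset

theorem mem_stabilizer {g : (Fin n → F) ≃ₗ[F] (Fin n → F)} :
    g ∈ stabilizer ω₀ T ↔ ∀ t ∈ T, act g ω₀ t = ω₀ t := by
  simp [stabilizer]

theorem stabilizer_nonempty : (stabilizer ω₀ T).Nonempty :=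
  ⟨LinearEquiv.refl F _, mem_stabilizer.2 fun _ _ => Submodule.map_id _⟩

/-- The stabilizer is transitive on these flags, and the sets of elements carrying `ω` to a given
flag all have the same size. -/
theorem avg_stabilizer {ω : ℕ → Submodule F (Fin n → F)} (hω : ω ∈ flagsThrough T ω₀)
    (φ : (ℕ → Submodule F (Fin n → F)) → ℝ) :
    avg (stabilizer ω₀ T) (fun g => φ (act g ω)) = avg (flagsThrough T ω₀) φ := by
  have hcomp : ∀ g g' : (Fin n → F) ≃ₗ[F] (Fin n → F), ∀ ω, act (g.trans g') ω = act g' (act g ω) :=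
    fun g g' ω => funext fun i => Submodule.map_comp _ _ _
  obtain ⟨c, hc⟩ := exists_card_left_eq (X := stabilizer ω₀ T) (B := flagsThrough T ω₀)
    (inc := fun g b => act g ω = b) (by
      intro b hb b' hb'
      obtain ⟨g', rfl, h2⟩ := exists_act_eq_of_mem hb hb'
      refine ⟨fun g => g.trans g', fun g₁ g₂ e => ?_, fun g hg e => ⟨mem_stabilizer.2 ?_, ?_⟩⟩
      · exact LinearEquiv.ext fun x => g'.injective (LinearEquiv.congr_fun e x)
      · intro t ht
        rw [hcomp, ← h2 t ht]
        exact congrArg (Submodule.map _) (mem_stabilizer.1 hg t ht)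
      · rw [hcomp, e])
  refine avg_comp_of_card_fiber (fun g hg => ?_) ?_ hc φ
  · exact (act_mem_flagsThrough (mem_stabilizer.1 hg)).2 hω
  · rw [← hc ω hω, card_pos]
    exact ⟨LinearEquiv.refl F _, mem_left.2 ⟨mem_stabilizer.2 fun t _ => Submodule.map_id _,
      funext fun i => Submodule.map_id _⟩⟩

/-- Expansion of the subspaces of the first three dimensions above a fixed partial flag. -/
theorem expands_three (h : IsFullFlag ω₀) (hr : r ∈ T) (hT : ∀ t ∈ T, t ≤ r) (hn : r + 3 ≤ n) :
    Expands.{u, v} (flagsThrough T ω₀) {r + 1, r + 2, r + 3} (1 / 23) := by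
  classical
  obtain ⟨S, hS, hcone⟩ := exists_cone.{u, v} h hr hT hn
  intro Γ _ f
  set I : Finset ℕ := {r + 1, r + 2, r + 3}
  set Ω := flagsThrough T ω₀
  let m : ((Fin n → F) ≃ₗ[F] (Fin n → F)) → Submodule F (Fin n → F) → Submodule F (Fin n → F) :=
    fun σ W => W.map (σ : (Fin n → F) →ₗ[F] (Fin n → F))
  -- One fixed cone might use mostly bad triangles. It is applied to all translates of `f`, and the
  -- solutions are carried back by `σ.symm`.
  choose g hg using fun σ => hcone Γ fun i j x y => f i j (m σ x) (m σ y)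
  let g' : ((Fin n → F) ≃ₗ[F] (Fin n → F)) → ℕ → Submodule F (Fin n → F) → Γ :=
    fun σ i x => g σ i (m σ.symm x)
  let χ : (ℕ → Submodule F (Fin n → F)) → ℝ := fun s => if TriangleBad I f s then 1 else 0
  have hχ : ∀ s, 0 ≤ χ s := fun s => by
    simp only [χ]
    split_ifs <;> norm_num
  have h1 : ∀ σ ∈ stabilizer ω₀ T, prob Ω (EdgeBad I f (g' σ)) ≤
      avg Ω fun ω => ∑ s ∈ S ω, χ (act σ s) := by
    intro σ hσ
    unfold prob
    rw [← avg_act (mem_stabilizer.1 hσ)]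
    refine avg_mono fun ω hω => ?_
    split_ifs with hbad
    · by_contra! hlt
      refine hg σ ω hω (fun s hs hb => ?_) ?_
      · have h2 : χ (act σ s) = 1 := if_pos hb
        have h3 := single_le_sum (f := fun s => χ (act σ s)) (fun s _ => hχ _) hs
        rw [h2] at h3
        exact absurd h3 (not_le.2 hlt)
      · obtain ⟨i, hi, j, hj, hij, hne⟩ := hbad
        refine ⟨i, hi, j, hj, hij, ?_⟩
        have e : ∀ i, m σ.symm (act σ ω i) = ω i := fun i => map_symm_map σ (ω i)
        simp only [g', e] at hne
        exact hne
    · exact sum_nonneg fun s _ => hχ _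
  obtain ⟨σ, hσ, h2⟩ := exists_le_avg (φ := fun σ => prob Ω (EdgeBad I f (g' σ)))
    (stabilizer_nonempty (ω₀ := ω₀) (T := T))
  refine ⟨g' σ, ?_⟩
  -- For fixed `ω` and `s ∈ S ω`, a random `σ` takes `s` to a uniform flag, so the expected number
  -- of bad triangles in the translated cone is at most `23` times the mean.
  have h3 : avg (stabilizer ω₀ T) (fun σ => prob Ω (EdgeBad I f (g' σ))) ≤
      23 * prob Ω (TriangleBad I f) := by
    refine (avg_mono h1).trans ?_
    rw [avg_comm]
    rw [← avg_const (flagsThrough_nonempty (T := T) h) (23 * prob Ω (TriangleBad I f))]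
    refine avg_mono fun ω hω => ?_
    obtain ⟨h4, h5⟩ := hS ω hω
    rw [avg_sum, sum_congr rfl fun s hs => avg_stabilizer (h4 hs) χ, sum_const, nsmul_eq_mul]
    exact mul_le_mul_of_nonneg_right (by exact_mod_cast h5) prob_nonneg
  linarith

end Cone

/-! ### Expansion for general sets of dimensions -/

section Dimensions

variable {F : Type u} [Field F] [Fintype F] {n : ℕ} {ω₀ : ℕ → Submodule F (Fin n → F)} {T : Set ℕ}

theorem mixes_link {ω : ℕ → Submodule F (Fin n → F)}
    (hω : ω ∈ flagsThrough T ω₀) {i k : ℕ} (hki : k ≠ i) (hk : k ∉ T) (hk0 : 0 < k) (hkn : k < n)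
    {lam : ℝ} (hlam : 0 ≤ lam) (hq : 2 ^ n ≤ lam ^ 2 * Fintype.card F) :
    Mixes (link (flagsThrough T ω₀) i (ω i)) k lam := by
  rw [link_flagsThrough hω]
  exact mixes_flagsThrough (mem_flagsThrough.1 hω).1 (by simp [hki, hk]) hk0 hkn hlam hq

theorem mixes_link_link {ω : ℕ → Submodule F (Fin n → F)}
    (hω : ω ∈ flagsThrough T ω₀) {i j k : ℕ} (hki : k ≠ i) (hkj : k ≠ j) (hk : k ∉ T) (hk0 : 0 < k)
    (hkn : k < n) {lam : ℝ} (hlam : 0 ≤ lam) (hq : 2 ^ n ≤ lam ^ 2 * Fintype.card F) :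
    Mixes (link (link (flagsThrough T ω₀) i (ω i)) j (ω j)) k lam := by
  have h1 := (mem_flagsThrough.1 hω).1
  rw [link_flagsThrough hω]
  exact mixes_link (mem_flagsThrough.2 ⟨h1, fun _ _ => rfl⟩) hkj (by simp [hki, hk]) hk0 hkn
    hlam hq

/-- Expansion of a colour set that is split by a fixed member of the flag. -/
theorem expands_split (h : IsFullFlag ω₀) {k : ℕ} (hk : k ∈ T) {I : Finset ℕ} (hI : #I ≤ 4)
    {i j j' : ℕ} (hi : i ∈ I) (hik : i ≤ k) (hj : j ∈ I) (hkj : k < j) (hj' : j' ∈ I)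
    (hkj' : k < j') (hne : j ≠ j') (hjn : j < n) (hjT : j ∉ T)
    (hq : 2 ^ n ≤ (1 / 2 : ℝ) ^ 2 * Fintype.card F) :
    Expands.{u, v} (flagsThrough T ω₀) I (1 / 26) := by
  refine Expands.of_splice (flagsThrough_nonempty h)
    (fun ω hω ω' hω' => splice_mem_flagsThrough hk hω hω') hI hi hik hj hj' hkj hkj' hne ?_
  intro i' _ hi'k ω hω
  exact mixes_link hω (by omega) hjT (by omega) hjn (by norm_num) hq

/-- Expansion of three dimensions above a fixed partial flag of dimensions at most `r`, with a
constant that depends on the first dimension only. -/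
theorem expands_above (a : ℕ) : ∀ (ω₀ : ℕ → Submodule F (Fin n → F)) (T : Set ℕ) (r b c : ℕ),
    IsFullFlag ω₀ → r ∈ T → (∀ t ∈ T, t ≤ r) → 1 ≤ a → r + a + 3 ≤ b → b < c → c < n →
    2 ^ n ≤ (1 / 2 : ℝ) ^ 2 * Fintype.card F →
    Expands.{u, v} (flagsThrough T ω₀) {r + a, b, c} (1 / 26 * (1 / 46000) ^ a) := by
  induction a using Nat.strong_induction_on with
  | _ a ih =>
  intro ω₀ T r b c h hr hT ha hab hbc hcn hq
  have hnot : ∀ k, r < k → k ∉ T := fun k hk hkT => absurd (hT k hkT) (by omega)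
  have hI : #({r + a, b, c} : Finset ℕ) ≤ 4 := card_le_three.trans (by norm_num)
  have hK : #({r + 1, r + 2, r + 3} : Finset ℕ) = 3 :=
    card_eq_three.2 ⟨_, _, _, by omega, by omega, by omega, rfl⟩
  obtain ⟨d, rfl⟩ : ∃ d, a = d + 1 := ⟨a - 1, by omega⟩
  have hpow : ∀ e ≤ d, (1 / 26 * (1 / 46000) ^ d : ℝ) ≤ 1 / 26 * (1 / 46000) ^ e := fun e he =>
    mul_le_mul_of_nonneg_left (pow_le_pow_of_le_one (by norm_num) (by norm_num) he) (by norm_num)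
  -- If `k` is at least `r + a`, it separates that dimension from `b` and `c`, since `k ≤ r + 3 <
  -- b`, and the link is a join. Otherwise the lowest dimension is nearer to the fixed part and the
  -- induction hypothesis applies.
  have hloc : ∀ k ∈ ({r + 1, r + 2, r + 3} : Finset ℕ), ∀ ω ∈ flagsThrough T ω₀,
      Expands.{u, v} (link (flagsThrough T ω₀) k (ω k)) {r + (d + 1), b, c}
        (1 / 26 * (1 / 46000) ^ d) := by
    intro k hk ω hω
    have hω1 := (mem_flagsThrough.1 hω).1
    have hk' : r < k ∧ k ≤ r + 3 := by
      simp only [mem_insert, mem_singleton] at hk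
      omega
    rw [link_flagsThrough hω]
    rcases le_or_gt (r + (d + 1)) k with hak | hka
    · refine (expands_split hω1 (Set.mem_insert k T) hI (i := r + (d + 1)) (j := b) (j' := c)
        (by simp) hak (by simp) (by omega) (by simp) (by omega) hbc.ne (by omega) ?_ hq).mono
        (by simpa using hpow 0 (Nat.zero_le d))
      rw [Set.mem_insert_iff, not_or]
      exact ⟨by omega, hnot b (by omega)⟩
    · have := ih (r + (d + 1) - k) (by omega) ω (insert k T) k b c hω1 (Set.mem_insert k T)
        (by
          rintro t (rfl | ht)
          · exact le_rfl
          · exact (hT t ht).trans hk'.1.le) (by omega) (by omega) hbc hcn hq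
      rw [show k + (r + (d + 1) - k) = r + (d + 1) by omega] at this
      exact this.mono (hpow _ (by omega))
  -- Each step loses `23` from the nerve and `2000` from gluing, whence `46000`.
  have hmain := Expands.of_nerve (by positivity) (by norm_num) (by norm_num) hK
    ⟨b, by simp⟩ hI hloc (expands_three.{u, v} h hr hT (by omega)) ?_ ?_
  · refine hmain.mono (le_of_eq ?_)
    rw [pow_succ]
    ring
  · intro k hk l hl hkl ω hω
    simp only [mem_insert, mem_singleton] at hk hl
    exact ⟨b, by simp, c, by simp, hbc.ne, mixes_link_link hω (by omega) (by omega)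
      (hnot b (by omega)) (by omega) (by omega) (by norm_num) hq⟩
  · intro i hi ω hω
    by_cases hi1 : i = r + 1
    · exact ⟨r + 2, by simp, r + 1, by simp, by omega, mixes_link hω (by omega)
        (hnot _ (by omega)) (by omega) (by omega) (by norm_num) hq⟩
    · exact ⟨r + 1, by simp, r + 2, by simp, by omega, mixes_link hω (by omega)
        (hnot _ (by omega)) (by omega) (by omega) (by norm_num) hq⟩

/-- Expansion of four dimensions in a random complete flag. -/
theorem expands_four (h : IsFullFlag ω₀) {i₀ i₁ i₂ i₃ : ℕ} (h0 : 1 ≤ i₀) (h1 : i₀ + 3 ≤ i₁)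
    (h2 : i₁ + 3 ≤ i₂) (h3 : i₂ + 3 ≤ i₃) (hn : i₃ < n)
    (hq : 2 ^ n ≤ ((1 / 10 ^ 6) * (1 / 46000) ^ n : ℝ) ^ 2 * Fintype.card F) :
    Expands.{u, v} (flagsThrough {0} ω₀) {i₀, i₁, i₂, i₃} (1 / 26 / 1000) := by
  -- The nerve will have constant `(1 / 46000) ^ (i₀ + 1) / 26`. As `i₀ + 1 ≤ n`, this `lam` is
  -- small enough for `Expands.of_nerve_of_mixes`, with `1 / 26` as the constant of the links.
  set lam : ℝ := (1 / 10 ^ 6) * (1 / 46000) ^ n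
  have hlam : 0 ≤ lam := by positivity
  have hpow1 : ((1 / 46000) ^ n : ℝ) ≤ 1 := pow_le_one₀ (by norm_num) (by norm_num)
  have hpow2 : ((1 / 46000) ^ n : ℝ) ≤ (1 / 46000) ^ (i₀ + 1) :=
    pow_le_pow_of_le_one (by norm_num) (by norm_num) (by omega)
  have hpow0 : (0 : ℝ) < (1 / 46000) ^ n := by positivity
  have hlam2 : 1500000 * lam ^ 2 ≤ 1 / 26 * (1 / 26 * (1 / 46000) ^ (i₀ + 1)) := by
    simp only [lam]
    nlinarith
  have hq' : 2 ^ n ≤ (1 / 2 : ℝ) ^ 2 * Fintype.card F := by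
    refine hq.trans (mul_le_mul_of_nonneg_right (pow_le_pow_left₀ hlam ?_ 2) (Nat.cast_nonneg _))
    simp only [lam]
    linarith
  have hI : #({i₀, i₁, i₂, i₃} : Finset ℕ) ≤ 4 := card_le_four
  -- Each of these dimensions misses `I` and has `i₀` below it and `i₂`, `i₃` above it, so its links
  -- are joins. The gap of three gives `(i₀ + 1) + 3 ≤ i₁ + 1`, as `expands_above` demands.
  have hK : #({i₀ + 1, i₁ + 1, i₁ + 2} : Finset ℕ) = 3 :=
    card_eq_three.2 ⟨_, _, _, by omega, by omega, by omega, rfl⟩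
  have hKb : ∀ k ∈ ({i₀ + 1, i₁ + 1, i₁ + 2} : Finset ℕ),
      i₀ < k ∧ k < i₂ ∧ k ≠ i₁ ∧ k ∉ ({0} : Set ℕ) := by
    intro k hk
    simp only [mem_insert, mem_singleton] at hk
    simp only [Set.mem_singleton_iff]
    omega
  have hnerve : Expands.{u, v} (flagsThrough {0} ω₀) {i₀ + 1, i₁ + 1, i₁ + 2}
      (1 / 26 * (1 / 46000) ^ (i₀ + 1)) := by
    have := expands_above.{u, v} (i₀ + 1) ω₀ {0} 0 (i₁ + 1) (i₁ + 2) h rfl (by simp) (by omega)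
      (by omega) (by omega) (by omega) hq'
    rwa [zero_add] at this
  refine Expands.of_nerve_of_mixes (by norm_num) (by norm_num) (by positivity) hlam hlam2 hK
    ⟨i₀, by simp⟩ hI ?_ ?_ hnerve ?_ ?_ ?_ ?_ ?_
  · intro k hk hkI
    have := hKb k hk
    simp only [mem_insert, mem_singleton] at hkI
    omega
  · intro k hk ω hω
    obtain ⟨k1, k2, k3, k4⟩ := hKb k hk
    rw [link_flagsThrough hω]
    refine expands_split (mem_flagsThrough.1 hω).1 (Set.mem_insert k _) hI (i := i₀) (j := i₂)
      (j' := i₃) (by simp) k1.le (by simp) k2 (by simp) (by omega) (by omega) (by omega) ?_ hq'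
    simp only [Set.mem_insert_iff, Set.mem_singleton_iff]
    omega
  · intro k hk l hl _ ω hω
    have k1 := hKb k hk
    have l1 := hKb l hl
    exact ⟨i₂, by simp, i₃, by simp, by omega, mixes_link_link hω (by omega) (by omega)
      (by simp; omega) (by omega) (by omega) (by norm_num) hq'⟩
  · intro i hi ω hω
    simp only [mem_insert, mem_singleton] at hi
    exact ⟨i₀ + 1, by simp, i₁ + 1, by simp, by omega, mixes_link hω (by omega)
      (by simp) (by omega) (by omega) (by norm_num) hq'⟩
  · intro k hk
    have k1 := hKb k hk
    exact mixes_flagsThrough h k1.2.2.2 (by omega) (by omega) hlam hq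
  · intro k hk l hl hkl ω hω
    have k1 := hKb k hk
    have l1 := hKb l hl
    exact mixes_link hω (by omega) l1.2.2.2 (by omega) (by omega) hlam hq
  · intro k hk l hl m hm hkl hkm hlm ω hω
    have m1 := hKb m hm
    exact mixes_link_link hω hkm.symm hlm.symm m1.2.2.2 (by omega) (by omega) hlam hq

end Dimensions

/-! ### From families of flags to the spherical building -/

section Building

open Module

theorem sum_colorRestrict {V : Type u} {colors : Finset ℕ} (X : PartiteComplex V colors)
    (c : Finset ℕ) (φ : Finset V → ℝ) :
    ∑ t ∈ (X.colorRestrict c).top, (X.colorRestrict c).weight t * φ t =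
      ∑ s ∈ X.top, X.weight s * φ (X.colorPart c s) := by
  classical
  have hm : ∀ s ∈ X.top, X.colorPart c s ∈ (X.colorRestrict c).top := fun s hs =>
    mem_image_of_mem _ hs
  rw [← sum_fiberwise_of_maps_to hm]
  refine sum_congr rfl fun t _ => ?_
  change (∑ s ∈ X.top.filter (fun s => X.colorPart c s = t), X.weight s) * φ t = _
  rw [sum_mul]
  refine sum_congr rfl fun s hs => ?_
  rw [(mem_filter.1 hs).2]

variable {F : Type u} [Field F] {n : ℕ}

open scoped Classical in
/-- The members of a flag in the dimensions in `I`. -/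
def face (I : Finset ℕ) (ω : ℕ → Submodule F (Fin n → F)) : Finset (Submodule F (Fin n → F)) :=
  I.image ω

theorem mem_face {I : Finset ℕ} {ω : ℕ → Submodule F (Fin n → F)} {W : Submodule F (Fin n → F)} :
    W ∈ face I ω ↔ ∃ i ∈ I, ω i = W := by
  simp [face]

theorem IsFullFlag.finrank_of_mem {ω : ℕ → Submodule F (Fin n → F)} (h : IsFullFlag ω) {I : Finset ℕ}
    (hI : I ⊆ Ioo 0 n) {i : ℕ} (hi : i ∈ I) : finrank F (ω i) = i :=
  h.finrank_eq (mem_Ioo.1 (hI hi)).2.le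

theorem face_injOn :
    Set.InjOn (face (F := F) (n := n) (Ioo 0 n)) {ω | IsFullFlag ω} := by
  intro ω hω ω' hω' e
  ext1 i
  rcases Nat.eq_zero_or_pos i with rfl | hi
  · rw [IsFullFlag.eq_bot hω, IsFullFlag.eq_bot hω']
  · rcases lt_or_ge i n with hin | hin
    · have h1 : ω i ∈ face (Ioo 0 n) ω' := e ▸ mem_face.2 ⟨i, mem_Ioo.2 ⟨hi, hin⟩, rfl⟩
      obtain ⟨j, hj, e'⟩ := mem_face.1 h1
      have h2 := IsFullFlag.finrank_of_mem hω' Subset.rfl hj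
      rw [e', IsFullFlag.finrank_eq hω hin.le] at h2
      rw [← e', h2]
    · rw [IsFullFlag.eq_top hω hin, IsFullFlag.eq_top hω' hin]

variable [Fintype F]

theorem face_mem_completeFlags {ω : ℕ → Submodule F (Fin n → F)} (h : IsFullFlag ω) :
    face (Ioo 0 n) ω ∈ completeFlags F n := by
  classical
  refine mem_completeFlags.2 ⟨⟨?_, ?_⟩, ?_⟩
  · intro W hW
    obtain ⟨i, hi, rfl⟩ := mem_face.1 hW
    have h1 := h.finrank_of_mem Subset.rfl hi
    have h2 := mem_Ioo.1 hi
    constructor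
    · intro e
      rw [e, finrank_bot] at h1
      omega
    · intro e
      rw [e, finrank_top, finrank_fin_fun] at h1
      omega
  · intro W hW W' hW' _
    obtain ⟨i, hi, rfl⟩ := mem_face.1 hW
    obtain ⟨j, hj, rfl⟩ := mem_face.1 hW'
    exact (le_total i j).imp (fun hij => h.1 hij) fun hij => h.1 hij
  · rw [face, card_image_of_injOn, Nat.card_Ioo, Nat.sub_zero]
    intro i hi j hj e
    rw [← h.finrank_of_mem Subset.rfl hi, ← h.finrank_of_mem Subset.rfl hj, e]

theorem exists_face_eq {s : Finset (Submodule F (Fin n → F))} (hs : s ∈ completeFlags F n) :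
    ∃ ω, IsFullFlag ω ∧ face (Ioo 0 n) ω = s := by
  obtain ⟨h1, h2, h3⟩ := bijOn_completeFlags hs
  have hchain := (mem_completeFlags.1 hs).1.2
  have : ∀ i, ∃ W : Submodule F (Fin n → F), (finrank F W = min i n) ∧
      ((0 < i ∧ i < n ∧ W ∈ s) ∨ i = 0 ∨ n ≤ i) := by
    intro i
    by_cases hi : 0 < i ∧ i < n
    · obtain ⟨W, hW, e⟩ := h3 (show i ∈ (Ioo 0 n : Set ℕ) by simpa using hi)
      exact ⟨W, by rw [min_eq_left hi.2.le]; exact e, Or.inl ⟨hi.1, hi.2, hW⟩⟩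
    · rcases Nat.eq_zero_or_pos i with rfl | hi0
      · exact ⟨⊥, by simp, by simp⟩
      · exact ⟨⊤, by rw [finrank_top, finrank_fin_fun]; omega, by omega⟩
  choose ω hω1 hω2 using this
  have hmono : Monotone ω := by
    intro i j hij
    rcases hω2 i with ⟨hi0, hin, hi⟩ | hi | hi
    · rcases hω2 j with ⟨hj0, hjn, hj⟩ | hj | hj
      · rcases hchain.total hi hj with hle | hle
        · exact hle
        · refine (Submodule.eq_of_le_of_finrank_le hle ?_).ge
          rw [hω1, hω1]
          omega
      · omega
      · rw [Submodule.eq_top_of_finrank_eq (S := ω j) (by rw [hω1, finrank_fin_fun]; omega)]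
        exact le_top
    · rw [Submodule.finrank_eq_zero.1 (show finrank F (ω i) = 0 by rw [hω1]; omega)]
      exact bot_le
    · rw [Submodule.eq_top_of_finrank_eq (S := ω j) (by rw [hω1, finrank_fin_fun]; omega)]
      exact le_top
  refine ⟨ω, ⟨hmono, hω1⟩, ?_⟩
  ext W
  rw [mem_face]
  constructor
  · rintro ⟨i, hi, rfl⟩
    have := mem_Ioo.1 hi
    rcases hω2 i with h | h | h
    · exact h.2.2
    · omega
    · omega
  · intro hW
    have hi := h1 hW
    simp only [coe_Ioo, Set.mem_Ioo] at hi
    refine ⟨finrank F W, mem_Ioo.2 hi, ?_⟩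
    rcases hω2 (finrank F W) with h | h | h
    · refine h2 h.2.2 hW ?_
      change finrank F (ω (finrank F W)) = finrank F W
      rw [hω1]
      omega
    · omega
    · omega

theorem colorPart_face {ω : ℕ → Submodule F (Fin n → F)} (h : IsFullFlag ω) {I : Finset ℕ}
    (hI : I ⊆ Ioo 0 n) : (sphericalBuilding F n).colorPart I (face (Ioo 0 n) ω) = face I ω := by
  classical
  ext W
  simp only [PartiteComplex.colorPart, mem_filter, mem_face]
  change (_ ∧ finrank F W ∈ I) ↔ _
  constructor
  · rintro ⟨⟨i, hi, rfl⟩, h2⟩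
    rw [h.finrank_of_mem Subset.rfl hi] at h2
    exact ⟨i, h2, rfl⟩
  · rintro ⟨i, hi, rfl⟩
    exact ⟨⟨i, hI hi, rfl⟩, by rwa [h.finrank_of_mem hI hi]⟩

theorem face_mem_top {ω : ℕ → Submodule F (Fin n → F)} (h : IsFullFlag ω) {I : Finset ℕ}
    (hI : I ⊆ Ioo 0 n) : face I ω ∈ ((sphericalBuilding F n).colorRestrict I).top := by
  classical
  rw [← colorPart_face h hI]
  exact mem_image_of_mem _ (face_mem_completeFlags h)

variable {ω₀ : ℕ → Submodule F (Fin n → F)}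

/-- Fixing the zero subspace is no condition, so the family of all complete flags fits the same
format as its links. -/
theorem mem_flagsThrough_zero (h : IsFullFlag ω₀) {ω : ℕ → Submodule F (Fin n → F)} :
    ω ∈ flagsThrough {0} ω₀ ↔ IsFullFlag ω := by
  rw [mem_flagsThrough]
  refine and_iff_left_of_imp fun hω t ht => ?_
  rw [Set.mem_singleton_iff.1 ht, hω.eq_bot, h.eq_bot]

/-- A random top-level face of a colour restriction of the building consists of the members of a
random complete flag. -/
theorem sum_building (h : IsFullFlag ω₀) {I : Finset ℕ} (hI : I ⊆ Ioo 0 n)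
    (φ : Finset (Submodule F (Fin n → F)) → ℝ) :
    ∑ t ∈ ((sphericalBuilding F n).colorRestrict I).top,
      ((sphericalBuilding F n).colorRestrict I).weight t * φ t =
      avg (flagsThrough {0} ω₀) fun ω => φ (face I ω) := by
  classical
  have himage : completeFlags F n = (flagsThrough {0} ω₀).image (face (Ioo 0 n)) := by
    ext s
    rw [mem_image]
    constructor
    · intro hs
      obtain ⟨ω, hω, e⟩ := exists_face_eq hs
      exact ⟨ω, (mem_flagsThrough_zero h).2 hω, e⟩
    · rintro ⟨ω, hω, rfl⟩
      exact face_mem_completeFlags ((mem_flagsThrough_zero h).1 hω)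
  have hinj : Set.InjOn (face (Ioo 0 n)) (flagsThrough {0} ω₀ : Set _) := fun ω hω ω' hω' e =>
    face_injOn ((mem_flagsThrough_zero h).1 hω) ((mem_flagsThrough_zero h).1 hω') e
  rw [sum_colorRestrict]
  change ∑ s ∈ completeFlags F n, 1 / (#(completeFlags F n) : ℝ) * _ = _
  rw [← mul_sum, himage, sum_image hinj, card_image_of_injOn hinj, avg, one_div,
    div_eq_inv_mul]
  congr 1
  refine sum_congr rfl fun ω hω => ?_
  rw [colorPart_face ((mem_flagsThrough_zero h).1 hω) hI]

theorem edgeProb_le (h : IsFullFlag ω₀) {I : Finset ℕ} (hI : I ⊆ Ioo 0 n)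
    {P : Submodule F (Fin n → F) × Submodule F (Fin n → F) → Prop}
    {Q : (ℕ → Submodule F (Fin n → F)) → Prop}
    (hPQ : ∀ ω, IsFullFlag ω → ¬Q ω →
      ∀ x y, (x, y) ∈ WeightedComplex.orientedEdges (face I ω) → ¬P (x, y)) :
    WeightedComplex.edgeProb ((sphericalBuilding F n).colorRestrict I).toWeightedComplex P ≤
      prob (flagsThrough {0} ω₀) Q := by
  classical
  refine (sum_building h hI _).trans_le (avg_mono fun ω hω => ?_)
  split_ifs with hQ
  · exact div_le_one_of_le₀ (by exact_mod_cast card_filter_le _ _) (Nat.cast_nonneg _)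
  · rw [filter_false_of_mem fun p hp => hPQ ω ((mem_flagsThrough_zero h).1 hω) hQ p.1 p.2 hp]
    simp

/-- A face has at most `4 ^ 3 = 64` oriented triangles, so a single bad one has conditional
probability at least `1 / 64`. -/
theorem le_triangleProb (h : IsFullFlag ω₀) {I : Finset ℕ} (hI : I ⊆ Ioo 0 n) (hI4 : #I ≤ 4)
    {P : Submodule F (Fin n → F) × Submodule F (Fin n → F) × Submodule F (Fin n → F) → Prop}
    {Q : (ℕ → Submodule F (Fin n → F)) → Prop}
    (hPQ : ∀ ω, IsFullFlag ω → Q ω →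
      ∃ x y z, (x, y, z) ∈ WeightedComplex.orientedTriangles (face I ω) ∧ P (x, y, z)) :
    prob (flagsThrough {0} ω₀) Q ≤
      64 * WeightedComplex.triangleProb
        ((sphericalBuilding F n).colorRestrict I).toWeightedComplex P := by
  classical
  refine le_trans ?_ (congrArg (64 * ·) (sum_building h hI _)).ge
  rw [← avg_mul_left]
  refine avg_mono fun ω hω => ?_
  split_ifs with hQ
  · obtain ⟨x, y, z, hmem, hP⟩ := hPQ ω ((mem_flagsThrough_zero h).1 hω) hQ
    have hpos := card_pos.2 ⟨_, mem_filter.2 ⟨hmem, hP⟩⟩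
    have h4 : #(face I ω) ≤ 4 := card_image_le.trans hI4
    have hle : #(WeightedComplex.orientedTriangles (face I ω)) ≤ 64 := by
      refine (card_filter_le _ _).trans ?_
      rw [card_product, card_product]
      calc #(face I ω) * (#(face I ω) * #(face I ω)) ≤ 4 * (4 * 4) := by gcongr
        _ = 64 := by norm_num
    have hpos' : (0 : ℝ) < #(WeightedComplex.orientedTriangles (face I ω)) := by
      exact_mod_cast card_pos.2 ⟨_, hmem⟩
    rw [mul_div_assoc', le_div_iff₀ hpos', one_mul]
    refine le_trans (by exact_mod_cast hle) (le_mul_of_one_le_right (by norm_num) ?_)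
    exact_mod_cast hpos
  · positivity

/-- Expansion of the coordinates of a random complete flag gives cosystolic expansion of the colour
restriction of the building. -/
theorem isCosystolicExpander_of_expands (h : IsFullFlag ω₀) {I : Finset ℕ} (hI : I ⊆ Ioo 0 n)
    (hI4 : #I ≤ 4) {β : ℝ} (hβ : 0 < β) (hexp : Expands.{u, v} (flagsThrough {0} ω₀) I β) :
    WeightedComplex.IsCosystolicExpander.{u, v}
      ((sphericalBuilding F n).colorRestrict I).toWeightedComplex (β / 64) := by
  classical
  refine ⟨by positivity, fun Γ _ f hf => ?_⟩
  obtain ⟨g, hg⟩ := hexp Γ fun _ _ x y => f x y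
  -- The cocycle is even a coboundary. A vertex determines its colour, its dimension, so the
  -- coloured functions `g i` combine into one vertex function.
  refine ⟨fun x y => (g (finrank F x) x)⁻¹ * g (finrank F y) y, ⟨?_, ?_⟩, ?_⟩
  · intro x y _ _
    group
  · intro x y z _ _ _ _
    simp only [WeightedComplex.coboundary]
    group
  have hsymm : ∀ {ω}, IsFullFlag ω → ∀ {i j}, i ∈ I → j ∈ I → i ≠ j →
      f (ω i) (ω j) = (f (ω j) (ω i))⁻¹ := by
    intro ω hω i j hi hj hij
    refine hf _ _ (fun e => hij ?_) ⟨_, face_mem_top hω hI, ?_⟩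
    · rw [← hω.finrank_of_mem hI hi, e, hω.finrank_of_mem hI hj]
    · simp only [insert_subset_iff, singleton_subset_iff, mem_face]
      exact ⟨⟨i, hi, rfl⟩, j, hj, rfl⟩
  have hedge : WeightedComplex.edgeDist
      ((sphericalBuilding F n).colorRestrict I).toWeightedComplex f
      (fun x y => (g (finrank F x) x)⁻¹ * g (finrank F y) y) ≤
      prob (flagsThrough {0} ω₀) (EdgeBad I (fun _ _ x y => f x y) g) := by
    refine edgeProb_le h hI fun ω hω hbad x y hxy => ?_
    simp only [WeightedComplex.orientedEdges, mem_filter, mem_product, mem_face] at hxy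
    obtain ⟨⟨⟨i, hi, rfl⟩, j, hj, rfl⟩, hne⟩ := hxy
    have hok : ∀ i ∈ I, ∀ j ∈ I, i < j → f (ω i) (ω j) = (g i (ω i))⁻¹ * g j (ω j) := by
      intro i hi j hj hij
      by_contra hcon
      exact hbad ⟨i, hi, j, hj, hij, hcon⟩
    have hij : i ≠ j := fun e => hne (by rw [e])
    simp only [not_not]
    rw [hω.finrank_of_mem hI hi, hω.finrank_of_mem hI hj]
    rcases hij.lt_or_gt with hlt | hlt
    · exact hok i hi j hj hlt
    · rw [hsymm hω hi hj hij, hok j hj i hi hlt]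
      group
  have htri : prob (flagsThrough {0} ω₀) (TriangleBad I fun _ _ x y => f x y) ≤
      64 * WeightedComplex.coboundaryWeight
        ((sphericalBuilding F n).colorRestrict I).toWeightedComplex f := by
    refine le_triangleProb h hI hI4 fun ω hω hbad => ?_
    obtain ⟨i, hi, j, hj, k, hk, hij, hjk, hne⟩ := hbad
    have hinj : ∀ {i j}, i ∈ I → j ∈ I → i ≠ j → ω i ≠ ω j := by
      intro i j hi hj hij e
      exact hij (by rw [← hω.finrank_of_mem hI hi, e, hω.finrank_of_mem hI hj])
    refine ⟨ω i, ω j, ω k, ?_, fun e => hne ?_⟩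
    · simp only [WeightedComplex.orientedTriangles, mem_filter, mem_product, mem_face]
      exact ⟨⟨⟨i, hi, rfl⟩, ⟨j, hj, rfl⟩, k, hk, rfl⟩, hinj hi hj hij.ne, hinj hj hk hjk.ne,
        hinj hi hk (hij.trans hjk).ne⟩
    · simp only [WeightedComplex.coboundary] at e
      rw [hsymm hω hk hi (hij.trans hjk).ne', mul_inv_eq_one] at e
      exact e
  have h1 := mul_le_mul_of_nonneg_left hedge hβ.le
  linarith

end Building

end FlagFamily

end

/-! ### The lemma -/

theorem mainTheorem8 :
    ∃ C : ℝ, 0 < C ∧ ∀ n : ℕ, ∃ q₀ : ℕ, ∀ (F : Type u) [Field F] [Fintype F],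
      q₀ ≤ Fintype.card F →
      ∀ i₀ i₁ i₂ i₃ : ℕ, 1 ≤ i₀ → i₀ + 3 ≤ i₁ → i₁ + 3 ≤ i₂ → i₂ + 3 ≤ i₃ → 21 < i₃ → i₃ < n →
        WeightedComplex.IsCosystolicExpander.{u, v}
          ((sphericalBuilding F n).colorRestrict {i₀, i₁, i₂, i₃}).toWeightedComplex
          (Real.exp (-(C * (1 + Real.log ((i₃ : ℝ) / ((i₁ : ℝ) - (i₀ : ℝ))) *
            Real.log ((i₃ : ℝ) / (i₁ : ℝ)))))) := by
  -- The constant is `26 * 1000 * 64`: expansion of four dimensions, then passage to oriented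
  -- triangles. The product of logarithms is nonnegative, so the required bound is at most `1 /
  -- 1664000`.
  refine ⟨Real.log 1664000, Real.log_pos (by norm_num), fun n => ?_⟩
  set lam : ℝ := (1 / 10 ^ 6) * (1 / 46000) ^ n
  have hlam : 0 < lam := by positivity
  refine ⟨⌈2 ^ n / lam ^ 2⌉₊, fun F _ _ hq i₀ i₁ i₂ i₃ h0 h1 h2 h3 _ hn => ?_⟩
  have hq' : 2 ^ n ≤ lam ^ 2 * Fintype.card F := by
    have := Nat.ceil_le.1 hq
    rwa [div_le_iff₀' (by positivity)] at this
  obtain ⟨ω₀, hω₀⟩ := FlagFamily.exists_isFullFlag (F := F) (n := n)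
  have hexp := FlagFamily.expands_four.{u, v} hω₀ h0 h1 h2 h3 hn hq'
  have hI : ({i₀, i₁, i₂, i₃} : Finset ℕ) ⊆ Ioo 0 n := by
    intro i hi
    simp only [mem_insert, mem_singleton] at hi
    rw [mem_Ioo]
    omega
  have c0 : (1 : ℝ) ≤ i₀ := by exact_mod_cast h0
  have c1 : (i₀ : ℝ) + 3 ≤ i₁ := by exact_mod_cast h1
  have c2 : (i₁ : ℝ) ≤ i₃ := by exact_mod_cast (by omega : i₁ ≤ i₃)
  have l1 : 0 ≤ Real.log ((i₃ : ℝ) / ((i₁ : ℝ) - (i₀ : ℝ))) :=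
    Real.log_nonneg ((one_le_div (by linarith)).2 (by linarith))
  have l2 : 0 ≤ Real.log ((i₃ : ℝ) / (i₁ : ℝ)) :=
    Real.log_nonneg ((one_le_div (by linarith)).2 c2)
  set E := Real.exp (-(Real.log 1664000 * (1 + Real.log ((i₃ : ℝ) / ((i₁ : ℝ) - (i₀ : ℝ))) *
    Real.log ((i₃ : ℝ) / (i₁ : ℝ)))))
  have hE : E ≤ 1 / 1664000 := by
    have h4 : E ≤ Real.exp (-Real.log 1664000) := by
      refine Real.exp_le_exp.2 (neg_le_neg (le_mul_of_one_le_right ?_ ?_))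
      · exact Real.log_nonneg (by norm_num)
      · exact le_add_of_nonneg_right (mul_nonneg l1 l2)
    rwa [Real.exp_neg, Real.exp_log (by norm_num), ← one_div] at h4
  have hE0 : 0 < E := Real.exp_pos _
  have := FlagFamily.isCosystolicExpander_of_expands.{u, v} hω₀ hI card_le_four
    (by positivity : 0 < 64 * E) (hexp.mono (by linarith))
  rwa [mul_div_cancel_left₀ E (by norm_num : (64 : ℝ) ≠ 0)] at this
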